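/- Let $X$ be a smooth (Hausdorff) 4-manifold, let $E\to X$ be a smooth real vector bundle of rank 3 with a smooth fibrewise inner product (for example an $SO(3)$-bundle), and let $A$ be a smooth metric connection in $E$ with curvature $F_A\in\Omega^2(X,\mathfrak{so}(E))$. Give $\mathfrak{so}(E)$ the inner product $\langle\xi,\eta\rangle=-\operatorname{tr}(\xi\eta)$ (minus the Killing form), for $\xi\in\mathfrak{so}(E_x)$ write $F_A(\xi)=\langle F_A(\cdot,\cdot),\xi\rangle\in\Lambda^2T_x^*X$, and put $\mu_A=-\tfrac13\operatorname{tr}(F_A\wedge F_A)=\tfrac{8\pi^2}{3}p_1(A)$, so that $\mu_A=\frac13\sum_i F_A(e_i)\wedge F_A(e_i)$ for any local orthonormal frame $e_1,e_2,e_3$ of $\mathfrak{so}(E)$. Assume that $A$ is perfect, that is: * $A$ is definite: $F_A(u,v)\neq0$ whenever $u,v$ are linearly independent tangent vectors at a point; and * $F_A$ maps $\mathfrak{so}(E)^*\cong\mathfrak{so}(E)$ isometrically onto its image $\Lambda^+_A\subset\Lambda^2$, that is, $F_A(\xi)\wedge F_A(\eta)=\langle\xi,\eta\rangle\,\mu_A$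 for all $x\in X$ and $\xi,\eta\in\mathfrak{so}(E_x)$. Then there is a unique smooth Riemannian metric $g_A$ on $X$ such that, for the orientation of $X$ in which $\mu_A$ is positive, $\mu_A$ is the volume form of $g_A$ and the self-dual 2-forms of $g_A$ at each $x\in X$ are exactly the forms $F_A(\xi)$, $\xi\in\mathfrak{so}(E_x)$. For this orientation the metric $g_A$ is anti-self-dual ($W^+=0$). It is Einstein ($\mathrm{Ric}=c\,g_A$ with $c$ constant on each connected component of $X$), and its scalar curvature vanishes nowhere. -/

import Mathlib

open Bundle Filter
open scoped Manifold ContDiff Topology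

noncomputable section

set_option linter.unusedSectionVars false

namespace CovariantDerivative

section Curvature

variable {B : Type*} [NormedAddCommGroup B] [NormedSpace ℝ B] [FiniteDimensional ℝ B]
  {H : Type*} [TopologicalSpace H] {I : ModelWithCorners ℝ B H}
  {M : Type*} [TopologicalSpace M] [ChartedSpace H M] [IsManifold I ∞ M] [T2Space M]
  {F : Type*} [NormedAddCommGroup F] [NormedSpace ℝ F]
  {V : M → Type*} [TopologicalSpace (TotalSpace F V)]
  [∀ x, AddCommGroup (V x)] [∀ x, Module ℝ (V x)] [∀ x, TopologicalSpace (V x)]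
  [∀ x, IsTopologicalAddGroup (V x)] [∀ x, ContinuousSMul ℝ (V x)]
  [FiberBundle F V] [VectorBundle ℝ F V] [ContMDiffVectorBundle ∞ F V I]

/-- `∇_X ∇_Y σ - ∇_Y ∇_X σ - ∇_[X,Y] σ` at the point `x`. -/
def curvatureAux (A : CovariantDerivative I F V) (x : M) (X Y : Π y : M, TangentSpace I y)
    (σ : Π y : M, V y) : V x :=
  A (fun y => A σ y (Y y)) x (X x) - A (fun y => A σ y (X y)) x (Y x)
    - A σ x (VectorField.mlieBracket I X Y x)

/-- For a smooth connection, `∇ σ` is smooth near `x` when `σ` is. -/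
lemma contMDiffAt_apply (A : CovariantDerivative I F V) [hA : ContMDiffCovariantDerivative A ∞]
    {x : M} {u : Set M} (hu : IsOpen u) (hx : x ∈ u) {σ : Π y : M, V y}
    (hσ : ContMDiffOn I (I.prod 𝓘(ℝ, F)) ∞ (fun y => TotalSpace.mk' F y (σ y)) u) :
    ContMDiffAt I (I.prod 𝓘(ℝ, B →L[ℝ] F)) ∞
      (fun y => (⟨y, A σ y⟩ : TotalSpace (B →L[ℝ] F) fun y => TangentSpace I y →L[ℝ] V y)) x := by
  have : ContMDiffVectorBundle 1 F V I := .of_le (n := ∞) (by simp)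
  obtain ⟨f, -, hf⟩ :=
    (SmoothBumpFunction.nhds_basis_tsupport (I := I) x).mem_iff.1 (hu.mem_nhds hx)
  have h1 : ContMDiff I (I.prod 𝓘(ℝ, F)) (∞ + 1)
      (fun y => TotalSpace.mk' F y (((f : M → ℝ) • σ) y)) :=
    ContMDiffOn.smul_section_of_tsupport f.contMDiff.contMDiffOn hu hf hσ
  have h2 := (hA.contMDiff.contMDiff h1.contMDiffOn).contMDiffAt (x := x) univ_mem
  refine h2.congr_of_eventuallyEq ?_
  filter_upwards [f.eventuallyEq_one.eventually_nhds, hu.mem_nhds hx] with y hy hyu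
  have h3 : A σ y = A ((f : M → ℝ) • σ) y := by
    refine A.isCovariantDerivativeOnUniv.congr_of_eventuallyEq ?_ ?_ univ_mem ?_
    · exact (hσ.contMDiffAt (hu.mem_nhds hyu)).mdifferentiableAt (by simp)
    · exact (h1.contMDiffAt).mdifferentiableAt (by simp)
    · filter_upwards [hy] with z hz
      simp [hz]
  rw [h3]

variable [FiniteDimensional ℝ F]

lemma mdifferentiableAt_apply (A : CovariantDerivative I F V)
    [ContMDiffCovariantDerivative A ∞] {x : M} {u : Set M} (hu : IsOpen u) (hx : x ∈ u)
    {σ : Π y : M, V y}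
    (hσ : ContMDiffOn I (I.prod 𝓘(ℝ, F)) ∞ (fun y => TotalSpace.mk' F y (σ y)) u)
    {Y : Π y : M, TangentSpace I y} (hY : MDiffAt (T% Y) x) :
    MDifferentiableAt I (I.prod 𝓘(ℝ, F)) (fun y => TotalSpace.mk' F y (A σ y (Y y))) x := by
  have h := (A.contMDiffAt_apply hu hx hσ).mdifferentiableAt (by simp)
  exact h.clm_bundle_apply hY

lemma curvatureAux_tensorial_left (A : CovariantDerivative I F V)
    [ContMDiffCovariantDerivative A ∞] {x : M} {u : Set M} (hu : IsOpen u) (hx : x ∈ u)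
    {σ : Π y : M, V y}
    (hσ : ContMDiffOn I (I.prod 𝓘(ℝ, F)) ∞ (fun y => TotalSpace.mk' F y (σ y)) u)
    {Y : Π y : M, TangentSpace I y} (_hY : MDiffAt (T% Y) x) :
    TensorialAt I B (fun X => A.curvatureAux x X Y σ) x where
  smul {f X} hf hX := by
    have : IsManifold I 2 M := .of_le (n := ∞) (WithTop.coe_le_coe.2 le_top)
    have : CompleteSpace B := FiniteDimensional.complete ℝ B
    have e : (fun y => A σ y ((f • X) y)) = f • fun y => A σ y (X y) := by
      ext y; simp
    simp only [curvatureAux, e]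
    rw [A.isCovariantDerivativeOnUniv.leibniz (A.mdifferentiableAt_apply hu hx hσ hX) hf,
      VectorField.mlieBracket_smul_left hf hX]
    simp
    module
  add {X X'} hX hX' := by
    have : IsManifold I 2 M := .of_le (n := ∞) (WithTop.coe_le_coe.2 le_top)
    have : CompleteSpace B := FiniteDimensional.complete ℝ B
    have e : (fun y => A σ y ((X + X') y)) =
        (fun y => A σ y (X y)) + fun y => A σ y (X' y) := by
      ext y; simp
    simp only [curvatureAux, e]
    rw [A.isCovariantDerivativeOnUniv.add (A.mdifferentiableAt_apply hu hx hσ hX)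
      (A.mdifferentiableAt_apply hu hx hσ hX'), VectorField.mlieBracket_add_left hX hX']
    simp
    module

lemma curvatureAux_swap (A : CovariantDerivative I F V) (x : M)
    (X Y : Π y : M, TangentSpace I y) (σ : Π y : M, V y) :
    A.curvatureAux x X Y σ = - A.curvatureAux x Y X σ := by
  have h : VectorField.mlieBracket I X Y x = - VectorField.mlieBracket I Y X x := by
    rw [VectorField.mlieBracket_swap]; rfl
  simp only [curvatureAux, h, map_neg]
  module

lemma curvatureAux_tensorial_right (A : CovariantDerivative I F V)
    [ContMDiffCovariantDerivative A ∞] {x : M} {u : Set M} (hu : IsOpen u) (hx : x ∈ u)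
    {σ : Π y : M, V y}
    (hσ : ContMDiffOn I (I.prod 𝓘(ℝ, F)) ∞ (fun y => TotalSpace.mk' F y (σ y)) u)
    {X : Π y : M, TangentSpace I y} (hX : MDiffAt (T% X) x) :
    TensorialAt I B (fun Y => A.curvatureAux x X Y σ) x where
  smul {f Y} hf hY := by
    simp only [A.curvatureAux_swap x X]
    rw [(A.curvatureAux_tensorial_left hu hx hσ hX).smul hf hY, smul_neg]
  add {Y Y'} hY hY' := by
    simp only [A.curvatureAux_swap x X]
    rw [(A.curvatureAux_tensorial_left hu hx hσ hX).add hY hY', neg_add]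

lemma contMDiffOn_extend {x : M} (s : V x) :
    ContMDiffOn I (I.prod 𝓘(ℝ, F)) ∞
      (fun y => TotalSpace.mk' F y (FiberBundle.extend F s y)) (trivializationAt F V x).baseSet := by
  rw [(trivializationAt F V x).contMDiffOn_section_baseSet_iff]
  refine (contMDiffOn_const (c := (trivializationAt F V x ⟨x, s⟩).2)).congr fun y hy => ?_
  simp [FiberBundle.extend, hy]

lemma extend_add {x y : M} (s t : V x) (hy : y ∈ (trivializationAt F V x).baseSet) :
    FiberBundle.extend F (s + t) y = FiberBundle.extend F s y + FiberBundle.extend F t y := by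
  have hx := FiberBundle.mem_baseSet_trivializationAt' (F := F) (E := V) x
  have h := ((trivializationAt F V x).linear ℝ hx).map_add s t
  simp only [FiberBundle.extend]
  rw [h]
  simpa only [Bundle.Trivialization.coe_symmₗ _ hy] using
    map_add ((trivializationAt F V x).symmₗ ℝ y) (trivializationAt F V x ⟨x, s⟩).2
      (trivializationAt F V x ⟨x, t⟩).2

lemma extend_smul {x y : M} (c : ℝ) (s : V x) (hy : y ∈ (trivializationAt F V x).baseSet) :
    FiberBundle.extend F (c • s) y = c • FiberBundle.extend F s y := by
  have hx := FiberBundle.mem_baseSet_trivializationAt' (F := F) (E := V) x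
  have h := ((trivializationAt F V x).linear ℝ hx).map_smul c s
  simp only [FiberBundle.extend]
  rw [h]
  simpa only [Bundle.Trivialization.coe_symmₗ _ hy] using
    map_smul ((trivializationAt F V x).symmₗ ℝ y) c (trivializationAt F V x ⟨x, s⟩).2

lemma curvatureAux_congr (A : CovariantDerivative I F V)
    [ContMDiffCovariantDerivative A ∞] {x : M} {u : Set M} (hu : IsOpen u) (hx : x ∈ u)
    {X Y : Π y : M, TangentSpace I y} (hX : MDiffAt (T% X) x) (hY : MDiffAt (T% Y) x)
    {σ τ : Π y : M, V y}
    (hσ : ContMDiffOn I (I.prod 𝓘(ℝ, F)) ∞ (fun y => TotalSpace.mk' F y (σ y)) u)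
    (hτ : ContMDiffOn I (I.prod 𝓘(ℝ, F)) ∞ (fun y => TotalSpace.mk' F y (τ y)) u)
    (h : ∀ y ∈ u, σ y = τ y) :
    A.curvatureAux x X Y σ = A.curvatureAux x X Y τ := by
  have hd {σ : Π y : M, V y}
      (hσ : ContMDiffOn I (I.prod 𝓘(ℝ, F)) ∞ (fun y => TotalSpace.mk' F y (σ y)) u)
      {y : M} (hy : y ∈ u) := (hσ.contMDiffAt (hu.mem_nhds hy)).mdifferentiableAt (by simp)
  have h0 (y : M) (hy : y ∈ u) : A σ y = A τ y :=
    A.isCovariantDerivativeOn.congr_of_eqOn (hd hσ hy) (hd hτ hy) (hu.mem_nhds hy) h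
  have key {Z : Π y : M, TangentSpace I y} (hZ : MDiffAt (T% Z) x) :
      A (fun y => A σ y (Z y)) x = A (fun y => A τ y (Z y)) x :=
    A.isCovariantDerivativeOn.congr_of_eqOn (A.mdifferentiableAt_apply hu hx hσ hZ)
      (A.mdifferentiableAt_apply hu hx hτ hZ) (hu.mem_nhds hx) fun y hy => by rw [h0 y hy]
  simp only [curvatureAux]
  rw [key hX, key hY, h0 x hx]

lemma curvatureAux_add_section (A : CovariantDerivative I F V)
    [ContMDiffCovariantDerivative A ∞] {x : M} {u : Set M} (hu : IsOpen u) (hx : x ∈ u)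
    {X Y : Π y : M, TangentSpace I y} (hX : MDiffAt (T% X) x) (hY : MDiffAt (T% Y) x)
    {σ τ : Π y : M, V y}
    (hσ : ContMDiffOn I (I.prod 𝓘(ℝ, F)) ∞ (fun y => TotalSpace.mk' F y (σ y)) u)
    (hτ : ContMDiffOn I (I.prod 𝓘(ℝ, F)) ∞ (fun y => TotalSpace.mk' F y (τ y)) u) :
    A.curvatureAux x X Y (σ + τ) = A.curvatureAux x X Y σ + A.curvatureAux x X Y τ := by
  have hd {σ : Π y : M, V y}
      (hσ : ContMDiffOn I (I.prod 𝓘(ℝ, F)) ∞ (fun y => TotalSpace.mk' F y (σ y)) u)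
      {y : M} (hy : y ∈ u) := (hσ.contMDiffAt (hu.mem_nhds hy)).mdifferentiableAt (by simp)
  have key {Z : Π y : M, TangentSpace I y} (hZ : MDiffAt (T% Z) x) :
      A (fun y => A (σ + τ) y (Z y)) x =
        A (fun y => A σ y (Z y)) x + A (fun y => A τ y (Z y)) x := by
    have h1 := A.mdifferentiableAt_apply hu hx hσ hZ
    have h2 := A.mdifferentiableAt_apply hu hx hτ hZ
    rw [← A.isCovariantDerivativeOnUniv.add h1 h2]
    refine A.isCovariantDerivativeOnUniv.congr_of_eventuallyEq
      (A.mdifferentiableAt_apply hu hx (hσ.add_section hτ) hZ)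
      (mdifferentiableAt_add_section h1 h2) univ_mem ?_
    filter_upwards [hu.mem_nhds hx] with y hy
    rw [A.isCovariantDerivativeOnUniv.add (hd hσ hy) (hd hτ hy)]
    rfl
  simp only [curvatureAux]
  rw [key hX, key hY, A.isCovariantDerivativeOnUniv.add (hd hσ hx) (hd hτ hx)]
  simp
  module

lemma curvatureAux_smul_section (A : CovariantDerivative I F V)
    [ContMDiffCovariantDerivative A ∞] {x : M} {u : Set M} (hu : IsOpen u) (hx : x ∈ u)
    {X Y : Π y : M, TangentSpace I y} (hX : MDiffAt (T% X) x) (hY : MDiffAt (T% Y) x)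
    {σ : Π y : M, V y} (c : ℝ)
    (hσ : ContMDiffOn I (I.prod 𝓘(ℝ, F)) ∞ (fun y => TotalSpace.mk' F y (σ y)) u) :
    A.curvatureAux x X Y (c • σ) = c • A.curvatureAux x X Y σ := by
  have hd {y : M} (hy : y ∈ u) := (hσ.contMDiffAt (hu.mem_nhds hy)).mdifferentiableAt (by simp)
  have key {Z : Π y : M, TangentSpace I y} (hZ : MDiffAt (T% Z) x) :
      A (fun y => A (c • σ) y (Z y)) x = c • A (fun y => A σ y (Z y)) x := by
    have h1 := A.mdifferentiableAt_apply hu hx hσ hZ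
    rw [← A.isCovariantDerivativeOnUniv.smul_const c h1]
    refine A.isCovariantDerivativeOnUniv.congr_of_eventuallyEq
      (A.mdifferentiableAt_apply hu hx hσ.const_smul_section hZ)
      (mdifferentiableAt_const.smul_section h1) univ_mem ?_
    filter_upwards [hu.mem_nhds hx] with y hy
    rw [A.isCovariantDerivativeOnUniv.smul_const c (hd hy)]
    rfl
  simp only [curvatureAux]
  rw [key hX, key hY, A.isCovariantDerivativeOnUniv.smul_const c (hd hx)]
  simp
  module

/-- The curvature `F_A` of a smooth connection `A` at the point `x`, as a trilinear map
`(u, v, s) ↦ F_A(u, v) s = (∇_u ∇_v - ∇_v ∇_u - ∇_[u,v]) s`. The vectors `u, v, s` at `x` are extended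
to smooth sections near `x` which are constant in the preferred local trivialization at `x`. -/
def curvature (A : CovariantDerivative I F V) [ContMDiffCovariantDerivative A ∞] (x : M) :
    TangentSpace I x →ₗ[ℝ] TangentSpace I x →ₗ[ℝ] Module.End ℝ (V x) :=
  have hx := FiberBundle.mem_baseSet_trivializationAt' (F := F) (E := V) x
  have ho := (trivializationAt F V x).open_baseSet
  have : IsManifold I 1 M := .of_le (n := ∞) (by simp)
  LinearMap.mk₂ ℝ
    (fun u v =>
      { toFun := fun s => A.curvatureAux x (FiberBundle.extend B u) (FiberBundle.extend B v)
          (FiberBundle.extend F s)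
        map_add' := fun s t => by
          rw [← A.curvatureAux_add_section ho hx (FiberBundle.mdifferentiableAt_extend I B _)
            (FiberBundle.mdifferentiableAt_extend I B _) (contMDiffOn_extend s)
            (contMDiffOn_extend t)]
          exact A.curvatureAux_congr ho hx (FiberBundle.mdifferentiableAt_extend I B _)
            (FiberBundle.mdifferentiableAt_extend I B _) (contMDiffOn_extend _)
            ((contMDiffOn_extend s).add_section (contMDiffOn_extend t))
            fun y hy => extend_add s t hy
        map_smul' := fun c s => by
          rw [RingHom.id_apply,
            ← A.curvatureAux_smul_section ho hx (FiberBundle.mdifferentiableAt_extend I B _)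
            (FiberBundle.mdifferentiableAt_extend I B _) c (contMDiffOn_extend s)]
          exact A.curvatureAux_congr ho hx (FiberBundle.mdifferentiableAt_extend I B _)
            (FiberBundle.mdifferentiableAt_extend I B _) (contMDiffOn_extend _)
            (contMDiffOn_extend s).const_smul_section fun y hy => extend_smul c s hy })
    (fun u u' v => by
      ext s
      exact (TensorialAt.mkHom _ x (A.curvatureAux_tensorial_left ho hx (contMDiffOn_extend s)
        (FiberBundle.mdifferentiableAt_extend I B v))).map_add u u')
    (fun c u v => by
      ext s
      exact (TensorialAt.mkHom _ x (A.curvatureAux_tensorial_left ho hx (contMDiffOn_extend s)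
        (FiberBundle.mdifferentiableAt_extend I B v))).map_smul c u)
    (fun u v v' => by
      ext s
      exact (TensorialAt.mkHom _ x (A.curvatureAux_tensorial_right ho hx (contMDiffOn_extend s)
        (FiberBundle.mdifferentiableAt_extend I B u))).map_add v v')
    (fun c u v => by
      ext s
      exact (TensorialAt.mkHom _ x (A.curvatureAux_tensorial_right ho hx (contMDiffOn_extend s)
        (FiberBundle.mdifferentiableAt_extend I B u))).map_smul c v)

end Curvature
end CovariantDerivative

namespace FourManifold

/-! ### Linear algebra of 2-forms in dimension four -/

section LinearAlgebra

variable {T : Type*} [AddCommGroup T] [Module ℝ T]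

/-- The 4-form `α ∧ β`, evaluated on the vectors `e 0, e 1, e 2, e 3`, for 2-forms `α`, `β`. -/
def wedge (α β : LinearMap.BilinForm ℝ T) (e : Fin 4 → T) : ℝ :=
  α (e 0) (e 1) * β (e 2) (e 3) - α (e 0) (e 2) * β (e 1) (e 3)
    + α (e 0) (e 3) * β (e 1) (e 2) + α (e 1) (e 2) * β (e 0) (e 3)
    - α (e 1) (e 3) * β (e 0) (e 2) + α (e 2) (e 3) * β (e 0) (e 1)

/-- `e` is an orthonormal frame of the 4-dimensional space `T` for the inner product `g`. -/
def IsOrthonormalFrame (g : T → T → ℝ) (e : Fin 4 → T) : Prop :=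
  ∀ i j, g (e i) (e j) = if i = j then 1 else 0

/-- The space `Λ⁺` of self-dual 2-forms for the inner product `g` and the orientation in which a
frame `e` is positive if and only if `0 < μ e` (where `μ` is a 4-form): the alternating forms `α`
with `∗α = α`, written out in oriented orthonormal frames. -/
def selfDual (g : T → T → ℝ) (μ : (Fin 4 → T) → ℝ) : Set (LinearMap.BilinForm ℝ T) :=
  {α | α.IsAlt ∧ ∀ e, IsOrthonormalFrame g e → 0 < μ e →
    α (e 0) (e 1) = α (e 2) (e 3) ∧ α (e 0) (e 2) = -α (e 1) (e 3) ∧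
      α (e 0) (e 3) = α (e 1) (e 2)}

end LinearAlgebra

section SkewEndomorphisms

variable {W : Type*} [NormedAddCommGroup W] [InnerProductSpace ℝ W]

/-- `ξ` belongs to the Lie algebra `so(W)`. -/
def IsSkew (ξ : Module.End ℝ W) : Prop :=
  ∀ a b : W, inner ℝ (ξ a) b = -inner ℝ a (ξ b)

/-- The inner product `⟨ξ, η⟩ = -tr(ξη)`. On `so(W)` with `dim W = 3` this is minus the Killing
form. -/
def killingInner (ξ η : Module.End ℝ W) : ℝ := -LinearMap.trace ℝ W (ξ * η)

lemma killingInner_add_left (ξ ξ' η : Module.End ℝ W) :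
    killingInner (ξ + ξ') η = killingInner ξ η + killingInner ξ' η := by
  rw [killingInner, add_mul, map_add, neg_add]; rfl

lemma killingInner_smul_left (c : ℝ) (ξ η : Module.End ℝ W) :
    killingInner (c • ξ) η = c * killingInner ξ η := by
  rw [killingInner, smul_mul_assoc, map_smul, ← smul_neg]; rfl

end SkewEndomorphisms

/-! ### Definite and perfect connections -/

section Connections

variable {M : Type*} [TopologicalSpace M] [ChartedSpace (EuclideanSpace ℝ (Fin 4)) M]
  [IsManifold (𝓡 4) ∞ M] [T2Space M]
  {E : M → Type*} [TopologicalSpace (TotalSpace (EuclideanSpace ℝ (Fin 3)) E)]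
  [∀ x, NormedAddCommGroup (E x)] [∀ x, InnerProductSpace ℝ (E x)]
  [FiberBundle (EuclideanSpace ℝ (Fin 3)) E] [VectorBundle ℝ (EuclideanSpace ℝ (Fin 3)) E]
  [ContMDiffVectorBundle ∞ (EuclideanSpace ℝ (Fin 3)) E (𝓡 4)]

/-- A connection is definite if its curvature is non-zero on every tangent 2-plane. -/
def IsDefinite (A : CovariantDerivative (𝓡 4) (EuclideanSpace ℝ (Fin 3)) E)
    [A.ContMDiffCovariantDerivative ∞] : Prop :=
  ∀ (x : M) (u v : TangentSpace (𝓡 4) x), LinearIndependent ℝ ![u, v] → A.curvature x u v ≠ 0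

/-- The 2-form `F_A(ξ) = ⟨F_A(·, ·), ξ⟩` on `T_x M`, for `ξ ∈ so(E_x)`. The inner product identifies
`so(E_x)` with its dual, so `ξ ↦ F_A(ξ)` is the curvature as a map `so(E_x)* → Λ² T_x* M`. -/
def curvatureForm (A : CovariantDerivative (𝓡 4) (EuclideanSpace ℝ (Fin 3)) E)
    [A.ContMDiffCovariantDerivative ∞] (x : M) (ξ : Module.End ℝ (E x)) :
    LinearMap.BilinForm ℝ (TangentSpace (𝓡 4) x) :=
  LinearMap.mk₂ ℝ (fun u v => killingInner (A.curvature x u v) ξ)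
    (fun u u' v => by rw [map_add, LinearMap.add_apply, killingInner_add_left])
    (fun c u v => by rw [map_smul, LinearMap.smul_apply, killingInner_smul_left, smul_eq_mul])
    (fun u v v' => by rw [map_add, killingInner_add_left])
    (fun c u v => by rw [map_smul, killingInner_smul_left, smul_eq_mul])

/-- The 4-form `μ_A = -(1/3) tr(F_A ∧ F_A) = (8π²/3) p₁(A)` on `T_x M`. In terms of an orthonormal
frame `ξ₁, ξ₂, ξ₃` of `so(E_x)` it is `(1/3) ∑ F_A(ξᵢ) ∧ F_A(ξᵢ)`. -/
def curvatureVolume (A : CovariantDerivative (𝓡 4) (EuclideanSpace ℝ (Fin 3)) E)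
    [A.ContMDiffCovariantDerivative ∞] (x : M) (e : Fin 4 → TangentSpace (𝓡 4) x) : ℝ :=
  let F := fun i j => A.curvature x (e i) (e j)
  (-1 / 3) * LinearMap.trace ℝ (E x)
    (F 0 1 * F 2 3 - F 0 2 * F 1 3 + F 0 3 * F 1 2 + F 1 2 * F 0 3 - F 1 3 * F 0 2 + F 2 3 * F 0 1)

/-- A connection `A` is perfect if it is definite and `F_A : so(E)* → Λ⁺_A` is an isometry, i.e.
`F_A(ξ) ∧ F_A(η) = ⟨ξ, η⟩ μ_A`. (The inner product on `Λ⁺_A` is `⟨α, β⟩ μ_A = α ∧ β`.) -/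
def IsPerfect (A : CovariantDerivative (𝓡 4) (EuclideanSpace ℝ (Fin 3)) E)
    [A.ContMDiffCovariantDerivative ∞] : Prop :=
  IsDefinite A ∧ ∀ (x : M) (ξ η : Module.End ℝ (E x)), IsSkew ξ → IsSkew η →
    ∀ e : Fin 4 → TangentSpace (𝓡 4) x,
      wedge (curvatureForm A x ξ) (curvatureForm A x η) e = killingInner ξ η * curvatureVolume A x e

/-- `g` is the metric `g_A` of the definite connection `A`: its volume form, for the orientation
given by `μ_A`, is `μ_A`, and its self-dual 2-forms are the forms `F_A(ξ)`, `ξ ∈ so(E)`. -/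
def IsMetricOf (A : CovariantDerivative (𝓡 4) (EuclideanSpace ℝ (Fin 3)) E)
    [A.ContMDiffCovariantDerivative ∞]
    (g : ContMDiffRiemannianMetric (𝓡 4) ∞ (EuclideanSpace ℝ (Fin 4))
      (fun x : M => TangentSpace (𝓡 4) x)) : Prop :=
  ∀ x : M,
    (∀ e, IsOrthonormalFrame (fun u v => g.inner x u v) e → |curvatureVolume A x e| = 1) ∧
    {α | ∃ ξ : Module.End ℝ (E x), IsSkew ξ ∧ α = curvatureForm A x ξ} =
      selfDual (fun u v => g.inner x u v) (curvatureVolume A x)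

end Connections

/-! ### Curvature of a Riemannian metric on a 4-manifold -/

section Riemannian

variable {M : Type*} [TopologicalSpace M] [ChartedSpace (EuclideanSpace ℝ (Fin 4)) M]
  [IsManifold (𝓡 4) ∞ M]

/-- The partial derivative `∂f/∂xⁱ` of a function on `ℝ⁴`. -/
def partialDeriv (i : Fin 4) (f : EuclideanSpace ℝ (Fin 4) → ℝ) (y : EuclideanSpace ℝ (Fin 4)) : ℝ :=
  fderiv ℝ f y (EuclideanSpace.single i 1)

/-- The components `g_ij = g(∂_i, ∂_j)` of the metric in the preferred chart at `p`, as functions on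
the image of the chart; `∂_i` is the derivative of the inverse chart along the `i`-th basis
vector. -/
def coordMetric (g : ContMDiffRiemannianMetric (𝓡 4) ∞ (EuclideanSpace ℝ (Fin 4))
      (fun x : M => TangentSpace (𝓡 4) x))
    (p : M) (y : EuclideanSpace ℝ (Fin 4)) : Matrix (Fin 4) (Fin 4) ℝ :=
  let φ := (extChartAt (𝓡 4) p).symm
  Matrix.of fun i j => g.inner (φ y)
    (mfderiv 𝓘(ℝ, EuclideanSpace ℝ (Fin 4)) (𝓡 4) φ y (EuclideanSpace.single i 1))
    (mfderiv 𝓘(ℝ, EuclideanSpace ℝ (Fin 4)) (𝓡 4) φ y (EuclideanSpace.single j 1))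

/-- The Christoffel symbols `Γᵏ_ij = ½ ∑_l gᵏˡ (∂_i g_jl + ∂_j g_il - ∂_l g_ij)` of the Levi-Civita
connection, in the preferred chart at `p`. -/
def christoffel (g : ContMDiffRiemannianMetric (𝓡 4) ∞ (EuclideanSpace ℝ (Fin 4))
      (fun x : M => TangentSpace (𝓡 4) x))
    (p : M) (k i j : Fin 4) (y : EuclideanSpace ℝ (Fin 4)) : ℝ :=
  (1 / 2) * ∑ l, (coordMetric g p y)⁻¹ k l *
    (partialDeriv i (fun z => coordMetric g p z j l) y
      + partialDeriv j (fun z => coordMetric g p z i l) y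
      - partialDeriv l (fun z => coordMetric g p z i j) y)

/-- The component `R^l_ijk` of the Riemann tensor at `p`, with `R(∂_i, ∂_j) ∂_k = ∑_l R^l_ijk ∂_l`
and `R(X, Y) = ∇_X ∇_Y - ∇_Y ∇_X - ∇_[X,Y]`, in the preferred chart at `p`. -/
def riemannCoord (g : ContMDiffRiemannianMetric (𝓡 4) ∞ (EuclideanSpace ℝ (Fin 4))
      (fun x : M => TangentSpace (𝓡 4) x))
    (p : M) (l i j k : Fin 4) : ℝ :=
  let y := extChartAt (𝓡 4) p p
  partialDeriv i (christoffel g p l j k) y - partialDeriv j (christoffel g p l i k) y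
    + ∑ m, (christoffel g p l i m y * christoffel g p m j k y
      - christoffel g p l j m y * christoffel g p m i k y)

/-- The components of a tangent vector at `p` in the coordinate basis of the preferred chart
at `p`. (In Mathlib, `T_p M` is `ℝ⁴` through exactly this chart.) -/
def coords {p : M} (u : TangentSpace (𝓡 4) p) (i : Fin 4) : ℝ :=
  (show EuclideanSpace ℝ (Fin 4) from u) i

/-- The Riemann tensor `Rm(u, v, w, z) = g(R(u, v) w, z)` at `p`. -/
def riemann (g : ContMDiffRiemannianMetric (𝓡 4) ∞ (EuclideanSpace ℝ (Fin 4))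
      (fun x : M => TangentSpace (𝓡 4) x))
    (p : M) (u v w z : TangentSpace (𝓡 4) p) : ℝ :=
  g.inner p
    (show TangentSpace (𝓡 4) p from WithLp.toLp 2 fun l =>
      ∑ i, ∑ j, ∑ k, riemannCoord g p l i j k * coords u i * coords v j * coords w k) z

/-- The Ricci tensor `Ric(v, w) = tr(u ↦ R(u, v) w)` at `p`. -/
def ricci (g : ContMDiffRiemannianMetric (𝓡 4) ∞ (EuclideanSpace ℝ (Fin 4))
      (fun x : M => TangentSpace (𝓡 4) x))
    (p : M) (v w : TangentSpace (𝓡 4) p) : ℝ :=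
  ∑ i, ∑ j, ∑ k, riemannCoord g p i i j k * coords v j * coords w k

/-- The scalar curvature `∑ gʲᵏ Ric_jk` at `p`. -/
def scalarCurvature (g : ContMDiffRiemannianMetric (𝓡 4) ∞ (EuclideanSpace ℝ (Fin 4))
      (fun x : M => TangentSpace (𝓡 4) x)) (p : M) : ℝ :=
  ∑ i, ∑ j, ∑ k, (coordMetric g p (extChartAt (𝓡 4) p p))⁻¹ j k * riemannCoord g p i i j k

/-- The Weyl tensor of a metric in dimension four,
`W = Rm - ½ (Ric ∧ g) + (s / 6) (g ∧ g) / 2`, with Kulkarni–Nomizu products written out. -/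
def weyl (g : ContMDiffRiemannianMetric (𝓡 4) ∞ (EuclideanSpace ℝ (Fin 4))
      (fun x : M => TangentSpace (𝓡 4) x))
    (p : M) (u v w z : TangentSpace (𝓡 4) p) : ℝ :=
  riemann g p u v w z
    - (1 / 2) * (g.inner p u z * ricci g p v w + g.inner p v w * ricci g p u z
      - g.inner p u w * ricci g p v z - g.inner p v z * ricci g p u w)
    + (scalarCurvature g p / 6) * (g.inner p u z * g.inner p v w - g.inner p u w * g.inner p v z)

/-- `g` is Einstein: `Ric = c g`, where `c` is constant on each connected component. -/
def IsEinstein (g : ContMDiffRiemannianMetric (𝓡 4) ∞ (EuclideanSpace ℝ (Fin 4))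
      (fun x : M => TangentSpace (𝓡 4) x)) : Prop :=
  ∃ c : M → ℝ, IsLocallyConstant c ∧
    ∀ (p : M) (v w : TangentSpace (𝓡 4) p), ricci g p v w = c p * g.inner p v w

/-- `g` is anti-self-dual for the orientation defined by the 4-form `μ`: `W⁺ = 0`, i.e. the Weyl
tensor, as an endomorphism of the 2-forms, vanishes on `Λ⁺`. -/
def IsAntiSelfDual (g : ContMDiffRiemannianMetric (𝓡 4) ∞ (EuclideanSpace ℝ (Fin 4))
      (fun x : M => TangentSpace (𝓡 4) x))
    (μ : ∀ p : M, (Fin 4 → TangentSpace (𝓡 4) p) → ℝ) : Prop :=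
  ∀ (p : M) (e : Fin 4 → TangentSpace (𝓡 4) p), IsOrthonormalFrame (fun u v => g.inner p u v) e →
    ∀ α ∈ selfDual (fun u v => g.inner p u v) (μ p), ∀ u v : TangentSpace (𝓡 4) p,
      ∑ k, ∑ l, weyl g p u v (e k) (e l) * α (e k) (e l) = 0

end Riemannian

end FourManifold

end

/-!
The metric is constructed point by point from linear algebra, and its curvature is found by showing
that the curvature forms are parallel.

In a local orthonormal frame of `E` the curvature `F_A` has three components `f⁰, f¹, f²`, and
perfection says `f^c ∧ f^d = ½ δ_cd μ_A`. At a point, definiteness makes the linear map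
`v ↦ (f^c(u, v))_c` onto for each `u ≠ 0`, and the wedge products allow the resulting dual vectors to
be corrected to a basis in which `f^c = (τ / 2) ω_c`, where `τ = ±1` and `ω_0, ω_1, ω_2` are the
standard self-dual forms of `ℝ⁴` (`exists_basis_of_definite`). The inner product for which this basis
is orthonormal has volume form `± μ_A` and self-dual forms `F_A(ξ)` (`exists_isMetricAt`).
Conversely, every inner product with these properties has an orthonormal frame of this kind
(`exists_adapted_frame`). The `ω_c` multiply like quaternions, so the matrix `G` of the inner product
is `-2 τ f¹ (f²)⁻¹ f⁰` (`IsAdapted.metric_eq_forms`), and positivity of `G` determines `τ`. This gives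
uniqueness and smoothness of the metric, and shows that `τ` is locally constant.

Let `∇` be the connection on `so(E)`-valued 2-forms built from `A` and the Levi-Civita connection.
Differentiating the quaternion relations shows that, in each direction, `∇ f` is an infinitesimal
rotation of the triple `f`; the Bianchi identity `d_A F_A = 0` and the symmetry of the Christoffel
symbols force this rotation to vanish (`IsPerfectCoord.covDeriv_eq_zero`). The Ricci identity for the
parallel triple `f` then expresses the action of the Riemann tensor on `Λ⁺` through `F_A`, which is
`f` itself: on `Λ⁺` the curvature operator is multiplication by `τ`
(`IsPerfectCoord.trace_riemannMat`). So it maps `Λ⁺` to itself, which is the Einstein condition, and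
acts on it as a scalar, which is `W⁺ = 0`. Explicitly `Ric = -(3 / 2) τ g` and `s = -6 τ ≠ 0`.
-/

noncomputable section

set_option linter.unusedSectionVars false

namespace FourManifold

/-! ### Coordinate vector fields -/

section CoordinateFields

variable {M : Type*} [TopologicalSpace M] [ChartedSpace (EuclideanSpace ℝ (Fin 4)) M]
  [IsManifold (𝓡 4) ∞ M]

/-- The constant vector field on `ℝ⁴` along the `i`-th basis vector. -/
def constField (i : Fin 4) (y : EuclideanSpace ℝ (Fin 4)) :
    TangentSpace 𝓘(ℝ, EuclideanSpace ℝ (Fin 4)) y :=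
  (EuclideanSpace.single i 1 : EuclideanSpace ℝ (Fin 4))

/-- The coordinate vector field `∂_i` of the preferred chart at `p`. Outside the domain of the chart
its value is irrelevant. -/
def coordField (p : M) (i : Fin 4) (x : M) : TangentSpace (𝓡 4) x :=
  (trivializationAt (EuclideanSpace ℝ (Fin 4)) (TangentSpace (𝓡 4)) p).symmL ℝ x
    (EuclideanSpace.single i 1)

lemma contMDiffOn_coordField (p : M) (i : Fin 4) :
    ContMDiffOn (𝓡 4) ((𝓡 4).prod 𝓘(ℝ, EuclideanSpace ℝ (Fin 4))) ∞
      (fun x => TotalSpace.mk' (EuclideanSpace ℝ (Fin 4)) x (coordField p i x))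
      (extChartAt (𝓡 4) p).source := by
  rw [extChartAt_source]
  rw [← TangentBundle.trivializationAt_baseSet (I := 𝓡 4),
    (trivializationAt (EuclideanSpace ℝ (Fin 4)) (TangentSpace (𝓡 4))
      p).contMDiffOn_section_baseSet_iff]
  refine (contMDiffOn_const (c := (EuclideanSpace.single i 1 : EuclideanSpace ℝ (Fin 4)))).congr
    fun y hy => ?_
  rw [coordField, Bundle.Trivialization.symmL_apply _ hy]
  exact congrArg Prod.snd (Bundle.Trivialization.apply_mk_symm _ hy _)

lemma coordField_symm {p : M} {y : EuclideanSpace ℝ (Fin 4)}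
    (hy : y ∈ (extChartAt (𝓡 4) p).target) (i : Fin 4) :
    coordField p i ((extChartAt (𝓡 4) p).symm y) =
      mfderiv 𝓘(ℝ, EuclideanSpace ℝ (Fin 4)) (𝓡 4) (extChartAt (𝓡 4) p).symm y
        (EuclideanSpace.single i 1) := by
  have hx : (extChartAt (𝓡 4) p).symm y ∈ (chartAt (EuclideanSpace ℝ (Fin 4)) p).source := by
    have := (extChartAt (𝓡 4) p).map_target hy
    rwa [extChartAt_source] at this
  have h2 := congrArg (fun L => L (EuclideanSpace.single i (1:ℝ)))
    (TangentBundle.symmL_trivializationAt (I := 𝓡 4) (x₀ := p) hx)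
  rw [(extChartAt (𝓡 4) p).right_inv hy, ModelWithCorners.range_eq_univ, mfderivWithin_univ] at h2
  exact h2

lemma mfderiv_coordField {p x : M} (hx : x ∈ (extChartAt (𝓡 4) p).source) (i : Fin 4) :
    mfderiv (𝓡 4) 𝓘(ℝ, EuclideanSpace ℝ (Fin 4)) (extChartAt (𝓡 4) p) x (coordField p i x) =
      (EuclideanSpace.single i 1 : EuclideanSpace ℝ (Fin 4)) := by
  have hx' : x ∈ (chartAt (EuclideanSpace ℝ (Fin 4)) p).source := by
    rwa [extChartAt_source] at hx
  have h1 := congrArg (fun L => L (coordField p i x))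
    (TangentBundle.continuousLinearMapAt_trivializationAt (I := 𝓡 4) (x₀ := p) hx')
  refine h1.symm.trans ?_
  exact (trivializationAt (EuclideanSpace ℝ (Fin 4)) (TangentSpace (𝓡 4)) p
    ).continuousLinearMapAt_symmL (R := ℝ) hx' (EuclideanSpace.single i 1)

lemma coordField_eq_mpullback {p x : M} (hx : x ∈ (extChartAt (𝓡 4) p).source) (i : Fin 4) :
    coordField p i x = VectorField.mpullback (𝓡 4) 𝓘(ℝ, EuclideanSpace ℝ (Fin 4))
      (extChartAt (𝓡 4) p) (constField i) x := by
  have : IsManifold (𝓡 4) 1 M := .of_le (n := ∞) (by simp)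
  have h := mfderiv_coordField hx i
  rw [VectorField.mpullback_apply]
  exact ((isInvertible_mfderiv_extChartAt hx).inverse_apply_eq.2 h.symm).symm

/-- Coordinate fields commute: they are pulled back from constant fields. -/
lemma mlieBracket_coordField {p x : M} (hx : x ∈ (extChartAt (𝓡 4) p).source) (i j : Fin 4) :
    VectorField.mlieBracket (𝓡 4) (coordField p i) (coordField p j) x = 0 := by
  have : IsManifold (𝓡 4) (minSmoothness ℝ 2) M :=
    .of_le (n := ∞) (by
      rw [minSmoothness_of_isRCLikeNormedField]; exact WithTop.coe_le_coe.2 le_top)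
  have : IsManifold (𝓡 4) 2 M := .of_le (n := ∞) (WithTop.coe_le_coe.2 le_top)
  have ho := (isOpen_extChartAt_source (I := 𝓡 4) p).mem_nhds hx
  have e (i : Fin 4) : coordField p i =ᶠ[𝓝 x]
      VectorField.mpullback (𝓡 4) 𝓘(ℝ, EuclideanSpace ℝ (Fin 4)) (extChartAt (𝓡 4) p)
        (constField i) := by
    filter_upwards [ho] with z hz using coordField_eq_mpullback hz i
  have hc (i : Fin 4) (z : EuclideanSpace ℝ (Fin 4)) :
      MDifferentiableAt 𝓘(ℝ, EuclideanSpace ℝ (Fin 4))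
        (𝓘(ℝ, EuclideanSpace ℝ (Fin 4)).prod 𝓘(ℝ, EuclideanSpace ℝ (Fin 4)))
        (fun z => (⟨z, constField i z⟩ :
          TangentBundle 𝓘(ℝ, EuclideanSpace ℝ (Fin 4)) (EuclideanSpace ℝ (Fin 4)))) z :=
    (contMDiffAt_vectorSpace_iff_contDiffAt (n := 1)
      (V := fun _ => (EuclideanSpace.single i 1 : EuclideanSpace ℝ (Fin 4))).2
        contDiffAt_const).mdifferentiableAt one_ne_zero
  rw [(e i).mlieBracket_vectorField_eq (e j),
    ← VectorField.mpullback_mlieBracket (n := 2) (hc i _) (hc j _)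
      (contMDiffAt_extChartAt' (by rwa [extChartAt_source] at hx)) (by simp)]
  rw [VectorField.mpullback_apply]
  have : VectorField.mlieBracket 𝓘(ℝ, EuclideanSpace ℝ (Fin 4))
      (constField i)
      (constField j)
      (extChartAt (𝓡 4) p x) = 0 := by
    rw [← VectorField.mlieBracketWithin_univ, VectorField.mlieBracketWithin_eq_lieBracketWithin]
    have h (v w y : EuclideanSpace ℝ (Fin 4)) :
        VectorField.lieBracketWithin ℝ (fun _ => v) (fun _ => w) Set.univ y = 0 := by
      simp [VectorField.lieBracket]
    exact h _ _ _
  rw [this]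
  exact map_zero _

/-- In Mathlib, `T_p M` is the model space through the preferred chart at `p`. -/
lemma coordField_self (p : M) (i : Fin 4) :
    coordField p i p = (show TangentSpace (𝓡 4) p from
      (EuclideanSpace.single i 1 : EuclideanSpace ℝ (Fin 4))) := by
  have h := mfderiv_coordField (mem_extChartAt_source (I := 𝓡 4) p) i
  rw [mfderiv_extChartAt_self] at h
  exact h

lemma mvfderiv_coordField {p : M} {y : EuclideanSpace ℝ (Fin 4)}
    (hy : y ∈ (extChartAt (𝓡 4) p).target) {f : M → ℝ}
    (hf : MDifferentiableAt (𝓡 4) 𝓘(ℝ, ℝ) f ((extChartAt (𝓡 4) p).symm y)) (i : Fin 4) :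
    mvfderiv (𝓡 4) f ((extChartAt (𝓡 4) p).symm y)
        (coordField p i ((extChartAt (𝓡 4) p).symm y)) =
      partialDeriv i (fun z => f ((extChartAt (𝓡 4) p).symm z)) y := by
  have : IsManifold (𝓡 4) 1 M := .of_le (n := ∞) (by simp)
  have hs : MDifferentiableAt 𝓘(ℝ, EuclideanSpace ℝ (Fin 4)) (𝓡 4) (extChartAt (𝓡 4) p).symm y :=
    ((contMDiffOn_extChartAt_symm (n := 1) p).contMDiffAt
      ((isOpen_extChartAt_target (I := 𝓡 4) p).mem_nhds hy)).mdifferentiableAt one_ne_zero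
  have h := mfderiv_comp y hf hs
  rw [mfderiv_eq_fderiv] at h
  rw [coordField_symm hy, partialDeriv]
  exact (congrArg (fun L => L (EuclideanSpace.single i (1:ℝ))) h).symm

lemma linearIndependent_coordField {p x : M} (hx : x ∈ (extChartAt (𝓡 4) p).source) :
    LinearIndependent ℝ (fun i => coordField p i x) := by
  have h : LinearIndependent ℝ
      (fun i => (EuclideanSpace.single i 1 : EuclideanSpace ℝ (Fin 4))) := by
    have h := (EuclideanSpace.basisFun (Fin 4) ℝ).toBasis.linearIndependent
    have e : ⇑(EuclideanSpace.basisFun (Fin 4) ℝ).toBasis =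
        fun i => (EuclideanSpace.single i 1 : EuclideanSpace ℝ (Fin 4)) := by
      ext1 i; simp
    rwa [e] at h
  have e : (fun i => (EuclideanSpace.single i 1 : EuclideanSpace ℝ (Fin 4))) =
      (mfderiv (𝓡 4) 𝓘(ℝ, EuclideanSpace ℝ (Fin 4)) (extChartAt (𝓡 4) p) x).toLinearMap ∘
        fun i => coordField p i x := by
    ext1 i
    exact (mfderiv_coordField hx i).symm
  exact LinearIndependent.of_comp
    (mfderiv (𝓡 4) 𝓘(ℝ, EuclideanSpace ℝ (Fin 4)) (extChartAt (𝓡 4) p) x).toLinearMap (e ▸ h)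

end CoordinateFields

/-! ### Partial derivatives -/

section PartialDerivatives

variable {V : Set (EuclideanSpace ℝ (Fin 4))} {f g : EuclideanSpace ℝ (Fin 4) → ℝ}
  {y : EuclideanSpace ℝ (Fin 4)}

lemma differentiableAt_of_contDiffOn (hf : ContDiffOn ℝ ∞ f V) (hV : IsOpen V) (hy : y ∈ V) :
    DifferentiableAt ℝ f y :=
  (hf.contDiffAt (hV.mem_nhds hy)).differentiableAt (by simp)

lemma ContDiffOn.partialDeriv (hf : ContDiffOn ℝ ∞ f V) (hV : IsOpen V) (i : Fin 4) :
    ContDiffOn ℝ ∞ (partialDeriv i f) V :=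
  (hf.fderiv_of_isOpen hV (by simp)).clm_apply contDiffOn_const

lemma partialDeriv_congr (hV : IsOpen V) (hy : y ∈ V) (h : ∀ z ∈ V, f z = g z) (i : Fin 4) :
    partialDeriv i f y = partialDeriv i g y := by
  have : f =ᶠ[𝓝 y] g := by filter_upwards [hV.mem_nhds hy] with z hz using h z hz
  rw [partialDeriv, partialDeriv, this.fderiv_eq]

lemma partialDeriv_const (c : ℝ) (i : Fin 4) : partialDeriv i (fun _ => c) y = 0 := by
  simp [partialDeriv]

lemma partialDeriv_add (hf : DifferentiableAt ℝ f y) (hg : DifferentiableAt ℝ g y) (i : Fin 4) :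
    partialDeriv i (fun z => f z + g z) y = partialDeriv i f y + partialDeriv i g y := by
  simp [partialDeriv, fderiv_fun_add hf hg]

lemma partialDeriv_sub (hf : DifferentiableAt ℝ f y) (hg : DifferentiableAt ℝ g y) (i : Fin 4) :
    partialDeriv i (fun z => f z - g z) y = partialDeriv i f y - partialDeriv i g y := by
  simp [partialDeriv, fderiv_fun_sub hf hg]

lemma partialDeriv_neg (i : Fin 4) :
    partialDeriv i (fun z => - f z) y = - partialDeriv i f y := by
  simp [partialDeriv, fderiv_fun_neg]

lemma partialDeriv_mul (hf : DifferentiableAt ℝ f y) (hg : DifferentiableAt ℝ g y) (i : Fin 4) :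
    partialDeriv i (fun z => f z * g z) y = partialDeriv i f y * g y + f y * partialDeriv i g y := by
  simp [partialDeriv, fderiv_fun_mul hf hg]
  ring

lemma partialDeriv_const_mul (hf : DifferentiableAt ℝ f y) (c : ℝ) (i : Fin 4) :
    partialDeriv i (fun z => c * f z) y = c * partialDeriv i f y := by
  rw [partialDeriv_mul (differentiableAt_const c) hf, partialDeriv_const]; ring

lemma partialDeriv_sum {ι : Type*} (t : Finset ι) {F : ι → EuclideanSpace ℝ (Fin 4) → ℝ}
    (hF : ∀ k ∈ t, DifferentiableAt ℝ (F k) y) (i : Fin 4) :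
    partialDeriv i (fun z => ∑ k ∈ t, F k z) y = ∑ k ∈ t, partialDeriv i (F k) y := by
  simp [partialDeriv, fderiv_fun_sum hF]

/-- Symmetry of second derivatives. -/
lemma partialDeriv_comm (hf : ContDiffOn ℝ ∞ f V) (hV : IsOpen V) (hy : y ∈ V) (i j : Fin 4) :
    partialDeriv i (partialDeriv j f) y = partialDeriv j (partialDeriv i f) y := by
  have h := (hf.contDiffAt (hV.mem_nhds hy)).isSymmSndFDerivAt (by
    rw [minSmoothness_of_isRCLikeNormedField]; exact WithTop.coe_le_coe.2 le_top)
  have hd : DifferentiableAt ℝ (fderiv ℝ f) y :=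
    ((hf.fderiv_of_isOpen hV (m := ∞) (by simp)).contDiffAt (hV.mem_nhds hy)).differentiableAt
      (by simp)
  have e (i j : Fin 4) : partialDeriv i (partialDeriv j f) y =
      fderiv ℝ (fderiv ℝ f) y (EuclideanSpace.single i 1) (EuclideanSpace.single j 1) := by
    change fderiv ℝ (fun z => fderiv ℝ f z (EuclideanSpace.single j 1)) y _ = _
    rw [fderiv_clm_apply hd (differentiableAt_const _)]
    simp
  rw [e, e]
  exact h _ _

end PartialDerivatives

/-! ### Orthonormal frames of a metric bundle of rank three -/

section Frames

variable {M : Type*} [TopologicalSpace M] [ChartedSpace (EuclideanSpace ℝ (Fin 4)) M]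
  [IsManifold (𝓡 4) ∞ M]
  {E : M → Type*} [TopologicalSpace (TotalSpace (EuclideanSpace ℝ (Fin 3)) E)]
  [∀ x, NormedAddCommGroup (E x)] [∀ x, InnerProductSpace ℝ (E x)]
  [FiberBundle (EuclideanSpace ℝ (Fin 3)) E] [VectorBundle ℝ (EuclideanSpace ℝ (Fin 3)) E]
  [ContMDiffVectorBundle ∞ (EuclideanSpace ℝ (Fin 3)) E (𝓡 4)]

/-- `s` is a smooth frame of `E` over the open set `U`, orthonormal at each point of `U`. -/
structure IsSmoothOrthonormalFrame (s : Fin 3 → Π x : M, E x) (U : Set M) : Prop where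
  isOpen : IsOpen U
  contMDiffOn (c : Fin 3) : ContMDiffOn (𝓡 4) ((𝓡 4).prod 𝓘(ℝ, EuclideanSpace ℝ (Fin 3))) ∞
    (fun x => TotalSpace.mk' (EuclideanSpace ℝ (Fin 3)) x (s c x)) U
  orthonormal {x : M} (hx : x ∈ U) : Orthonormal ℝ fun c => s c x

lemma finrank_fiber (E : M → Type*) [TopologicalSpace (TotalSpace (EuclideanSpace ℝ (Fin 3)) E)]
    [∀ x, NormedAddCommGroup (E x)] [∀ x, InnerProductSpace ℝ (E x)]
    [FiberBundle (EuclideanSpace ℝ (Fin 3)) E] [VectorBundle ℝ (EuclideanSpace ℝ (Fin 3)) E]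
    (x : M) : Module.finrank ℝ (E x) = 3 := by
  have h := ((trivializationAt (EuclideanSpace ℝ (Fin 3)) E x).continuousLinearEquivAt ℝ x
    (FiberBundle.mem_baseSet_trivializationAt' x)).toLinearEquiv.finrank_eq
  rw [h]; simp

/-- The orthonormal basis of the fibre at `x` given by an orthonormal frame. -/
def IsSmoothOrthonormalFrame.basis {s : Fin 3 → Π x : M, E x} {U : Set M}
    (hs : IsSmoothOrthonormalFrame s U) {x : M} (hx : x ∈ U) :
    OrthonormalBasis (Fin 3) ℝ (E x) :=
  haveI : FiniteDimensional ℝ (E x) := .of_finrank_pos (by rw [finrank_fiber E x]; simp)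
  OrthonormalBasis.mk (hs.orthonormal hx) (by
    have h := LinearIndependent.span_eq_top_of_card_eq_finrank (hs.orthonormal hx).linearIndependent
      (by rw [finrank_fiber E x]; simp)
    exact h.ge)

@[simp] lemma IsSmoothOrthonormalFrame.basis_apply {s : Fin 3 → Π x : M, E x} {U : Set M}
    (hs : IsSmoothOrthonormalFrame s U) {x : M} (hx : x ∈ U) (c : Fin 3) :
    hs.basis hx c = s c x := by
  simp [basis]

variable [IsContMDiffRiemannianBundle (𝓡 4) ∞ (EuclideanSpace ℝ (Fin 3)) E]

/-- Orthonormal frames exist near each point, by Gram–Schmidt. -/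
lemma exists_isSmoothOrthonormalFrame (p : M) :
    ∃ (s : Fin 3 → Π x : M, E x) (U : Set M), IsSmoothOrthonormalFrame s U ∧ p ∈ U := by
  set t := trivializationAt (EuclideanSpace ℝ (Fin 3)) E p
  let u : Fin 3 → Π x : M, E x := fun c x => t.symm x (EuclideanSpace.single c 1)
  have hu (c : Fin 3) : ContMDiffOn (𝓡 4) ((𝓡 4).prod 𝓘(ℝ, EuclideanSpace ℝ (Fin 3))) ∞
      (fun x => TotalSpace.mk' (EuclideanSpace ℝ (Fin 3)) x (u c x)) t.baseSet := by
    rw [t.contMDiffOn_section_baseSet_iff]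
    refine (contMDiffOn_const (c := (EuclideanSpace.single c 1 : EuclideanSpace ℝ (Fin 3)))).congr
      fun y hy => ?_
    exact congrArg Prod.snd (Bundle.Trivialization.apply_mk_symm _ hy _)
  have hli {x : M} (hx : x ∈ t.baseSet) : LinearIndependent ℝ fun c => u c x := by
    have h := (EuclideanSpace.basisFun (Fin 3) ℝ).toBasis.linearIndependent
    have e : ⇑(EuclideanSpace.basisFun (Fin 3) ℝ).toBasis =
        fun i => (EuclideanSpace.single i 1 : EuclideanSpace ℝ (Fin 3)) := by
      ext1 i; simp
    rw [e] at h
    exact h.map' (t.continuousLinearEquivAt ℝ x hx).symm.toLinearEquiv.toLinearMap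
      (LinearEquiv.ker _)
  let v : Fin 3 → Π x : M, E x := fun c x => InnerProductSpace.gramSchmidt ℝ (fun d => u d x) c
  have hv0 {x : M} (hx : x ∈ t.baseSet) (c : Fin 3) : v c x ≠ 0 :=
    InnerProductSpace.gramSchmidt_ne_zero c (hli hx)
  have hv (c : Fin 3) : ContMDiffOn (𝓡 4) ((𝓡 4).prod 𝓘(ℝ, EuclideanSpace ℝ (Fin 3))) ∞
      (fun x => TotalSpace.mk' (EuclideanSpace ℝ (Fin 3)) x (v c x)) t.baseSet := by
    induction c using WellFoundedLT.induction with
    | ind c ih =>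
      have e : v c = u c - ∑ d ∈ Finset.Iio c,
          (fun x => inner ℝ (v d x) (u c x) / inner ℝ (v d x) (v d x)) • v d := by
        ext1 x
        simp only [v]
        rw [InnerProductSpace.gramSchmidt_def]
        simp [Submodule.starProjection_singleton]
      rw [e]
      refine (hu c).sub_section ?_
      have h := ContMDiffOn.sum_section (s := Finset.Iio c) (u := t.baseSet) (n := ∞)
        (I := 𝓡 4) (F := EuclideanSpace ℝ (Fin 3)) (V := E)
        (t := fun d => (fun x => inner ℝ (v d x) (u c x) / inner ℝ (v d x) (v d x)) • v d)
        (fun d hd => by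
          have hd := ih d (Finset.mem_Iio.1 hd)
          exact ((hd.inner_bundle (hu c)).div₀ (hd.inner_bundle hd) fun x hx =>
            inner_self_ne_zero.2 (hv0 hx d)).smul_section hd)
      convert h using 3
      simp
  refine ⟨fun c x => InnerProductSpace.gramSchmidtNormed ℝ (fun d => u d x) c, t.baseSet,
    ⟨t.open_baseSet, fun c => ?_, fun {x} hx => ?_⟩, FiberBundle.mem_baseSet_trivializationAt' p⟩
  · have h2 : ContMDiffOn (𝓡 4) 𝓘(ℝ, ℝ) ∞ (fun x => (√(inner ℝ (v c x) (v c x)))⁻¹) t.baseSet :=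
      fun x hx => by
        have h := inner_self_ne_zero (𝕜 := ℝ).2 (hv0 hx c)
        have h3 : ContDiffAt ℝ ∞ (fun r : ℝ => (√r)⁻¹) (inner ℝ (v c x) (v c x)) :=
          (contDiffAt_id.sqrt h).inv (Real.sqrt_ne_zero'.2 (real_inner_self_nonneg.lt_of_ne' h))
        exact h3.comp_contMDiffWithinAt (f := fun b => inner ℝ (v c b) (v c b))
          (((hv c).inner_bundle (hv c)) x hx)
    convert h2.smul_section (hv c) using 3
    simp [InnerProductSpace.gramSchmidtNormed, v]
  · exact InnerProductSpace.gramSchmidtNormed_orthonormal (hli hx)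

end Frames

/-! ### A metric connection in an orthonormal frame and coordinates -/

section Frames

variable {M : Type*} [TopologicalSpace M] [ChartedSpace (EuclideanSpace ℝ (Fin 4)) M]
  [IsManifold (𝓡 4) ∞ M] [T2Space M]
  {E : M → Type*} [TopologicalSpace (TotalSpace (EuclideanSpace ℝ (Fin 3)) E)]
  [∀ x, NormedAddCommGroup (E x)] [∀ x, InnerProductSpace ℝ (E x)]
  [FiberBundle (EuclideanSpace ℝ (Fin 3)) E] [VectorBundle ℝ (EuclideanSpace ℝ (Fin 3)) E]
  [ContMDiffVectorBundle ∞ (EuclideanSpace ℝ (Fin 3)) E (𝓡 4)]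

/-- The part of the image of the chart at `p` that lies over `U`. -/
def coordDomain (p : M) (U : Set M) : Set (EuclideanSpace ℝ (Fin 4)) :=
  (extChartAt (𝓡 4) p).target ∩ (extChartAt (𝓡 4) p).symm ⁻¹' U

lemma isOpen_coordDomain (p : M) {U : Set M} (hU : IsOpen U) : IsOpen (coordDomain p U) :=
  (continuousOn_extChartAt_symm p).isOpen_inter_preimage (isOpen_extChartAt_target p) hU

lemma contDiffOn_comp_symm {p : M} {U : Set M} {f : M → ℝ} (hf : ContMDiffOn (𝓡 4) 𝓘(ℝ, ℝ) ∞ f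
    ((extChartAt (𝓡 4) p).source ∩ U)) :
    ContDiffOn ℝ ∞ (fun y => f ((extChartAt (𝓡 4) p).symm y)) (coordDomain p U) := by
  rw [← contMDiffOn_iff_contDiffOn]
  exact hf.comp ((contMDiffOn_extChartAt_symm p).mono Set.inter_subset_left)
    fun y hy => ⟨(extChartAt (𝓡 4) p).map_target hy.1, hy.2⟩

/-- The coefficients `⟨s_c, ∇_{∂_i} s_d⟩` of a connection, in the chart at `p`. -/
def connCoeff (A : CovariantDerivative (𝓡 4) (EuclideanSpace ℝ (Fin 3)) E)
    (s : Fin 3 → Π x : M, E x) (p : M) (i : Fin 4) (c d : Fin 3)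
    (y : EuclideanSpace ℝ (Fin 4)) : ℝ :=
  let x := (extChartAt (𝓡 4) p).symm y
  inner ℝ (s c x) (A (s d) x (coordField p i x))

/-- The coefficients `⟨s_c, F_A(∂_i, ∂_j) s_d⟩` of the curvature, in the chart at `p`. -/
def curvCoeff (A : CovariantDerivative (𝓡 4) (EuclideanSpace ℝ (Fin 3)) E)
    [A.ContMDiffCovariantDerivative ∞]
    (s : Fin 3 → Π x : M, E x) (p : M) (i j : Fin 4) (c d : Fin 3)
    (y : EuclideanSpace ℝ (Fin 4)) : ℝ :=
  let x := (extChartAt (𝓡 4) p).symm y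
  inner ℝ (s c x) (A.curvature x (coordField p i x) (coordField p j x) (s d x))

variable [IsContMDiffRiemannianBundle (𝓡 4) ∞ (EuclideanSpace ℝ (Fin 3)) E]
  {A : CovariantDerivative (𝓡 4) (EuclideanSpace ℝ (Fin 3)) E}
  [A.ContMDiffCovariantDerivative ∞]
  {s : Fin 3 → Π x : M, E x} {U : Set M}

lemma contMDiffOn_apply_coordField (p : M) {u : Set M}
    (hu : IsOpen u) {σ : Π x : M, E x}
    (hσ : ContMDiffOn (𝓡 4) ((𝓡 4).prod 𝓘(ℝ, EuclideanSpace ℝ (Fin 3))) ∞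
      (fun x => TotalSpace.mk' (EuclideanSpace ℝ (Fin 3)) x (σ x)) u) (i : Fin 4) :
    ContMDiffOn (𝓡 4) ((𝓡 4).prod 𝓘(ℝ, EuclideanSpace ℝ (Fin 3))) ∞
      (fun x => TotalSpace.mk' (EuclideanSpace ℝ (Fin 3)) x (A σ x (coordField p i x)))
      ((extChartAt (𝓡 4) p).source ∩ u) := by
  intro x hx
  have h1 := A.contMDiffAt_apply hu hx.2 hσ
  have h2 := (contMDiffOn_coordField p i).contMDiffAt
    ((isOpen_extChartAt_source (I := 𝓡 4) p).mem_nhds hx.1)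
  exact (h1.clm_bundle_apply h2).contMDiffWithinAt

lemma contDiffOn_connCoeff (hs : IsSmoothOrthonormalFrame s U) (p : M) (i : Fin 4) (c d : Fin 3) :
    ContDiffOn ℝ ∞ (connCoeff A s p i c d) (coordDomain p U) :=
  contDiffOn_comp_symm (f := fun x => inner ℝ (s c x) (A (s d) x (coordField p i x)))
    (((hs.contMDiffOn c).mono Set.inter_subset_right).inner_bundle
      (contMDiffOn_apply_coordField p hs.isOpen (hs.contMDiffOn d) i))

lemma connCoeff_skew (hA : A.IsMetricCompatible) (hs : IsSmoothOrthonormalFrame s U) (p : M)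
    (i : Fin 4) (c d : Fin 3) {y : EuclideanSpace ℝ (Fin 4)} (hy : y ∈ coordDomain p U) :
    connCoeff A s p i c d y = -connCoeff A s p i d c y := by
  have hd (c : Fin 3) := ((hs.contMDiffOn c).contMDiffAt
    (hs.isOpen.mem_nhds hy.2)).mdifferentiableAt (by simp)
  have h := hA.mvfderiv_inner_eq (coordField p i) (hd c) (hd d)
  have h0 : (fun x => inner ℝ (s c x) (s d x)) =ᶠ[𝓝 ((extChartAt (𝓡 4) p).symm y)]
      fun _ => if c = d then (1 : ℝ) else 0 := by
    filter_upwards [hs.isOpen.mem_nhds hy.2] with z hz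
    exact orthonormal_iff_ite.1 (hs.orthonormal hz) c d
  have h1 : mvfderiv (𝓡 4) (fun x => (inner ℝ (s c x) (s d x) : ℝ))
      ((extChartAt (𝓡 4) p).symm y) = 0 := by
    rw [mvfderiv, h0.mfderiv_eq, mfderiv_const]
    exact ContinuousLinearMap.comp_zero _
  rw [h1] at h
  simp only [zero_apply] at h
  rw [real_inner_comm] at h
  simp only [connCoeff]
  linarith

/-- The covariant derivative of a section in terms of its coefficients. -/
lemma inner_apply_coordField (hA : A.IsMetricCompatible) (hs : IsSmoothOrthonormalFrame s U)
    (p : M) (i : Fin 4) (c : Fin 3) {y : EuclideanSpace ℝ (Fin 4)} (hy : y ∈ coordDomain p U)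
    {σ : Π x : M, E x}
    (hσ : MDifferentiableAt (𝓡 4) ((𝓡 4).prod 𝓘(ℝ, EuclideanSpace ℝ (Fin 3)))
      (fun x => TotalSpace.mk' (EuclideanSpace ℝ (Fin 3)) x (σ x)) ((extChartAt (𝓡 4) p).symm y)) :
    inner ℝ (s c ((extChartAt (𝓡 4) p).symm y))
        (A σ ((extChartAt (𝓡 4) p).symm y) (coordField p i ((extChartAt (𝓡 4) p).symm y))) =
      partialDeriv i (fun z => inner ℝ (s c ((extChartAt (𝓡 4) p).symm z))
          (σ ((extChartAt (𝓡 4) p).symm z))) y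
        + ∑ b, connCoeff A s p i c b y *
          inner ℝ (s b ((extChartAt (𝓡 4) p).symm y)) (σ ((extChartAt (𝓡 4) p).symm y)) := by
  have hd := ((hs.contMDiffOn c).contMDiffAt
    (hs.isOpen.mem_nhds hy.2)).mdifferentiableAt (by simp)
  have h := hA.mvfderiv_inner_eq (coordField p i) hd hσ
  rw [mvfderiv_coordField hy.1 (hd.inner_bundle hσ)] at h
  beta_reduce at h
  rw [h]
  have e := (hs.basis hy.2).sum_inner_mul_inner
    (A (s c) ((extChartAt (𝓡 4) p).symm y) (coordField p i ((extChartAt (𝓡 4) p).symm y)))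
    (σ ((extChartAt (𝓡 4) p).symm y))
  simp only [hs.basis_apply] at e
  rw [← e]
  have e2 (b : Fin 3) : connCoeff A s p i c b y = - inner ℝ
      (A (s c) ((extChartAt (𝓡 4) p).symm y) (coordField p i ((extChartAt (𝓡 4) p).symm y)))
      (s b ((extChartAt (𝓡 4) p).symm y)) := by
    rw [connCoeff_skew hA hs p i c b hy, real_inner_comm]; rfl
  simp only [e2, neg_mul, Finset.sum_neg_distrib]
  ring

/-- The curvature of a section `σ` along the coordinate fields, in terms of the curvature
`dA + A ∧ A` of the connection matrix; the second derivatives of `σ` cancel. -/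
lemma inner_curvatureAux (hA : A.IsMetricCompatible) (hs : IsSmoothOrthonormalFrame s U)
    (p : M) (i j : Fin 4) (c : Fin 3) {y : EuclideanSpace ℝ (Fin 4)} (hy : y ∈ coordDomain p U)
    {u : Set M} (hu : IsOpen u) (hyu : (extChartAt (𝓡 4) p).symm y ∈ u) {σ : Π x : M, E x}
    (hσ : ContMDiffOn (𝓡 4) ((𝓡 4).prod 𝓘(ℝ, EuclideanSpace ℝ (Fin 3))) ∞
      (fun x => TotalSpace.mk' (EuclideanSpace ℝ (Fin 3)) x (σ x)) u) :
    inner ℝ (s c ((extChartAt (𝓡 4) p).symm y))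
        (A.curvatureAux ((extChartAt (𝓡 4) p).symm y) (coordField p i) (coordField p j) σ) =
      ∑ d, (partialDeriv i (connCoeff A s p j c d) y - partialDeriv j (connCoeff A s p i c d) y
        + ∑ b, (connCoeff A s p i c b y * connCoeff A s p j b d y
          - connCoeff A s p j c b y * connCoeff A s p i b d y)) *
        inner ℝ (s d ((extChartAt (𝓡 4) p).symm y)) (σ ((extChartAt (𝓡 4) p).symm y)) := by
  set φ := (extChartAt (𝓡 4) p).symm
  have hV := isOpen_coordDomain p (hs.isOpen.inter hu)
  have hyV : y ∈ coordDomain p (U ∩ u) := ⟨hy.1, hy.2, hyu⟩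
  have hsub : coordDomain p (U ∩ u) ⊆ coordDomain p U := fun z hz => ⟨hz.1, hz.2.1⟩
  let h (c : Fin 3) (z : EuclideanSpace ℝ (Fin 4)) : ℝ := inner ℝ (s c (φ z)) (σ (φ z))
  have hh (c : Fin 3) : ContDiffOn ℝ ∞ (h c) (coordDomain p (U ∩ u)) :=
    contDiffOn_comp_symm (f := fun x => inner ℝ (s c x) (σ x))
      (((hs.contMDiffOn c).mono fun z hz => hz.2.1).inner_bundle (hσ.mono fun z hz => hz.2.2))
  have hcc (i : Fin 4) (c d : Fin 3) := (contDiffOn_connCoeff (A := A) hs p i c d).mono hsub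
  -- the coefficients of `∇_j σ`
  have h1 (j : Fin 4) (c : Fin 3) (z : EuclideanSpace ℝ (Fin 4)) (hz : z ∈ coordDomain p (U ∩ u)) :
      inner ℝ (s c (φ z)) (A σ (φ z) (coordField p j (φ z))) =
        partialDeriv j (h c) z + ∑ b, connCoeff A s p j c b z * h b z :=
    inner_apply_coordField hA hs p j c (hsub hz)
      ((hσ.contMDiffAt (hu.mem_nhds hz.2.2)).mdifferentiableAt (by simp))
  have h2 (i j : Fin 4) : inner ℝ (s c (φ y))
      (A (fun x => A σ x (coordField p j x)) (φ y) (coordField p i (φ y))) =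
      partialDeriv i (partialDeriv j (h c)) y
        + ∑ b, (partialDeriv i (connCoeff A s p j c b) y * h b y
          + connCoeff A s p j c b y * partialDeriv i (h b) y)
        + ∑ b, connCoeff A s p i c b y *
          (partialDeriv j (h b) y + ∑ d, connCoeff A s p j b d y * h d y) := by
    have hm := (contMDiffOn_apply_coordField (A := A) p hu hσ j).contMDiffAt (x := φ y)
      (((isOpen_extChartAt_source (I := 𝓡 4) p).inter hu).mem_nhds
        ⟨(extChartAt (𝓡 4) p).map_target hy.1, hyu⟩)
    rw [inner_apply_coordField hA hs p i c hy (hm.mdifferentiableAt (by simp)),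
      partialDeriv_congr hV hyV (fun z hz => h1 j c z hz)]
    congr 1
    · have hd (b : Fin 3) : DifferentiableAt ℝ (fun z => connCoeff A s p j c b z * h b z) y :=
        (differentiableAt_of_contDiffOn (hcc j c b) hV hyV).mul
          (differentiableAt_of_contDiffOn (hh b) hV hyV)
      rw [partialDeriv_add
        (differentiableAt_of_contDiffOn (ContDiffOn.partialDeriv (hh c) hV j) hV hyV)
        (DifferentiableAt.fun_sum fun b _ => hd b), partialDeriv_sum _ fun b _ => hd b]
      congr 1
      refine Finset.sum_congr rfl fun b _ => ?_
      exact partialDeriv_mul (differentiableAt_of_contDiffOn (hcc j c b) hV hyV)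
        (differentiableAt_of_contDiffOn (hh b) hV hyV) i
    · exact Finset.sum_congr rfl fun b _ => by rw [← h1 j b y hyV]
  rw [CovariantDerivative.curvatureAux,
    mlieBracket_coordField ((extChartAt (𝓡 4) p).map_target hy.1), map_zero, sub_zero,
    inner_sub_right, h2, h2, partialDeriv_comm (hh c) hV hyV j i]
  simp only [Fin.sum_univ_three]
  ring

lemma curvature_coordField (p : M) (i j : Fin 4) {x : M} (hx : x ∈ (extChartAt (𝓡 4) p).source)
    (w : E x) :
    A.curvature x (coordField p i x) (coordField p j x) w =
      A.curvatureAux x (coordField p i) (coordField p j)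
        (FiberBundle.extend (EuclideanSpace ℝ (Fin 3)) w) := by
  have hb := FiberBundle.mem_baseSet_trivializationAt' (F := EuclideanSpace ℝ (Fin 3)) (E := E) x
  have ho := (trivializationAt (EuclideanSpace ℝ (Fin 3)) E x).open_baseSet
  have : IsManifold (𝓡 4) 1 M := .of_le (n := ∞) (by simp)
  have hX (i : Fin 4) := ((contMDiffOn_coordField p i).contMDiffAt
    ((isOpen_extChartAt_source (I := 𝓡 4) p).mem_nhds hx)).mdifferentiableAt (by simp)
  have hw := CovariantDerivative.contMDiffOn_extend (I := 𝓡 4) (F := EuclideanSpace ℝ (Fin 3)) w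
  have hE (v : TangentSpace (𝓡 4) x) :=
    FiberBundle.mdifferentiableAt_extend (𝓡 4) (EuclideanSpace ℝ (Fin 4)) v
  change A.curvatureAux x _ _ _ = _
  refine ((A.curvatureAux_tensorial_left ho hb hw (hE _)).pointwise (hE _) (hX i) ?_).trans
    ((A.curvatureAux_tensorial_right ho hb hw (hX i)).pointwise (hE _) (hX j) ?_) <;>
  exact FiberBundle.extend_apply_self _ _

lemma curvCoeff_eq (hA : A.IsMetricCompatible) (hs : IsSmoothOrthonormalFrame s U)
    (p : M) (i j : Fin 4) (c d : Fin 3) {y : EuclideanSpace ℝ (Fin 4)}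
    (hy : y ∈ coordDomain p U) :
    curvCoeff A s p i j c d y =
      partialDeriv i (connCoeff A s p j c d) y - partialDeriv j (connCoeff A s p i c d) y
        + ∑ b, (connCoeff A s p i c b y * connCoeff A s p j b d y
          - connCoeff A s p j c b y * connCoeff A s p i b d y) := by
  have ho := (trivializationAt (EuclideanSpace ℝ (Fin 3)) E
    ((extChartAt (𝓡 4) p).symm y)).open_baseSet
  rw [curvCoeff, curvature_coordField p i j ((extChartAt (𝓡 4) p).map_target hy.1),
    inner_curvatureAux hA hs p i j c hy ho (FiberBundle.mem_baseSet_trivializationAt' _)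
      (CovariantDerivative.contMDiffOn_extend _)]
  simp only [FiberBundle.extend_apply_self, orthonormal_iff_ite.1 (hs.orthonormal hy.2)]
  simp

end Frames

/-! ### The standard self-dual forms on `ℝ⁴` -/

section AdaptedFrames

/-- The standard self-dual forms `e⁰¹ + e²³`, `e⁰² + e³¹`, `e⁰³ + e¹²` on `ℝ⁴`, as matrices. -/
def omega (c : Fin 3) : Matrix (Fin 4) (Fin 4) ℝ :=
  ![!![0, 1, 0, 0; -1, 0, 0, 0; 0, 0, 0, 1; 0, 0, -1, 0],
    !![0, 0, 1, 0; 0, 0, 0, -1; -1, 0, 0, 0; 0, 1, 0, 0],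
    !![0, 0, 0, 1; 0, 0, 1, 0; 0, -1, 0, 0; -1, 0, 0, 0]] c

lemma omega_mul_self (c : Fin 3) : omega c * omega c = -1 := by
  ext k l
  fin_cases c <;> fin_cases k <;> fin_cases l <;>
    simp [omega, Matrix.mul_apply, Fin.sum_univ_four]

lemma omega_mul_succ (c : Fin 3) : omega c * omega (c + 1) = -omega (c + 2) := by
  ext k l
  fin_cases c <;> fin_cases k <;> fin_cases l <;>
    simp [omega, Matrix.mul_apply, Fin.sum_univ_four]

lemma omega_mul_add_two (c : Fin 3) : omega c * omega (c + 2) = omega (c + 1) := by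
  ext k l
  fin_cases c <;> fin_cases k <;> fin_cases l <;>
    simp [omega, Matrix.mul_apply, Fin.sum_univ_four]

lemma succ_succ (c : Fin 3) : c + 1 + 1 = c + 2 := by rw [add_assoc]; rfl
lemma succ_add_two (c : Fin 3) : c + 1 + 2 = c := by rw [add_assoc]; exact add_zero c
lemma add_two_succ (c : Fin 3) : c + 2 + 1 = c := by rw [add_assoc]; exact add_zero c
lemma add_two_add_two (c : Fin 3) : c + 2 + 2 = c + 1 := by rw [add_assoc]; rfl

/-- Three cases cover all pairs of indices in `Fin 3`. -/
lemma forall_fin_three_pair {p : Fin 3 → Fin 3 → Prop} (h0 : ∀ c, p c c)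
    (h1 : ∀ c, p c (c + 1)) (h2 : ∀ c, p c (c + 2)) (c d : Fin 3) : p c d := by
  have : d = c ∨ d = c + 1 ∨ d = c + 2 := by decide +revert
  rcases this with rfl | rfl | rfl
  exacts [h0 _, h1 _, h2 _]

/-- First-order variations `n c` of the `ω_c` which keep them skew and preserve the relations
`ω_c ω_d + ω_d ω_c = -2 δ_cd` are an infinitesimal rotation of the triple. -/
lemma exists_rotation_of_anticomm {n : Fin 3 → Matrix (Fin 4) (Fin 4) ℝ}
    (hskew : ∀ c k l, n c k l = -n c l k)
    (h : ∀ c d, n c * omega d + omega c * n d + n d * omega c + omega d * n c = 0) :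
    ∃ b : Fin 3 → ℝ, ∀ c, n c = b (c + 1) • omega (c + 2) - b (c + 2) • omega (c + 1) := by
  have hd (c k) : n c k k = 0 := by linarith [hskew c k k]
  have hs (c) : n c 1 0 = -n c 0 1 ∧ n c 2 0 = -n c 0 2 ∧ n c 3 0 = -n c 0 3 ∧
    n c 2 1 = -n c 1 2 ∧ n c 3 1 = -n c 1 3 ∧ n c 3 2 = -n c 2 3 :=
    ⟨hskew .., hskew .., hskew .., hskew .., hskew .., hskew ..⟩
  have he (c d k l) := congrFun (congrFun (h c d) k) l
  simp only [Matrix.add_apply, Matrix.mul_apply, Fin.sum_univ_four, Matrix.zero_apply] at he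
  -- the entries of the relations that are needed
  have a0 := he 0 0 0 0
  have a1 := he 0 0 2 2
  have a2 := he 0 0 0 2
  have a3 := he 0 0 0 3
  have b0 := he 1 1 0 0
  have b1 := he 1 1 1 1
  have b2 := he 1 1 0 1
  have b3 := he 1 1 0 3
  have c0 := he 2 2 0 0
  have c1 := he 2 2 1 1
  have c2 := he 2 2 0 1
  have c3 := he 2 2 0 2
  have d0 := he 0 1 0 0
  have d1 := he 0 2 0 0
  have d2 := he 1 2 0 0
  simp [omega, hd] at a0 a1 a2 a3 b0 b1 b2 b3 c0 c1 c2 c3 d0 d1 d2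
  refine ⟨![-n 1 0 3, n 0 0 3, -n 0 0 2], fun c => ?_⟩
  obtain ⟨p0, p1, p2, p3, p4, p5⟩ := hs 0
  obtain ⟨q0, q1, q2, q3, q4, q5⟩ := hs 1
  obtain ⟨r0, r1, r2, r3, r4, r5⟩ := hs 2
  ext k l
  fin_cases c <;> fin_cases k <;> fin_cases l <;> simp [omega, hd] <;> linarith

/-- If the variations of `exists_rotation_of_anticomm` depend linearly on a direction `a` and satisfy
the Bianchi identity, they vanish: the components `b a c` of the rotations are twelve unknowns, and
the Bianchi identity is twelve independent linear equations for them. -/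
lemma eq_zero_of_anticomm_of_cyclic {n : Fin 4 → Fin 3 → Matrix (Fin 4) (Fin 4) ℝ}
    (hskew : ∀ a c k l, n a c k l = -n a c l k)
    (h : ∀ a c d, n a c * omega d + omega c * n a d + n a d * omega c + omega d * n a c = 0)
    (hcyc : ∀ c i j k, n i c j k + n j c k i + n k c i j = 0) (a : Fin 4) (c : Fin 3) :
    n a c = 0 := by
  choose b hb using fun a => exists_rotation_of_anticomm (hskew a) (h a)
  have he (c i j k) := hcyc c i j k
  simp only [hb] at he
  have hb0 : ∀ a c, b a c = 0 := by
    -- one equation for each form and each three of the four directions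
    have a1 := he 0 0 1 2
    have a2 := he 0 0 1 3
    have a3 := he 0 0 2 3
    have a4 := he 0 1 2 3
    have b1 := he 1 0 1 2
    have b2 := he 1 0 1 3
    have b3 := he 1 0 2 3
    have b4 := he 1 1 2 3
    have c1 := he 2 0 1 2
    have c2 := he 2 0 1 3
    have c3 := he 2 0 2 3
    have c4 := he 2 1 2 3
    simp [omega] at a1 a2 a3 a4 b1 b2 b3 b4 c1 c2 c3 c4
    intro a c
    fin_cases a <;> fin_cases c <;> simp <;> linarith
  simp [hb, hb0]

/-- With the symmetries of a Riemann tensor, acting by a scalar on the self-dual forms determines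
the Ricci tensor `∑ Rm(e_i, e_j, e_k, e_i)`. -/
lemma ricci_of_curvature_selfDual {τ : ℝ}
    {Rm : Fin 4 → Fin 4 → Fin 4 → Fin 4 → ℝ} (h1 : ∀ a b c d, Rm a b c d = -Rm b a c d)
    (h2 : ∀ a b c d, Rm a b c d = -Rm a b d c)
    (h3 : ∀ a b c d, Rm a b c d + Rm b c a d + Rm c a b d = 0)
    (h : ∀ a b c, ∑ k, ∑ l, Rm a b k l * omega c k l = τ * omega c a b) (j k : Fin 4) :
    ∑ i, Rm i j k i = if j = k then -(3 / 2) * τ else 0 := by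
  -- pair symmetry, from the other three symmetries
  have hp (a b c d) : Rm a b c d = Rm c d a b := by
    linarith [h3 a b c d, h3 b c d a, h3 c d a b, h3 d a b c, h1 a b c d, h2 a b c d, h1 c d a b,
      h2 c d a b, h1 b c d a, h2 b c d a, h1 d a b c, h2 d a b c, h1 c a b d, h1 d b c a,
      h1 a c d b, h1 b d a c, h2 c a b d, h2 d b c a,
      h2 a c d b, h2 b d a c, h2 a c b d, h2 b d c a, h2 a d b c, h1 a d b c, h2 d a c b,
      h1 a d c b, h2 b c a d]
  -- the hypothesis, with each pair of indices counted once
  have hh (a b) : Rm a b 0 1 + Rm a b 2 3 = τ / 2 * omega 0 a b ∧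
      Rm a b 0 2 - Rm a b 1 3 = τ / 2 * omega 1 a b ∧
      Rm a b 0 3 + Rm a b 1 2 = τ / 2 * omega 2 a b := by
    have e0 := h a b 0
    have e1 := h a b 1
    have e2 := h a b 2
    have s1 := h2 a b 1 0
    have s2 := h2 a b 2 0
    have s3 := h2 a b 3 0
    have s4 := h2 a b 2 1
    have s5 := h2 a b 3 1
    have s6 := h2 a b 3 2
    generalize omega 0 a b = w0 at *
    generalize omega 1 a b = w1 at *
    generalize omega 2 a b = w2 at *
    simp [omega, Fin.sum_univ_four] at e0 e1 e2
    refine ⟨?_, ?_, ?_⟩ <;> linarith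
  have e01 := hh 0 1
  have e02 := hh 0 2
  have e03 := hh 0 3
  have e12 := hh 1 2
  have e13 := hh 1 3
  have e23 := hh 2 3
  simp [omega] at e01 e02 e03 e12 e13 e23
  obtain ⟨x1, x2, x3⟩ := e01
  obtain ⟨y1, y2, y3⟩ := e02
  obtain ⟨z1, z2, z3⟩ := e03
  obtain ⟨u1, u2, u3⟩ := e12
  obtain ⟨v1, v2, v3⟩ := e13
  obtain ⟨w1, w2, w3⟩ := e23
  have d1 (a c d) : Rm a a c d = 0 := by linarith [h1 a a c d]
  have d2 (a c d) : Rm c d a a = 0 := by linarith [h2 c d a a]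
  have b := h3 0 1 2 3
  rw [h1 2 0] at b
  have hq := hp 1 2 0 3
  have hr := hp 0 2 1 3
  have hs := hp 0 1 2 3
  have f1 (c d) := h1 1 0 c d
  have f2 (c d) := h1 2 0 c d
  have f3 (c d) := h1 3 0 c d
  have f4 (c d) := h1 2 1 c d
  have f5 (c d) := h1 3 1 c d
  have f6 (c d) := h1 3 2 c d
  have g1 (c d) := h2 c d 1 0
  have g2 (c d) := h2 c d 2 0
  have g3 (c d) := h2 c d 3 0
  have g4 (c d) := h2 c d 2 1
  have g5 (c d) := h2 c d 3 1
  have g6 (c d) := h2 c d 3 2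
  have p1 := hp 0 2 0 1
  have p2 := hp 0 3 0 1
  have p3 := hp 1 2 0 1
  have p4 := hp 1 3 0 1
  have p5 := hp 2 3 0 1
  have p6 := hp 0 3 0 2
  have p7 := hp 1 2 0 2
  have p8 := hp 1 3 0 2
  have p9 := hp 2 3 0 2
  have q1 := hp 1 2 0 3
  have q2 := hp 1 3 0 3
  have q3 := hp 2 3 0 3
  have q4 := hp 1 3 1 2
  have q5 := hp 2 3 1 2
  have q6 := hp 2 3 1 3
  rw [Fin.sum_univ_four]
  fin_cases j <;> fin_cases k <;>
    simp [f1, f2, f3, f4, f5, f6, g1, g2, g3, g4, g5, g6, d1, d2] <;> linarith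

end AdaptedFrames

/-! ### Frames adapted to a triple of 2-forms -/

section AdaptedFrames

/-- The columns of `P` form an orthonormal frame for the inner product with matrix `G` in which the
2-forms `f 0, f 1, f 2` are `τ / 2` times the standard self-dual forms, with `τ = ±1`. -/
structure IsAdapted (G : Matrix (Fin 4) (Fin 4) ℝ) (f : Fin 3 → Matrix (Fin 4) (Fin 4) ℝ) (τ : ℝ)
    (P : Matrix (Fin 4) (Fin 4) ℝ) : Prop where
  sign : τ = 1 ∨ τ = -1
  metric : P.transpose * G * P = 1
  form (c : Fin 3) : P.transpose * f c * P = (τ / 2) • omega c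

lemma inv_eq_of_orthonormal {G P : Matrix (Fin 4) (Fin 4) ℝ} (h : P.transpose * G * P = 1) :
    G⁻¹ = P * P.transpose := by
  refine Matrix.inv_eq_left_inv ?_
  rw [mul_assoc, mul_eq_one_comm, h]

lemma sum_contract_cyclic (P : Matrix (Fin 4) (Fin 4) ℝ) {T : Fin 4 → Fin 4 → Fin 4 → ℝ}
    (hT : ∀ i j k, T i j k + T j k i + T k i j = 0) (a b c : Fin 4) :
    (∑ i, ∑ j, ∑ m, P i a * P j b * P m c * T i j m)
      + (∑ i, ∑ j, ∑ m, P i b * P j c * P m a * T i j m)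
      + (∑ i, ∑ j, ∑ m, P i c * P j a * P m b * T i j m) = 0 := by
  have e2 : ∑ i, ∑ j, ∑ m, P i b * P j c * P m a * T i j m =
      ∑ i, ∑ j, ∑ m, P i a * P j b * P m c * T j m i := by
    rw [Finset.sum_comm_cycle]
    refine Finset.sum_congr rfl fun i _ => Finset.sum_congr rfl fun j _ =>
      Finset.sum_congr rfl fun m _ => by ring
  have e3 : ∑ i, ∑ j, ∑ m, P i c * P j a * P m b * T i j m =
      ∑ i, ∑ j, ∑ m, P i a * P j b * P m c * T m i j := by
    rw [← Finset.sum_comm_cycle]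
    refine Finset.sum_congr rfl fun i _ => Finset.sum_congr rfl fun j _ =>
      Finset.sum_congr rfl fun m _ => by ring
  rw [e2, e3]
  simp only [← Finset.sum_add_distrib, ← mul_add, hT, mul_zero, Finset.sum_const_zero]

namespace IsAdapted

variable {G P : Matrix (Fin 4) (Fin 4) ℝ} {f : Fin 3 → Matrix (Fin 4) (Fin 4) ℝ} {τ : ℝ}

lemma mul_inv_right (h : IsAdapted G f τ P) : P * (P.transpose * G) = 1 :=
  mul_eq_one_comm.1 h.metric

lemma mul_inv_left (h : IsAdapted G f τ P) : G * P * P.transpose = 1 := by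
  rw [mul_eq_one_comm, ← mul_assoc, h.metric]

lemma sq (h : IsAdapted G f τ P) : τ * τ = 1 := by
  rcases h.sign with rfl | rfl <;> norm_num

lemma metric_eq (h : IsAdapted G f τ P) : G = G * P * (P.transpose * G) := by
  rw [mul_assoc, h.mul_inv_right, mul_one]

lemma metric_mul_inv (h : IsAdapted G f τ P) : G * G⁻¹ = 1 := by
  rw [inv_eq_of_orthonormal h.metric, ← mul_assoc, h.mul_inv_left]

lemma metric_inv_mul (h : IsAdapted G f τ P) : G⁻¹ * G = 1 :=
  mul_eq_one_comm.1 h.metric_mul_inv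

/-- A matrix is recovered from its conjugate by the frame. -/
lemma eq_conj (h : IsAdapted G f τ P) (N : Matrix (Fin 4) (Fin 4) ℝ) :
    N = G * P * (P.transpose * N * P) * (P.transpose * G) := by
  calc N = 1 * N * 1 := by simp
    _ = (G * P * P.transpose) * N * (P * (P.transpose * G)) := by
      rw [h.mul_inv_left, h.mul_inv_right]
    _ = _ := by simp only [mul_assoc]

lemma form_eq (h : IsAdapted G f τ P) (c : Fin 3) :
    f c = (τ / 2) • (G * P * omega c * (P.transpose * G)) := by
  rw [h.eq_conj (f c), h.form c]
  simp

lemma form_mul_form (h : IsAdapted G f τ P) (c d : Fin 3) :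
    f c * G⁻¹ * f d = (1 / 4 : ℝ) • (G * P * (omega c * omega d) * (P.transpose * G)) := by
  have e : P.transpose * (f c * G⁻¹ * f d) * P = (1 / 4 : ℝ) • (omega c * omega d) := by
    calc P.transpose * (f c * G⁻¹ * f d) * P
        = (P.transpose * f c * P) * (P.transpose * f d * P) := by
          rw [inv_eq_of_orthonormal h.metric]; simp only [mul_assoc]
      _ = _ := by
          rw [h.form, h.form, smul_mul_smul_comm]
          congr 1
          linear_combination (1 / 4) * h.sq
  rw [h.eq_conj (f c * G⁻¹ * f d), e]
  simp

lemma form_mul_self (h : IsAdapted G f τ P) (c : Fin 3) :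
    f c * G⁻¹ * f c = -(1 / 4 : ℝ) • G := by
  rw [h.form_mul_form, omega_mul_self]
  have e := h.metric_eq
  simp [← e]

lemma form_mul_succ (h : IsAdapted G f τ P) (c : Fin 3) :
    f c * G⁻¹ * f (c + 1) = -(τ / 2) • f (c + 2) := by
  rw [h.form_mul_form, omega_mul_succ, h.form_eq (c + 2), smul_smul,
    show -(τ / 2) * (τ / 2) = -(1 / 4) by linear_combination (-1 / 4) * h.sq]
  simp

lemma form_mul_add_two (h : IsAdapted G f τ P) (c : Fin 3) :
    f c * G⁻¹ * f (c + 2) = (τ / 2) • f (c + 1) := by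
  rw [h.form_mul_form, omega_mul_add_two, h.form_eq (c + 1), smul_smul,
    show (τ / 2) * (τ / 2) = 1 / 4 by linear_combination (1 / 4) * h.sq]

lemma form_succ_mul (h : IsAdapted G f τ P) (c : Fin 3) :
    f (c + 1) * G⁻¹ * f c = (τ / 2) • f (c + 2) := by
  fin_cases c
  exacts [h.form_mul_add_two 1, h.form_mul_add_two 2, h.form_mul_add_two 0]

lemma form_add_two_mul (h : IsAdapted G f τ P) (c : Fin 3) :
    f (c + 2) * G⁻¹ * f c = -(τ / 2) • f (c + 1) := by
  fin_cases c
  exacts [h.form_mul_succ 2, h.form_mul_succ 0, h.form_mul_succ 1]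

/-- The polarized quaternion relation. -/
lemma form_anticomm (h : IsAdapted G f τ P) (c d : Fin 3) :
    f c * G⁻¹ * f d + f d * G⁻¹ * f c = (if c = d then -(1 / 2) else 0 : ℝ) • G := by
  revert c d
  refine forall_fin_three_pair (fun c => ?_) (fun c => ?_) (fun c => ?_)
  · rw [h.form_mul_self, ← two_smul ℝ, smul_smul]; norm_num
  · rw [h.form_mul_succ, h.form_succ_mul]; simp
  · rw [h.form_mul_add_two, h.form_add_two_mul]; simp

/-- The metric is determined by the forms up to sign. -/
lemma metric_eq_forms (h : IsAdapted G f τ P) : G = -(2 * τ) • (f 1 * (f 2)⁻¹ * f 0) := by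
  have hinv : (f 2)⁻¹ = -(4 : ℝ) • (G⁻¹ * f 2 * G⁻¹) := by
    refine Matrix.inv_eq_right_inv ?_
    rw [mul_smul_comm, ← mul_assoc, ← mul_assoc, h.form_mul_self, smul_mul_assoc, smul_smul,
      h.metric_mul_inv]
    norm_num
  have h1 : f 1 * G⁻¹ * f 2 = -(τ / 2) • f 0 := h.form_mul_succ 1
  rw [hinv, mul_smul_comm, smul_mul_assoc, ← mul_assoc, ← mul_assoc, h1, smul_mul_assoc,
    smul_mul_assoc, h.form_mul_self, smul_smul, smul_smul, smul_smul]
  rw [show -(2 * τ) * -4 * -(τ / 2) * -(1 / 4) = 1 by linear_combination h.sq, one_smul]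

/-- A tensor `N` with the symmetries of the covariant derivative of the triple `f` (skew, a
derivation up to rotation, satisfying the Bianchi identity) vanishes. -/
lemma eq_zero_of_anticomm_of_cyclic (h : IsAdapted G f τ P)
    {N : Fin 4 → Fin 3 → Matrix (Fin 4) (Fin 4) ℝ} (hskew : ∀ i c k l, N i c k l = -N i c l k)
    (hN : ∀ i c d, N i c * G⁻¹ * f d + f c * G⁻¹ * N i d
      + (N i d * G⁻¹ * f c + f d * G⁻¹ * N i c) = 0)
    (hcyc : ∀ c i j k, N i c j k + N j c k i + N k c i j = 0) (i : Fin 4) (c : Fin 3) :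
    N i c = 0 := by
  let n : Fin 4 → Fin 3 → Matrix (Fin 4) (Fin 4) ℝ :=
    fun a c => P.transpose * (∑ i, P i a • N i c) * P
  have hT (i c) : (N i c).transpose = - N i c := by
    ext k l; simp [hskew i c l k]
  have hn : ∀ a c, n a c = 0 := by
    refine FourManifold.eq_zero_of_anticomm_of_cyclic (fun a c k l => ?_) (fun a c d => ?_)
      (fun c a k l => ?_)
    · have : (n a c).transpose = - n a c := by
        simp [n, Matrix.transpose_mul, Matrix.transpose_sum, hT, mul_assoc]
      simpa using congrFun (congrFun this l) k
    · have key (c d : Fin 3) (i : Fin 4) : P.transpose * (N i c * G⁻¹ * f d) * P =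
          (τ / 2) • (P.transpose * N i c * P * omega d) := by
        rw [← mul_smul_comm, ← h.form, inv_eq_of_orthonormal h.metric]
        simp only [mul_assoc]
      have key' (c d : Fin 3) (i : Fin 4) : P.transpose * (f c * G⁻¹ * N i d) * P =
          (τ / 2) • (omega c * (P.transpose * N i d * P)) := by
        rw [← smul_mul_assoc, ← h.form, inv_eq_of_orthonormal h.metric]
        simp only [mul_assoc]
      have h0 (i : Fin 4) : P.transpose * N i c * P * omega d + omega c * (P.transpose * N i d * P)
          + P.transpose * N i d * P * omega c + omega d * (P.transpose * N i c * P) = 0 := by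
        have h1 := congrArg (fun X => P.transpose * X * P) (hN i c d)
        simp only [mul_add, add_mul, key, key', mul_zero, zero_mul] at h1
        rw [← smul_add, ← smul_add, ← smul_add] at h1
        have hτ : τ / 2 ≠ 0 := by rcases h.sign with rfl | rfl <;> norm_num
        rw [← (smul_eq_zero_iff_right hτ).1 h1]
        abel
      have e (c : Fin 3) : n a c = ∑ i, P i a • (P.transpose * N i c * P) := by
        simp only [n, Finset.mul_sum, Finset.sum_mul, mul_smul_comm, smul_mul_assoc]
      simp only [e, Finset.mul_sum, Finset.sum_mul, mul_smul_comm, smul_mul_assoc]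
      simp only [← Finset.sum_add_distrib, ← smul_add, h0, smul_zero, Finset.sum_const_zero]
    · have e (a k l : Fin 4) : n a c k l = ∑ i, ∑ j, ∑ m, P i a * P j k * P m l * N i c j m := by
        simp only [n, Matrix.mul_apply, Matrix.sum_apply, Matrix.smul_apply, Matrix.transpose_apply,
          smul_eq_mul, Finset.mul_sum, Finset.sum_mul]
        rw [Finset.sum_comm_cycle, Finset.sum_comm]
        refine Finset.sum_congr rfl fun i _ => Finset.sum_congr rfl fun j _ =>
          Finset.sum_congr rfl fun m _ => by ring
      rw [e a k l, e k l a, e l a k]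
      exact sum_contract_cyclic P (hcyc c) a k l
  have h1 (a : Fin 4) : ∑ i, P i a • N i c = 0 := by
    have := hn a c
    rw [h.eq_conj (∑ i, P i a • N i c)]
    simp only [n] at this
    simp [this]
  ext k l
  have h2 : (Matrix.of fun i a => N a c k l : Matrix (Fin 4) (Fin 4) ℝ) * P = 0 := by
    ext u a
    have := congrFun (congrFun (h1 a) k) l
    simpa [Matrix.mul_apply, Matrix.sum_apply, mul_comm] using this
  have h3 := congrArg (· * (P.transpose * G)) h2
  simp only [mul_assoc, h.mul_inv_right, mul_one, zero_mul] at h3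
  simpa using congrFun (congrFun h3 0) i

/-- The curvature relation `[R_ij, f^c] = f^{c+1}_ij f^{c+2} - f^{c+2}_ij f^{c+1}` determines the
pairing of `R_ij` with the self-dual forms. -/
lemma trace_curvature (h : IsAdapted G f τ P) (hfT : ∀ c, (f c).transpose = -f c)
    {R : Matrix (Fin 4) (Fin 4) ℝ} (hG : G.transpose = G)
    (hR : R.transpose * G + G * R = 0) {w : Fin 3 → ℝ}
    (hf : ∀ c, -(R.transpose * f c) - f c * R + w (c + 1) • f (c + 2) - w (c + 2) • f (c + 1) = 0)
    (c : Fin 3) : (R * G⁻¹ * f c).trace = τ * w c := by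
  have hH : (G⁻¹).transpose = G⁻¹ := by rw [Matrix.transpose_nonsing_inv, hG]
  have hRT : R.transpose = -(G * R * G⁻¹) := by
    calc R.transpose = R.transpose * (G * G⁻¹) := by rw [h.metric_mul_inv, mul_one]
      _ = R.transpose * G * G⁻¹ := by rw [mul_assoc]
      _ = _ := by rw [eq_neg_of_add_eq_zero_left hR, neg_mul]
  have h0 (c : Fin 3) : (f c * G⁻¹).trace = 0 := by
    have := Matrix.trace_transpose (f c * G⁻¹)
    rw [Matrix.transpose_mul, hH, hfT, mul_neg, Matrix.trace_neg, Matrix.trace_mul_comm] at this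
    linarith
  -- the trace of the relation for `c + 1` against `f (c + 2)` isolates the pairing with `f c`
  have h1 := hf (c + 1)
  rw [succ_succ, succ_add_two, hRT] at h1
  have h2 := congrArg (fun X => (X * G⁻¹ * f (c + 2) * G⁻¹).trace) h1
  have r1 : f (c + 1) * G⁻¹ * f (c + 2) = -(τ / 2) • f c := by
    have := h.form_mul_succ (c + 1); rwa [succ_succ, succ_add_two] at this
  have r2 : f (c + 2) * G⁻¹ * f (c + 1) = (τ / 2) • f c := by
    have := h.form_succ_mul (c + 1); rwa [succ_succ, succ_add_two] at this
  have r3 := h.form_mul_add_two c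
  have t1 : (G * R * G⁻¹ * f (c + 1) * G⁻¹ * f (c + 2) * G⁻¹).trace
      = -(τ / 2) * (R * G⁻¹ * f c).trace := by
    rw [show G * R * G⁻¹ * f (c + 1) * G⁻¹ * f (c + 2) * G⁻¹
      = G * (R * G⁻¹ * (f (c + 1) * G⁻¹ * f (c + 2)) * G⁻¹) by simp only [mul_assoc],
      Matrix.trace_mul_comm, mul_assoc _ G⁻¹ G, h.metric_inv_mul, r1]
    simp
  have t2 : (f (c + 1) * R * G⁻¹ * f (c + 2) * G⁻¹).trace = τ / 2 * (R * G⁻¹ * f c).trace := by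
    rw [show f (c + 1) * R * G⁻¹ * f (c + 2) * G⁻¹ = f (c + 1) * (R * G⁻¹ * f (c + 2) * G⁻¹) by
      simp only [mul_assoc], Matrix.trace_mul_comm,
      show R * G⁻¹ * f (c + 2) * G⁻¹ * f (c + 1) = R * G⁻¹ * (f (c + 2) * G⁻¹ * f (c + 1)) by
      simp only [mul_assoc], r2]
    simp
  have t3 : (f c * G⁻¹ * f (c + 2) * G⁻¹).trace = 0 := by
    rw [r3, smul_mul_assoc, Matrix.trace_smul, h0, smul_zero]
  have t4 : (f (c + 2) * G⁻¹ * f (c + 2) * G⁻¹).trace = -1 := by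
    rw [h.form_mul_self, smul_mul_assoc, h.metric_mul_inv]
    simp
  simp only [neg_mul, sub_mul, add_mul, smul_mul_assoc, Matrix.trace_sub, Matrix.trace_add,
    Matrix.trace_smul, zero_mul, Matrix.trace_zero, t1, t2, t3, t4,
    neg_neg, smul_eq_mul] at h2
  have := h.sq
  linear_combination (-τ) * h2 + (-(R * G⁻¹ * f c).trace) * this

end IsAdapted

end AdaptedFrames

/-! ### Matrix-valued functions on `ℝ⁴` -/

section MatrixCalculus

variable {V : Set (EuclideanSpace ℝ (Fin 4))}
  {N N' : EuclideanSpace ℝ (Fin 4) → Matrix (Fin 4) (Fin 4) ℝ} {y : EuclideanSpace ℝ (Fin 4)}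

/-- The entrywise partial derivative of a matrix-valued function. -/
def matDeriv (i : Fin 4) (N : EuclideanSpace ℝ (Fin 4) → Matrix (Fin 4) (Fin 4) ℝ)
    (y : EuclideanSpace ℝ (Fin 4)) : Matrix (Fin 4) (Fin 4) ℝ :=
  Matrix.of fun k l => partialDeriv i (fun z => N z k l) y

/-- All entries are smooth on `V`. -/
def MatSmooth (V : Set (EuclideanSpace ℝ (Fin 4)))
    (N : EuclideanSpace ℝ (Fin 4) → Matrix (Fin 4) (Fin 4) ℝ) : Prop :=
  ∀ k l, ContDiffOn ℝ ∞ (fun z => N z k l) V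

lemma MatSmooth.mul (h : MatSmooth V N) (h' : MatSmooth V N') :
    MatSmooth V (fun z => N z * N' z) := fun k l => by
  simp only [Matrix.mul_apply]
  exact ContDiffOn.sum fun m _ => (h k m).mul (h' m l)

lemma MatSmooth.add (h : MatSmooth V N) (h' : MatSmooth V N') :
    MatSmooth V (fun z => N z + N' z) := fun k l => (h k l).add (h' k l)

lemma MatSmooth.sub (h : MatSmooth V N) (h' : MatSmooth V N') :
    MatSmooth V (fun z => N z - N' z) := fun k l => (h k l).sub (h' k l)

lemma MatSmooth.smul {a : EuclideanSpace ℝ (Fin 4) → ℝ} (ha : ContDiffOn ℝ ∞ a V)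
    (h : MatSmooth V N) : MatSmooth V (fun z => a z • N z) := fun k l => ha.mul (h k l)

lemma MatSmooth.transpose (h : MatSmooth V N) : MatSmooth V (fun z => (N z).transpose) :=
  fun k l => h l k

lemma contDiffOn_det {n : ℕ} {N : EuclideanSpace ℝ (Fin 4) → Matrix (Fin n) (Fin n) ℝ}
    (h : ∀ k l, ContDiffOn ℝ ∞ (fun z => N z k l) V) : ContDiffOn ℝ ∞ (fun z => (N z).det) V := by
  simp only [Matrix.det_apply]
  refine ContDiffOn.sum fun σ _ => ?_
  simp only [Units.smul_def, zsmul_eq_mul]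
  exact contDiffOn_const.mul (contDiffOn_prod fun i _ => h _ _)

lemma MatSmooth.inv (h : MatSmooth V N) (hN : ∀ z ∈ V, (N z).det ≠ 0) :
    MatSmooth V (fun z => (N z)⁻¹) := fun k l => by
  simp only [Matrix.inv_def, Matrix.smul_apply, smul_eq_mul, Ring.inverse_eq_inv]
  refine ((contDiffOn_det h).inv hN).mul ?_
  simp only [Matrix.adjugate_apply]
  refine contDiffOn_det fun m n => ?_
  rcases eq_or_ne m l with rfl | hm
  · simp only [Matrix.updateRow_self]
    exact contDiffOn_const
  · simp only [Matrix.updateRow_ne hm]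
    exact h m n

lemma matDeriv_congr (hV : IsOpen V) (hy : y ∈ V) (h : ∀ z ∈ V, N z = N' z) (i : Fin 4) :
    matDeriv i N y = matDeriv i N' y := by
  ext k l
  exact partialDeriv_congr hV hy (fun z hz => by rw [h z hz]) i

lemma matDeriv_mul (hV : IsOpen V) (hy : y ∈ V) (h : MatSmooth V N) (h' : MatSmooth V N')
    (i : Fin 4) :
    matDeriv i (fun z => N z * N' z) y = matDeriv i N y * N' y + N y * matDeriv i N' y := by
  ext k l
  have hd (m : Fin 4) := differentiableAt_of_contDiffOn (h k m) hV hy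
  have hd' (m : Fin 4) := differentiableAt_of_contDiffOn (h' m l) hV hy
  simp only [matDeriv, Matrix.of_apply, Matrix.mul_apply, Matrix.add_apply]
  rw [partialDeriv_sum _ fun m _ => (hd m).fun_mul (hd' m), ← Finset.sum_add_distrib]
  exact Finset.sum_congr rfl fun m _ => partialDeriv_mul (hd m) (hd' m) i

lemma matDeriv_add (hV : IsOpen V) (hy : y ∈ V) (h : MatSmooth V N) (h' : MatSmooth V N')
    (i : Fin 4) :
    matDeriv i (fun z => N z + N' z) y = matDeriv i N y + matDeriv i N' y := by
  ext k l
  exact partialDeriv_add (differentiableAt_of_contDiffOn (h k l) hV hy)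
    (differentiableAt_of_contDiffOn (h' k l) hV hy) i

lemma matDeriv_sub (hV : IsOpen V) (hy : y ∈ V) (h : MatSmooth V N) (h' : MatSmooth V N')
    (i : Fin 4) :
    matDeriv i (fun z => N z - N' z) y = matDeriv i N y - matDeriv i N' y := by
  ext k l
  exact partialDeriv_sub (differentiableAt_of_contDiffOn (h k l) hV hy)
    (differentiableAt_of_contDiffOn (h' k l) hV hy) i

lemma matDeriv_smul {a : EuclideanSpace ℝ (Fin 4) → ℝ} (hV : IsOpen V) (hy : y ∈ V)
    (ha : ContDiffOn ℝ ∞ a V) (h : MatSmooth V N) (i : Fin 4) :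
    matDeriv i (fun z => a z • N z) y = partialDeriv i a y • N y + a y • matDeriv i N y := by
  ext k l
  exact partialDeriv_mul (differentiableAt_of_contDiffOn ha hV hy)
    (differentiableAt_of_contDiffOn (h k l) hV hy) i

lemma matDeriv_const_smul (c : ℝ) (hV : IsOpen V) (hy : y ∈ V) (h : MatSmooth V N) (i : Fin 4) :
    matDeriv i (fun z => c • N z) y = c • matDeriv i N y := by
  ext k l
  exact partialDeriv_const_mul (differentiableAt_of_contDiffOn (h k l) hV hy) c i

lemma matDeriv_const (c : Matrix (Fin 4) (Fin 4) ℝ) (i : Fin 4) :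
    matDeriv i (fun _ => c) y = 0 := by
  ext k l
  exact partialDeriv_const _ i

lemma matDeriv_transpose (i : Fin 4) :
    matDeriv i (fun z => (N z).transpose) y = (matDeriv i N y).transpose := rfl

lemma matDeriv_comm (hV : IsOpen V) (hy : y ∈ V) (h : MatSmooth V N) (i j : Fin 4) :
    matDeriv i (matDeriv j N) y = matDeriv j (matDeriv i N) y := by
  ext k l
  exact partialDeriv_comm (h k l) hV hy i j

end MatrixCalculus

/-! ### The Levi-Civita connection in coordinates -/

section LeviCivita

variable {V : Set (EuclideanSpace ℝ (Fin 4))}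
  {G : EuclideanSpace ℝ (Fin 4) → Matrix (Fin 4) (Fin 4) ℝ} {y : EuclideanSpace ℝ (Fin 4)}

/-- The matrix `(Γᵏ_ij)_{kj}` of Christoffel symbols of the metric `G`. -/
def christoffelMat (G : EuclideanSpace ℝ (Fin 4) → Matrix (Fin 4) (Fin 4) ℝ) (i : Fin 4)
    (y : EuclideanSpace ℝ (Fin 4)) : Matrix (Fin 4) (Fin 4) ℝ :=
  Matrix.of fun k j => (1 / 2) * ∑ l, (G y)⁻¹ k l *
    (partialDeriv i (fun z => G z j l) y + partialDeriv j (fun z => G z i l) y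
      - partialDeriv l (fun z => G z i j) y)

/-- The matrix `(R^l_ijk)_{lk}` of the curvature operator `R(∂_i, ∂_j)` of the metric `G`. -/
def riemannMat (G : EuclideanSpace ℝ (Fin 4) → Matrix (Fin 4) (Fin 4) ℝ) (i j : Fin 4)
    (y : EuclideanSpace ℝ (Fin 4)) : Matrix (Fin 4) (Fin 4) ℝ :=
  matDeriv i (christoffelMat G j) y - matDeriv j (christoffelMat G i) y
    + (christoffelMat G i y * christoffelMat G j y - christoffelMat G j y * christoffelMat G i y)

/-- `G` is a smooth (pseudo-)Riemannian metric on the open set `V`. -/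
structure IsCoordMetric (V : Set (EuclideanSpace ℝ (Fin 4)))
    (G : EuclideanSpace ℝ (Fin 4) → Matrix (Fin 4) (Fin 4) ℝ) : Prop where
  isOpen : IsOpen V
  smooth : MatSmooth V G
  symm {y : EuclideanSpace ℝ (Fin 4)} (hy : y ∈ V) : (G y).transpose = G y
  det_ne_zero {y : EuclideanSpace ℝ (Fin 4)} (hy : y ∈ V) : (G y).det ≠ 0

namespace IsCoordMetric

lemma partialDeriv_symm (hG : IsCoordMetric V G) (hy : y ∈ V) (i k l : Fin 4) :
    partialDeriv i (fun z => G z k l) y = partialDeriv i (fun z => G z l k) y :=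
  partialDeriv_congr hG.isOpen hy
    (fun _ hz => congrFun (congrFun (hG.symm hz) l) k) i

lemma christoffelMat_symm (hG : IsCoordMetric V G) (hy : y ∈ V) (i j k : Fin 4) :
    christoffelMat G i y k j = christoffelMat G j y k i := by
  simp only [christoffelMat, Matrix.of_apply]
  congr 1
  refine Finset.sum_congr rfl fun l _ => ?_
  rw [hG.partialDeriv_symm hy l i j]
  ring

lemma mul_inv (hG : IsCoordMetric V G) (hy : y ∈ V) : G y * (G y)⁻¹ = 1 :=
  Matrix.mul_nonsing_inv _ (isUnit_iff_ne_zero.2 (hG.det_ne_zero hy))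

lemma inv_mul (hG : IsCoordMetric V G) (hy : y ∈ V) : (G y)⁻¹ * G y = 1 :=
  Matrix.nonsing_inv_mul _ (isUnit_iff_ne_zero.2 (hG.det_ne_zero hy))

lemma smooth_inv (hG : IsCoordMetric V G) : MatSmooth V (fun z => (G z)⁻¹) :=
  hG.smooth.inv fun _ hz => hG.det_ne_zero hz

lemma smooth_christoffelMat (hG : IsCoordMetric V G) (i : Fin 4) :
    MatSmooth V (christoffelMat G i) := fun k j => by
  have hp (i k l : Fin 4) := ContDiffOn.partialDeriv (hG.smooth k l) hG.isOpen i
  exact contDiffOn_const.mul (ContDiffOn.sum fun l _ =>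
    (hG.smooth_inv k l).mul (((hp i j l).add (hp j i l)).sub (hp l i j)))

/-- The Levi-Civita connection is metric. -/
lemma matDeriv_metric (hG : IsCoordMetric V G) (hy : y ∈ V) (i : Fin 4) :
    matDeriv i G y = (christoffelMat G i y).transpose * G y + G y * christoffelMat G i y := by
  have e (m j : Fin 4) : (G y * christoffelMat G i y) m j = 1 / 2 *
      (partialDeriv i (fun z => G z j m) y + partialDeriv j (fun z => G z i m) y
      - partialDeriv m (fun z => G z i j) y) := by
    set d : Fin 4 → ℝ := fun l => partialDeriv i (fun z => G z j l) y
      + partialDeriv j (fun z => G z i l) y - partialDeriv l (fun z => G z i j) y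
    have h1 : (fun k => christoffelMat G i y k j) = (1 / 2 : ℝ) • Matrix.mulVec (G y)⁻¹ d := by
      ext k; simp [christoffelMat, Matrix.mulVec, dotProduct, d]
    have h2 : (G y * christoffelMat G i y) m j =
        Matrix.mulVec (G y) (fun k => christoffelMat G i y k j) m := rfl
    rw [h2, h1, Matrix.mulVec_smul, Matrix.mulVec_mulVec, hG.mul_inv hy, Matrix.one_mulVec]
    rfl
  have e2 : (christoffelMat G i y).transpose * G y = (G y * christoffelMat G i y).transpose := by
    rw [Matrix.transpose_mul, hG.symm hy]
  ext m j
  rw [e2, Matrix.add_apply, Matrix.transpose_apply, e, e]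
  simp only [matDeriv, Matrix.of_apply]
  rw [hG.partialDeriv_symm hy i j m]
  ring

lemma matDeriv_inv (hG : IsCoordMetric V G) (hy : y ∈ V) (i : Fin 4) :
    matDeriv i (fun z => (G z)⁻¹) y =
      -((G y)⁻¹ * (christoffelMat G i y).transpose) - christoffelMat G i y * (G y)⁻¹ := by
  have h1 := matDeriv_mul hG.isOpen hy hG.smooth hG.smooth_inv i
  rw [matDeriv_congr hG.isOpen hy (fun z hz => hG.mul_inv hz), matDeriv_const,
    hG.matDeriv_metric hy] at h1
  have h2 := congrArg (fun X => (G y)⁻¹ * X) h1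
  simp only [mul_zero, mul_add, add_mul] at h2
  have e1 : (G y)⁻¹ * ((christoffelMat G i y).transpose * G y * (G y)⁻¹) =
      (G y)⁻¹ * (christoffelMat G i y).transpose := by
    rw [mul_assoc _ (G y), hG.mul_inv hy, mul_one]
  have e2 : (G y)⁻¹ * (G y * christoffelMat G i y * (G y)⁻¹) =
      christoffelMat G i y * (G y)⁻¹ := by
    rw [← mul_assoc, ← mul_assoc, hG.inv_mul hy, one_mul]
  have e3 : (G y)⁻¹ * (G y * matDeriv i (fun z => (G z)⁻¹) y) =
      matDeriv i (fun z => (G z)⁻¹) y := by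
    rw [← mul_assoc, hG.inv_mul hy, one_mul]
  rw [e1, e2, e3] at h2
  rw [← sub_eq_zero, h2]
  abel

lemma riemannMat_swap (G : EuclideanSpace ℝ (Fin 4) → Matrix (Fin 4) (Fin 4) ℝ) (i j : Fin 4) :
    riemannMat G i j y = -riemannMat G j i y := by
  rw [riemannMat, riemannMat]; abel

/-- The first Bianchi identity. -/
lemma riemannMat_cyclic (hG : IsCoordMetric V G) (hy : y ∈ V) (i j k l : Fin 4) :
    riemannMat G i j y l k + riemannMat G j k y l i + riemannMat G k i y l j = 0 := by
  have hd (m i j : Fin 4) : matDeriv m (christoffelMat G i) y l j =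
      matDeriv m (christoffelMat G j) y l i :=
    partialDeriv_congr hG.isOpen hy (fun z hz => hG.christoffelMat_symm hz i j l) m
  have hc (i j k : Fin 4) : (christoffelMat G i y * christoffelMat G j y) l k =
      (christoffelMat G i y * christoffelMat G k y) l j := by
    simp only [Matrix.mul_apply]
    exact Finset.sum_congr rfl fun m _ => by rw [hG.christoffelMat_symm hy j k m]
  simp only [riemannMat, Matrix.add_apply, Matrix.sub_apply]
  rw [hd i j k, hd j k i, hd k i j, hc i j k, hc j k i, hc k i j]
  ring

/-- The curvature operator is skew with respect to the metric. -/
lemma riemannMat_skew (hG : IsCoordMetric V G) (hy : y ∈ V) (i j : Fin 4) :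
    (riemannMat G i j y).transpose * G y + G y * riemannMat G i j y = 0 := by
  have h (i j : Fin 4) : matDeriv j (matDeriv i G) y =
      (matDeriv j (christoffelMat G i) y).transpose * G y
      + (christoffelMat G i y).transpose * matDeriv j G y
      + (matDeriv j G y * christoffelMat G i y + G y * matDeriv j (christoffelMat G i) y) := by
    have hΓ := hG.smooth_christoffelMat i
    rw [matDeriv_congr hG.isOpen hy (fun z hz => hG.matDeriv_metric hz i),
      matDeriv_add hG.isOpen hy (hΓ.transpose.mul hG.smooth) (hG.smooth.mul hΓ),
      matDeriv_mul hG.isOpen hy hΓ.transpose hG.smooth,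
      matDeriv_mul hG.isOpen hy hG.smooth hΓ, matDeriv_transpose]
  have h1 := matDeriv_comm hG.isOpen hy hG.smooth i j
  rw [h i j, h j i, hG.matDeriv_metric hy, hG.matDeriv_metric hy] at h1
  simp only [riemannMat, Matrix.transpose_add, Matrix.transpose_sub, Matrix.transpose_mul]
  rw [← sub_eq_zero] at h1
  rw [← h1]
  noncomm_ring

end IsCoordMetric

end LeviCivita

/-! ### A perfect connection in coordinates: the curvature is parallel -/

section PerfectCoordinates

/-- A perfect `SO(3)` connection in coordinates. The `so(3)`-valued 1-form `a` is the connection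
form, `f` its curvature `da + a ∧ a`, and `G` a metric for which the components of `f` are, up to a
common factor, a standard frame of the self-dual forms. Indices in `Fin 3` are cyclic, so that
`[L_c, L_{c+1}] = L_{c+2}` in `so(3)`. -/
structure IsPerfectCoord (V : Set (EuclideanSpace ℝ (Fin 4)))
    (G : EuclideanSpace ℝ (Fin 4) → Matrix (Fin 4) (Fin 4) ℝ)
    (a : Fin 4 → Fin 3 → EuclideanSpace ℝ (Fin 4) → ℝ)
    (f : Fin 3 → EuclideanSpace ℝ (Fin 4) → Matrix (Fin 4) (Fin 4) ℝ) : Prop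
    extends IsCoordMetric V G where
  smooth_conn (i : Fin 4) (c : Fin 3) : ContDiffOn ℝ ∞ (a i c) V
  curv (c : Fin 3) (i j : Fin 4) {y : EuclideanSpace ℝ (Fin 4)} (hy : y ∈ V) :
    f c y i j = partialDeriv i (a j c) y - partialDeriv j (a i c) y
      + (a i (c + 1) y * a j (c + 2) y - a i (c + 2) y * a j (c + 1) y)
  adapted {y : EuclideanSpace ℝ (Fin 4)} (hy : y ∈ V) :
    ∃ τ P, IsAdapted (G y) (fun c => f c y) τ P

namespace IsPerfectCoord

variable {V : Set (EuclideanSpace ℝ (Fin 4))}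
  {G : EuclideanSpace ℝ (Fin 4) → Matrix (Fin 4) (Fin 4) ℝ}
  {a : Fin 4 → Fin 3 → EuclideanSpace ℝ (Fin 4) → ℝ}
  {f : Fin 3 → EuclideanSpace ℝ (Fin 4) → Matrix (Fin 4) (Fin 4) ℝ}
  {y : EuclideanSpace ℝ (Fin 4)}

lemma smooth_form (h : IsPerfectCoord V G a f) (c : Fin 3) : MatSmooth V (f c) := fun i j => by
  have hp (i j : Fin 4) := ContDiffOn.partialDeriv (h.smooth_conn j c) h.isOpen i
  refine (((hp i j).sub (hp j i)).add (((h.smooth_conn i (c + 1)).mul (h.smooth_conn j (c + 2))).sub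
    ((h.smooth_conn i (c + 2)).mul (h.smooth_conn j (c + 1))))).congr fun y hy => h.curv c i j hy

lemma form_skew (h : IsPerfectCoord V G a f) (hy : y ∈ V) (c : Fin 3) (i j : Fin 4) :
    f c y i j = -f c y j i := by
  rw [h.curv c i j hy, h.curv c j i hy]; ring

lemma form_transpose (h : IsPerfectCoord V G a f) (hy : y ∈ V) (c : Fin 3) :
    (f c y).transpose = -f c y := by
  ext i j; exact h.form_skew hy c j i

/-- The connection term in the covariant derivative of `f`. -/
def conn (a : Fin 4 → Fin 3 → EuclideanSpace ℝ (Fin 4) → ℝ)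
    (f : Fin 3 → EuclideanSpace ℝ (Fin 4) → Matrix (Fin 4) (Fin 4) ℝ) (i : Fin 4) (c : Fin 3)
    (y : EuclideanSpace ℝ (Fin 4)) : Matrix (Fin 4) (Fin 4) ℝ :=
  a i (c + 1) y • f (c + 2) y - a i (c + 2) y • f (c + 1) y

/-- The covariant derivative of the triple `f`, with the connection `a` on `so(3)` and the
Levi-Civita connection on forms. -/
def covDeriv (G : EuclideanSpace ℝ (Fin 4) → Matrix (Fin 4) (Fin 4) ℝ)
    (a : Fin 4 → Fin 3 → EuclideanSpace ℝ (Fin 4) → ℝ)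
    (f : Fin 3 → EuclideanSpace ℝ (Fin 4) → Matrix (Fin 4) (Fin 4) ℝ) (i : Fin 4) (c : Fin 3)
    (y : EuclideanSpace ℝ (Fin 4)) : Matrix (Fin 4) (Fin 4) ℝ :=
  matDeriv i (f c) y - (christoffelMat G i y).transpose * f c y - f c y * christoffelMat G i y
    + conn a f i c y

/-- The Bianchi identity `d_A F_A = 0`. -/
lemma bianchi (h : IsPerfectCoord V G a f) (hy : y ∈ V) (c : Fin 3) (i j k : Fin 4) :
    (matDeriv i (f c) y + conn a f i c y) j k + (matDeriv j (f c) y + conn a f j c y) k i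
      + (matDeriv k (f c) y + conn a f k c y) i j = 0 := by
  have ha (i : Fin 4) (c : Fin 3) := differentiableAt_of_contDiffOn (h.smooth_conn i c) h.isOpen hy
  have hp (i j : Fin 4) := differentiableAt_of_contDiffOn
    (ContDiffOn.partialDeriv (h.smooth_conn j c) h.isOpen i) h.isOpen hy
  have hd (i j k : Fin 4) : matDeriv i (f c) y j k =
      partialDeriv i (partialDeriv j (a k c)) y - partialDeriv i (partialDeriv k (a j c)) y
      + (partialDeriv i (a j (c + 1)) y * a k (c + 2) y + a j (c + 1) y * partialDeriv i (a k (c + 2)) y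
        - (partialDeriv i (a j (c + 2)) y * a k (c + 1) y
          + a j (c + 2) y * partialDeriv i (a k (c + 1)) y)) := by
    rw [matDeriv, Matrix.of_apply,
      partialDeriv_congr h.isOpen hy (fun z hz => h.curv c j k hz),
      partialDeriv_add ((hp j k).fun_sub (hp k j))
        (((ha j _).fun_mul (ha k _)).fun_sub ((ha j _).fun_mul (ha k _))),
      partialDeriv_sub (hp j k) (hp k j),
      partialDeriv_sub ((ha j _).fun_mul (ha k _)) ((ha j _).fun_mul (ha k _)),
      partialDeriv_mul (ha j _) (ha k _), partialDeriv_mul (ha j _) (ha k _)]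
  simp only [Matrix.add_apply, hd, conn, Matrix.sub_apply, Matrix.smul_apply, smul_eq_mul,
    h.curv _ _ _ hy, succ_succ, succ_add_two, add_two_succ, add_two_add_two]
  rw [partialDeriv_comm (h.smooth_conn k c) h.isOpen hy i j,
    partialDeriv_comm (h.smooth_conn j c) h.isOpen hy i k,
    partialDeriv_comm (h.smooth_conn i c) h.isOpen hy j k]
  ring

lemma covDeriv_skew (h : IsPerfectCoord V G a f) (hy : y ∈ V) (i : Fin 4) (c : Fin 3)
    (k l : Fin 4) : covDeriv G a f i c y k l = -covDeriv G a f i c y l k := by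
  have h1 : matDeriv i (f c) y k l = -matDeriv i (f c) y l k := by
    simp only [matDeriv, Matrix.of_apply]
    rw [partialDeriv_congr h.isOpen hy (fun z hz => h.form_skew hz c k l), partialDeriv_neg]
  have h2 : ((christoffelMat G i y).transpose * f c y) k l
      = -(f c y * christoffelMat G i y) l k := by
    have := congrFun (congrFun (Matrix.transpose_mul (f c y) (christoffelMat G i y)) k) l
    rw [h.form_transpose hy, Matrix.mul_neg, Matrix.neg_apply, Matrix.transpose_apply] at this
    linarith
  have h3 : ((christoffelMat G i y).transpose * f c y) l k
      = -(f c y * christoffelMat G i y) k l := by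
    have := congrFun (congrFun (Matrix.transpose_mul (f c y) (christoffelMat G i y)) l) k
    rw [h.form_transpose hy, Matrix.mul_neg, Matrix.neg_apply, Matrix.transpose_apply] at this
    linarith
  simp only [covDeriv, conn, Matrix.add_apply, Matrix.sub_apply, Matrix.smul_apply, smul_eq_mul, h1,
    h2, h3, h.form_skew hy _ k l]
  ring

lemma covDeriv_cyclic (h : IsPerfectCoord V G a f) (hy : y ∈ V) (c : Fin 3) (i j k : Fin 4) :
    covDeriv G a f i c y j k + covDeriv G a f j c y k i + covDeriv G a f k c y i j = 0 := by
  have hb := h.bianchi hy c i j k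
  have e1 (i j k : Fin 4) : ((christoffelMat G i y).transpose * f c y) j k =
      ∑ m, christoffelMat G i y m j * f c y m k := by
    simp [Matrix.mul_apply]
  have e2 (i j k : Fin 4) : (f c y * christoffelMat G i y) j k =
      -∑ m, christoffelMat G k y m i * f c y m j := by
    simp only [Matrix.mul_apply, ← Finset.sum_neg_distrib]
    refine Finset.sum_congr rfl fun m _ => ?_
    rw [h.form_skew hy, h.christoffelMat_symm hy i k]
    ring
  simp only [covDeriv, Matrix.add_apply, Matrix.sub_apply, e1, e2] at hb ⊢
  linear_combination hb

lemma covDeriv_anticomm (h : IsPerfectCoord V G a f) (hy : y ∈ V) (i : Fin 4) (c d : Fin 3) :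
    covDeriv G a f i c y * (G y)⁻¹ * f d y + f c y * (G y)⁻¹ * covDeriv G a f i d y
      + (covDeriv G a f i d y * (G y)⁻¹ * f c y + f d y * (G y)⁻¹ * covDeriv G a f i c y) = 0 := by
  obtain ⟨τ, P, hP⟩ := h.adapted hy
  -- differentiate the polarized quaternion relation
  have h1 := matDeriv_congr h.isOpen hy (i := i) (fun z hz => by
    obtain ⟨τ, P, hP⟩ := h.adapted hz
    exact hP.form_anticomm c d)
  have hs (c : Fin 3) := h.smooth_form c
  have hH := h.smooth_inv
  rw [matDeriv_add h.isOpen hy (((hs c).mul hH).mul (hs d)) (((hs d).mul hH).mul (hs c)),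
    matDeriv_mul h.isOpen hy ((hs c).mul hH) (hs d), matDeriv_mul h.isOpen hy ((hs d).mul hH) (hs c),
    matDeriv_mul h.isOpen hy (hs c) hH, matDeriv_mul h.isOpen hy (hs d) hH,
    matDeriv_const_smul _ h.isOpen hy h.smooth, h.matDeriv_inv hy, h.matDeriv_metric hy] at h1
  -- the connection terms cancel, since the connection is skew
  have h2 : conn a f i c y * (G y)⁻¹ * f d y + f c y * (G y)⁻¹ * conn a f i d y
      + (conn a f i d y * (G y)⁻¹ * f c y + f d y * (G y)⁻¹ * conn a f i c y) = 0 := by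
    have e (c d : Fin 3) : conn a f i c y * (G y)⁻¹ * f d y + f d y * (G y)⁻¹ * conn a f i c y =
        (a i (c + 1) y * (if c + 2 = d then -(1 / 2) else 0)
          - a i (c + 2) y * (if c + 1 = d then -(1 / 2) else 0)) • G y := by
      rw [sub_smul, mul_smul, mul_smul, ← hP.form_anticomm, ← hP.form_anticomm]
      simp only [conn, sub_mul, mul_sub, smul_mul_assoc, mul_smul_comm, smul_add]
      abel
    have e2 := congrArg₂ (· + ·) (e c d) (e d c)
    have e3 : (a i (c + 1) y * (if c + 2 = d then -(1 / 2) else 0)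
          - a i (c + 2) y * (if c + 1 = d then -(1 / 2) else 0)) +
        (a i (d + 1) y * (if d + 2 = c then -(1 / 2) else 0)
          - a i (d + 2) y * (if d + 1 = c then -(1 / 2) else 0)) = 0 := by
      fin_cases c <;> fin_cases d <;> simp
    rw [← add_smul, e3, zero_smul] at e2
    rw [← e2]
    abel
  have h3 := hP.form_anticomm c d
  have h4 (c : Fin 3) : matDeriv i (f c) y = covDeriv G a f i c y
      + (christoffelMat G i y).transpose * f c y + f c y * christoffelMat G i y
      - conn a f i c y := by
    rw [covDeriv]; abel
  rw [h4 c, h4 d, smul_add, ← mul_smul_comm, ← smul_mul_assoc, ← h3] at h1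
  rw [← sub_eq_zero] at h1
  rw [← h1, ← sub_eq_zero, ← h2]
  noncomm_ring

/-- The triple `f` is parallel: the Levi-Civita connection induces on the self-dual forms the given
connection. -/
lemma covDeriv_eq_zero (h : IsPerfectCoord V G a f) (hy : y ∈ V) (i : Fin 4) (c : Fin 3) :
    covDeriv G a f i c y = 0 := by
  obtain ⟨τ, P, hP⟩ := h.adapted hy
  exact hP.eq_zero_of_anticomm_of_cyclic (fun i c => h.covDeriv_skew hy i c)
    (fun i c d => h.covDeriv_anticomm hy i c d) (fun c => h.covDeriv_cyclic hy c) i c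

lemma matDeriv_form (h : IsPerfectCoord V G a f) (hy : y ∈ V) (i : Fin 4) (c : Fin 3) :
    matDeriv i (f c) y = (christoffelMat G i y).transpose * f c y + f c y * christoffelMat G i y
      - (a i (c + 1) y • f (c + 2) y - a i (c + 2) y • f (c + 1) y) := by
  have := h.covDeriv_eq_zero hy i c
  rw [covDeriv, conn] at this
  rw [← sub_eq_zero, ← this]
  abel

/-- The Ricci identity for the parallel triple `f`: the Riemann tensor acts on the self-dual forms
through the curvature of the given connection, that is, through `f` itself. -/
lemma riemannMat_comm_form (h : IsPerfectCoord V G a f) (hy : y ∈ V) (i j : Fin 4) (c : Fin 3) :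
    -((riemannMat G i j y).transpose * f c y) - f c y * riemannMat G i j y
      + f (c + 1) y i j • f (c + 2) y - f (c + 2) y i j • f (c + 1) y = 0 := by
  have hs (c : Fin 3) := h.smooth_form c
  have ha (i : Fin 4) (c : Fin 3) := h.smooth_conn i c
  have hd (i j : Fin 4) : matDeriv j (matDeriv i (f c)) y =
      (matDeriv j (christoffelMat G i) y).transpose * f c y
      + (christoffelMat G i y).transpose * matDeriv j (f c) y
      + (matDeriv j (f c) y * christoffelMat G i y + f c y * matDeriv j (christoffelMat G i) y)
      - (partialDeriv j (a i (c + 1)) y • f (c + 2) y + a i (c + 1) y • matDeriv j (f (c + 2)) y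
        - (partialDeriv j (a i (c + 2)) y • f (c + 1) y
          + a i (c + 2) y • matDeriv j (f (c + 1)) y)) := by
    have hΓ := h.smooth_christoffelMat i
    rw [matDeriv_congr h.isOpen hy (fun z hz => h.matDeriv_form hz i c),
      matDeriv_sub h.isOpen hy ((hΓ.transpose.mul (hs c)).add ((hs c).mul hΓ))
        ((MatSmooth.smul (ha _ _) (hs _)).sub (MatSmooth.smul (ha _ _) (hs _))),
      matDeriv_add h.isOpen hy (hΓ.transpose.mul (hs c)) ((hs c).mul hΓ),
      matDeriv_sub h.isOpen hy (MatSmooth.smul (ha _ _) (hs _)) (MatSmooth.smul (ha _ _) (hs _)),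
      matDeriv_mul h.isOpen hy hΓ.transpose (hs c), matDeriv_mul h.isOpen hy (hs c) hΓ,
      matDeriv_smul h.isOpen hy (ha _ _) (hs _), matDeriv_smul h.isOpen hy (ha _ _) (hs _),
      matDeriv_transpose]
  have h1 := matDeriv_comm h.isOpen hy (hs c) i j
  rw [hd i j, hd j i] at h1
  simp only [h.matDeriv_form hy, succ_succ, succ_add_two, add_two_succ, add_two_add_two] at h1
  rw [← sub_eq_zero] at h1
  rw [← neg_eq_zero, ← h1, h.curv _ i j hy, h.curv _ i j hy]
  simp only [succ_succ, succ_add_two, add_two_succ, add_two_add_two, riemannMat,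
    Matrix.transpose_add, Matrix.transpose_sub, Matrix.transpose_mul, mul_add, add_mul, mul_sub,
    sub_mul, smul_mul_assoc, mul_smul_comm, smul_add, smul_sub, mul_assoc]
  module

end IsPerfectCoord

end PerfectCoordinates

/-! ### The Ricci tensor of a perfect connection in coordinates -/

section PerfectCoordinates

namespace IsPerfectCoord

variable {V : Set (EuclideanSpace ℝ (Fin 4))}
  {G : EuclideanSpace ℝ (Fin 4) → Matrix (Fin 4) (Fin 4) ℝ}
  {a : Fin 4 → Fin 3 → EuclideanSpace ℝ (Fin 4) → ℝ}
  {f : Fin 3 → EuclideanSpace ℝ (Fin 4) → Matrix (Fin 4) (Fin 4) ℝ}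
  {y : EuclideanSpace ℝ (Fin 4)} {τ : ℝ} {P : Matrix (Fin 4) (Fin 4) ℝ}

/-- On self-dual forms the curvature operator is multiplication by `τ`. -/
lemma trace_riemannMat (h : IsPerfectCoord V G a f) (hy : y ∈ V)
    (hP : IsAdapted (G y) (fun c => f c y) τ P) (i j : Fin 4) (c : Fin 3) :
    (riemannMat G i j y * (G y)⁻¹ * f c y).trace = τ * f c y i j :=
  hP.trace_curvature (fun c => h.form_transpose hy c) (h.symm hy) (h.riemannMat_skew hy i j)
    (w := fun c => f c y i j) (fun c => h.riemannMat_comm_form hy i j c) c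

/-- The Ricci tensor is `-(3 / 2) τ G`. -/
lemma sum_riemannMat (h : IsPerfectCoord V G a f) (hy : y ∈ V)
    (hP : IsAdapted (G y) (fun c => f c y) τ P) (j k : Fin 4) :
    ∑ i, riemannMat G i j y i k = -(3 / 2) * τ * G y j k := by
  set R := fun i j => riemannMat G i j y
  -- the Riemann tensor in the adapted frame
  let S : Fin 4 → Fin 4 → Matrix (Fin 4) (Fin 4) ℝ := fun i j => P.transpose * G y * R i j * P
  let Rm : Fin 4 → Fin 4 → Fin 4 → Fin 4 → ℝ :=
    fun a b c d => ∑ i, ∑ j, P i a * P j b * S i j d c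
  have hST (i j) : (S i j).transpose = -S i j := by
    have := h.riemannMat_skew hy i j
    have e : (R i j).transpose * G y = -(G y * R i j) := eq_neg_of_add_eq_zero_left this
    simp only [S, Matrix.transpose_mul, Matrix.transpose_transpose, h.symm hy]
    rw [← mul_assoc, ← mul_assoc, mul_assoc _ _ (G y), e]
    simp [mul_assoc]
  have h1 (a b c d) : Rm a b c d = -Rm b a c d := by
    simp only [Rm]
    rw [Finset.sum_comm, ← Finset.sum_neg_distrib]
    refine Finset.sum_congr rfl fun i _ => ?_
    rw [← Finset.sum_neg_distrib]
    refine Finset.sum_congr rfl fun j _ => ?_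
    have : S j i = -S i j := by
      simp only [S, R]
      rw [IsCoordMetric.riemannMat_swap]
      simp
    rw [this, Matrix.neg_apply]
    ring
  have h2 (a b c d) : Rm a b c d = -Rm a b d c := by
    simp only [Rm, ← Finset.sum_neg_distrib]
    refine Finset.sum_congr rfl fun i _ => Finset.sum_congr rfl fun j _ => ?_
    have := congrFun (congrFun (hST i j) c) d
    rw [Matrix.transpose_apply, Matrix.neg_apply] at this
    rw [this]
    ring
  have h3 (a b c d) : Rm a b c d + Rm b c a d + Rm c a b d = 0 := by
    have e (a b c) : Rm a b c d = ∑ i, ∑ j, ∑ m, P i a * P j b * P m c *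
        (P.transpose * G y * R i j) d m := by
      simp only [Rm, S]
      refine Finset.sum_congr rfl fun i _ => Finset.sum_congr rfl fun j _ => ?_
      rw [Matrix.mul_apply, Finset.mul_sum]
      exact Finset.sum_congr rfl fun m _ => by ring
    rw [e, e, e]
    refine sum_contract_cyclic P (fun i j m => ?_) a b c
    simp only [Matrix.mul_apply (M := P.transpose * G y), ← Finset.sum_add_distrib, ← mul_add]
    exact Finset.sum_eq_zero fun l _ => by rw [h.riemannMat_cyclic hy, mul_zero]
  have hτ : τ / 2 ≠ 0 := by rcases hP.sign with rfl | rfl <;> norm_num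
  have h4 (a b c) : ∑ k, ∑ l, Rm a b k l * omega c k l = τ * omega c a b := by
    have e (i j) : ∑ k, ∑ l, S i j l k * ((τ / 2) * omega c k l) = τ * f c y i j := by
      have e1 : ∑ k, ∑ l, S i j l k * ((τ / 2) * omega c k l) =
          (S i j * (P.transpose * f c y * P)).trace := by
        rw [hP.form, Matrix.trace, Finset.sum_comm]
        simp only [Matrix.mul_smul, Matrix.diag_apply, Matrix.smul_apply, Matrix.mul_apply,
          smul_eq_mul, Finset.mul_sum]
        exact Finset.sum_congr rfl fun l _ => Finset.sum_congr rfl fun k _ => by ring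
      rw [e1, ← h.trace_riemannMat hy hP]
      simp only [S]
      rw [show P.transpose * G y * R i j * P * (P.transpose * f c y * P) =
        P.transpose * G y * (R i j * (P * P.transpose) * f c y * P) by simp only [mul_assoc],
        Matrix.trace_mul_comm, mul_assoc _ P, hP.mul_inv_right, mul_one,
        ← inv_eq_of_orthonormal hP.metric]
    have e2 : ∑ i, ∑ j, P i a * P j b * f c y i j = τ / 2 * omega c a b := by
      have := congrFun (congrFun (hP.form c) a) b
      rw [Matrix.smul_apply, smul_eq_mul] at this
      rw [← this, Finset.sum_comm]
      simp only [Matrix.mul_apply, Finset.sum_mul, Matrix.transpose_apply]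
      exact Finset.sum_congr rfl fun i _ => Finset.sum_congr rfl fun j _ => by ring
    refine mul_left_cancel₀ hτ ?_
    rw [mul_left_comm, ← e2, Finset.mul_sum, Finset.mul_sum]
    have e3 (i j : Fin 4) : τ * (P i a * P j b * f c y i j) =
        ∑ k, ∑ l, P i a * P j b * S i j l k * ((τ / 2) * omega c k l) := by
      rw [mul_left_comm, ← e i j, Finset.mul_sum]
      refine Finset.sum_congr rfl fun k _ => ?_
      rw [Finset.mul_sum]
      exact Finset.sum_congr rfl fun l _ => by ring
    simp only [Finset.mul_sum (s := Finset.univ) (a := τ), e3, Rm, Finset.sum_mul, Finset.mul_sum]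
    rw [Finset.sum_comm_cycle]
    refine Finset.sum_congr rfl fun i _ => ?_
    rw [Finset.sum_comm_cycle]
    exact Finset.sum_congr rfl fun j _ => Finset.sum_congr rfl fun k _ =>
      Finset.sum_congr rfl fun l _ => by ring
  -- back from the adapted frame to coordinates
  have h5 := ricci_of_curvature_selfDual h1 h2 h3 h4
  set ric : Matrix (Fin 4) (Fin 4) ℝ := Matrix.of fun j k => ∑ i, R i j i k
  have h6 : P.transpose * ric * P = (-(3 / 2) * τ) • 1 := by
    ext b c
    rw [Matrix.smul_apply, Matrix.one_apply, smul_eq_mul, mul_ite, mul_one, mul_zero, ← h5 b c]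
    have e (i j) : ∑ a, P i a * S i j a c = (R i j * P) i c := by
      rw [← Matrix.mul_apply]
      simp only [S]
      rw [mul_assoc, ← mul_assoc, hP.mul_inv_right, one_mul]
    have e1 : ∑ a, Rm a b c a = ∑ i, ∑ j, P j b * (R i j * P) i c := by
      simp only [Rm]
      rw [Finset.sum_comm_cycle, Finset.sum_comm_cycle]
      refine Finset.sum_congr rfl fun i _ => Finset.sum_congr rfl fun j _ => ?_
      rw [← e, Finset.mul_sum]
      exact Finset.sum_congr rfl fun a _ => by ring
    rw [e1, mul_assoc]
    simp only [ric, Matrix.mul_apply, Matrix.transpose_apply, Matrix.of_apply, Finset.mul_sum,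
      Finset.sum_mul]
    rw [Finset.sum_comm, Finset.sum_comm_cycle]
    refine Finset.sum_congr rfl fun i _ => ?_
    rw [Finset.sum_comm]
  have h7 := hP.eq_conj ric
  rw [h6] at h7
  have h8 : ric = (-(3 / 2) * τ) • G y := by
    rw [h7]
    have e := hP.metric_eq
    simp [← e]
  exact congrFun (congrFun h8 j) k

end IsPerfectCoord

end PerfectCoordinates

/-! ### Definite triples of 2-forms on a four-dimensional space -/

section Triples

variable {T : Type*} [AddCommGroup T] [Module ℝ T] {φ : Fin 3 → LinearMap.BilinForm ℝ T}
  {μ : (Fin 4 → T) → ℝ}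

/-- Definiteness makes `v ↦ (φ c u v)_c` onto `ℝ³`, by counting dimensions: its kernel is the span
of `u`. -/
lemma exists_dual_vectors (hT : Module.finrank ℝ T = 4) (halt : ∀ c, (φ c).IsAlt)
    (hdef : ∀ u v : T, LinearIndependent ℝ ![u, v] → ∃ c, φ c u v ≠ 0) {u : T} (hu : u ≠ 0) :
    ∃ w : Fin 3 → T, ∀ c d, φ c u (w d) = if c = d then 1 else 0 := by
  have : FiniteDimensional ℝ T := Module.finite_of_finrank_eq_succ hT
  let L : T →ₗ[ℝ] (Fin 3 → ℝ) := LinearMap.pi fun c => φ c u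
  have hker : LinearMap.ker L = Submodule.span ℝ {u} := by
    refine le_antisymm (fun v hv => ?_) ?_
    · by_contra hvu
      have hli : LinearIndependent ℝ ![u, v] := by
        rw [LinearIndependent.pair_iff' hu]
        rintro a rfl
        exact hvu (Submodule.smul_mem _ _ (Submodule.mem_span_singleton_self u))
      obtain ⟨c, hc⟩ := hdef u v hli
      exact hc (congrFun hv c)
    · rw [Submodule.span_singleton_le_iff_mem]
      ext c
      exact halt c u
  have hr : LinearMap.range L = ⊤ := by
    refine Submodule.eq_top_of_finrank_eq ?_
    have h1 := L.finrank_range_add_finrank_ker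
    rw [hker, finrank_span_singleton hu, hT] at h1
    simp
    omega
  choose w hw using fun d : Fin 3 => LinearMap.range_eq_top.1 hr (fun c => if c = d then 1 else 0)
  exact ⟨w, fun c d => congrFun (hw d) c⟩

lemma linearIndependent_of_form_eq {e : Fin 4 → T} {τ : ℝ} (hτ : τ = 1 ∨ τ = -1)
    (h : ∀ i j, φ 0 (e i) (e j) = τ / 2 * omega 0 i j) : LinearIndependent ℝ e := by
  rw [Fintype.linearIndependent_iff]
  intro g hg
  have h1 (j : Fin 4) : ∑ i, g i * (τ / 2 * omega 0 j i) = 0 := by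
    have := congrArg (φ 0 (e j)) hg
    simpa [h] using this
  have h10 := h1 0
  have h11 := h1 1
  have h12 := h1 2
  have h13 := h1 3
  simp only [Fin.sum_univ_four] at h10 h11 h12 h13
  rcases hτ with rfl | rfl <;> simp [omega] at h10 h11 h12 h13 <;> intro i <;> fin_cases i <;>
    assumption

/-- A definite triple of 2-forms whose wedge products are `½ δ_cd μ` is, up to a sign, half the
triple of standard self-dual forms of some basis. -/
lemma exists_basis_of_definite (hT : Module.finrank ℝ T = 4) (halt : ∀ c, (φ c).IsAlt)
    (hdef : ∀ u v : T, LinearIndependent ℝ ![u, v] → ∃ c, φ c u v ≠ 0)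
    (hw : ∀ c d e, wedge (φ c) (φ d) e = if c = d then 1 / 2 * μ e else 0) :
    ∃ (b : Module.Basis (Fin 4) ℝ T) (τ : ℝ), (τ = 1 ∨ τ = -1) ∧
      ∀ c i j, φ c (b i) (b j) = τ / 2 * omega c i j := by
  have : Nontrivial T := Module.nontrivial_of_finrank_pos (R := ℝ) (by omega)
  obtain ⟨u, hu⟩ := exists_ne (0 : T)
  obtain ⟨w, huw⟩ := exists_dual_vectors hT halt hdef hu
  have hneg (c) (x y : T) : φ c x y = -φ c y x := ((halt c).neg_eq x y).symm ▸ by simp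
  -- in terms of `u, w 0, w 1, w 2`, the matrix `B c d = φ c (w (d + 1)) (w (d + 2))` is scalar plus
  -- skew; adding multiples of `u` to the `w c` removes the skew part
  let B (c d : Fin 3) : ℝ := φ c (w (d + 1)) (w (d + 2))
  set m := μ ![u, w 0, w 1, w 2]
  have hB (c d : Fin 3) : B c d + B d c = if c = d then 1 / 2 * m else 0 := by
    rw [← hw c d]
    simp only [wedge, B, Matrix.cons_val]
    rw [hneg c (w 0) (w 2), hneg d (w 0) (w 2)]
    fin_cases c <;> fin_cases d <;> simp [huw] <;> ring
  let t : Fin 3 → ℝ := fun c => -B (c + 1) (c + 2)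
  let v : Fin 3 → T := fun c => w c + t c • u
  have huv (c d) : φ c u (v d) = if c = d then 1 else 0 := by
    simp [v, huw, (halt c) u]
  have hvv (c d : Fin 3) : φ c (v (d + 1)) (v (d + 2)) = if c = d then m / 4 else 0 := by
    have e : φ c (v (d + 1)) (v (d + 2)) =
        B c d + t (d + 1) * φ c u (w (d + 2)) - t (d + 2) * φ c u (w (d + 1)) := by
      simp [v, B, (halt c) u, hneg c (w (d + 1)) u]
      ring
    rw [e, huw, huw]
    have h00 := hB 0 0
    have h11 := hB 1 1
    have h22 := hB 2 2
    have h01 := hB 0 1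
    have h02 := hB 0 2
    have h12 := hB 1 2
    simp at h00 h11 h22 h01 h02 h12
    fin_cases c <;> fin_cases d <;> simp [t] <;> linarith
  have hm : m ≠ 0 := by
    intro hm
    have hli : LinearIndependent ℝ ![v 1, v 2] := by
      rw [LinearIndependent.pair_iff]
      intro x y hxy
      have h1 := congrArg (φ 1 u) hxy
      have h2 := congrArg (φ 2 u) hxy
      simp [huv] at h1 h2
      exact ⟨h1, h2⟩
    obtain ⟨c, hc⟩ := hdef _ _ hli
    refine hc ((hvv c 0).trans ?_)
    simp [hm]
  -- rescaling `u` by `α` and the `v c` by `β` normalizes both kinds of components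
  obtain ⟨τ, β, α, hτ, hβ, hα⟩ : ∃ τ β α : ℝ, (τ = 1 ∨ τ = -1) ∧ β * β * (m / 4) = τ / 2 ∧
      α * β = τ / 2 := by
    obtain ⟨τ, hτ, hpos⟩ : ∃ τ : ℝ, (τ = 1 ∨ τ = -1) ∧ 0 < τ * m := by
      rcases lt_or_gt_of_ne hm with h | h
      · exact ⟨-1, Or.inr rfl, by linarith⟩
      · exact ⟨1, Or.inl rfl, by linarith⟩
    have hττ : τ * τ = 1 := by rcases hτ with rfl | rfl <;> norm_num
    have hs : 0 < √(2 / (τ * m)) := Real.sqrt_pos.2 (by positivity)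
    refine ⟨τ, √(2 / (τ * m)), τ / 2 / √(2 / (τ * m)), hτ, ?_, by field_simp⟩
    rw [Real.mul_self_sqrt (by positivity)]
    have : τ ≠ 0 := left_ne_zero_of_mul hpos.ne'
    field_simp
    linear_combination (-4) * hττ
  let e : Fin 4 → T := ![α • u, β • v 0, β • v 1, β • v 2]
  have h01 (c) := hvv c 2
  have h12 (c) := hvv c 0
  have h20 (c) := hvv c 1
  simp at h01 h12 h20
  have he (c : Fin 3) (i j : Fin 4) : φ c (e i) (e j) = τ / 2 * omega c i j := by
    have := halt c
    have h10 := hneg c (v 1) (v 0)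
    have h21 := hneg c (v 2) (v 1)
    have h02 := hneg c (v 0) (v 2)
    have hu0 (d) := hneg c (v d) u
    fin_cases i <;> fin_cases j <;> simp [e, huv, h01, h12, h20, h10, h21, h02, hu0, this _] <;>
      fin_cases c <;> simp [omega] <;> linarith
  have hli := linearIndependent_of_form_eq hτ (he 0)
  refine ⟨basisOfLinearIndependentOfCardEqFinrank hli (by simp [hT]), τ, hτ, fun c i j => ?_⟩
  simp [he]

end Triples

/-! ### Inner products with prescribed self-dual forms -/

section SelfDual

variable {T : Type*} [AddCommGroup T] [Module ℝ T] {φ : Fin 3 → LinearMap.BilinForm ℝ T}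
  {μ : (Fin 4 → T) → ℝ} {γ : LinearMap.BilinForm ℝ T}

/-- The matrix of a bilinear form on four vectors. -/
def formMatrix (β : LinearMap.BilinForm ℝ T) (e : Fin 4 → T) : Matrix (Fin 4) (Fin 4) ℝ :=
  Matrix.of fun i j => β (e i) (e j)

lemma formMatrix_eq_conj (β : LinearMap.BilinForm ℝ T) (b : Module.Basis (Fin 4) ℝ T)
    (e : Fin 4 → T) :
    formMatrix β e = (b.toMatrix e).transpose * formMatrix β b * b.toMatrix e := by
  ext i j
  simp only [formMatrix, Matrix.of_apply, Matrix.mul_apply, Matrix.transpose_apply]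
  conv_lhs => rw [← b.sum_toMatrix_smul_self e i, ← b.sum_toMatrix_smul_self e j]
  simp only [map_sum, map_smul, LinearMap.sum_apply, LinearMap.smul_apply, smul_eq_mul]
  refine Finset.sum_congr rfl fun k _ => ?_
  rw [Finset.sum_mul, Finset.mul_sum]
  exact Finset.sum_congr rfl fun l _ => by ring

lemma isOrthonormalFrame_iff {e : Fin 4 → T} :
    IsOrthonormalFrame (fun u v => γ u v) e ↔ formMatrix γ e = 1 := by
  constructor
  · intro h
    ext i j
    rw [Matrix.one_apply, ← h i j]; rfl
  · intro h i j
    have := congrFun (congrFun h i) j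
    rwa [Matrix.one_apply] at this

lemma exists_isOrthonormalFrame (hT : Module.finrank ℝ T = 4) (hsymm : ∀ u v, γ u v = γ v u)
    (hpos : ∀ u, u ≠ 0 → 0 < γ u u) : ∃ e, IsOrthonormalFrame (fun u v => γ u v) e := by
  have : FiniteDimensional ℝ T := Module.finite_of_finrank_eq_succ hT
  obtain ⟨v, hv⟩ := LinearMap.BilinForm.exists_orthogonal_basis (B := γ) ⟨fun u v => hsymm u v⟩
  have h (i) : 0 < γ (v i) (v i) := hpos _ (v.ne_zero i)
  refine ⟨fun i => (√(γ (v (i.cast hT.symm)) (v (i.cast hT.symm))))⁻¹ • v (i.cast hT.symm),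
    fun i j => ?_⟩
  split_ifs with hij
  · subst hij
    have h1 := Real.mul_self_sqrt (h (i.cast hT.symm)).le
    have h2 := Real.sqrt_pos.2 (h (i.cast hT.symm))
    simp only [map_smul, LinearMap.smul_apply, smul_eq_mul]
    field_simp
    linarith
  · have := hv (i := i.cast hT.symm) (j := j.cast hT.symm) (by simpa using hij)
    simp only [Function.onFun] at this
    simp [this]

/-- The square of the Pfaffian is the determinant. -/
lemma wedge_sq {α : LinearMap.BilinForm ℝ T} (hα : α.IsAlt) (e : Fin 4 → T) :
    wedge α α e ^ 2 = 4 * (formMatrix α e).det := by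
  have h (i j) : α (e i) (e j) = -α (e j) (e i) := by rw [hα.neg_eq]
  have h0 (i) : α (e i) (e i) = 0 := hα _
  rw [Matrix.det_succ_row_zero]
  simp [Fin.sum_univ_succ, Matrix.det_fin_three, formMatrix, wedge, h0, h 1 0, h 2 0, h 3 0, h 2 1,
    h 3 1, h 3 2, Fin.succAbove]
  ring

/-- In the orthonormal basis `b` this follows from the shape of `φ 0`; another orthonormal frame
differs by an orthogonal matrix, of determinant `± 1`. -/
lemma abs_eq_one_of_isOrthonormalFrame (halt : ∀ c, (φ c).IsAlt)
    (hw : ∀ c d e, wedge (φ c) (φ d) e = if c = d then 1 / 2 * μ e else 0)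
    {b : Module.Basis (Fin 4) ℝ T} {τ : ℝ} (hτ : τ = 1 ∨ τ = -1)
    (hb : ∀ c i j, φ c (b i) (b j) = τ / 2 * omega c i j)
    (hγ : IsOrthonormalFrame (fun u v => γ u v) b) {e : Fin 4 → T}
    (he : IsOrthonormalFrame (fun u v => γ u v) e) : |μ e| = 1 := by
  have hP := isOrthonormalFrame_iff.1 he
  rw [formMatrix_eq_conj γ b, isOrthonormalFrame_iff.1 hγ, mul_one] at hP
  have h0 : formMatrix (φ 0) b = (τ / 2) • omega 0 := by ext i j; simp [formMatrix, hb]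
  have h := wedge_sq (halt 0) e
  have hd : (omega 0).det = 1 := by
    rw [Matrix.det_succ_row_zero]
    simp [Fin.sum_univ_succ, Matrix.det_fin_three, omega, Fin.succAbove]
  have hdP := congrArg Matrix.det hP
  rw [Matrix.det_mul, Matrix.det_one] at hdP
  rw [formMatrix_eq_conj _ b, h0, Matrix.det_mul, Matrix.det_mul, mul_right_comm, hdP,
    Matrix.det_smul, hd, hw, if_pos rfl] at h
  refine ((sq_eq_sq_iff_abs_eq_abs (μ e) 1).1 ?_).trans abs_one
  rcases hτ with rfl | rfl <;> norm_num at h <;> linear_combination 4 * h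

lemma sum_smul_form_apply (φ : Fin 3 → LinearMap.BilinForm ℝ T) (x : Fin 3 → ℝ) (u v : T) :
    (∑ c, x c • φ c) u v = x 0 * φ 0 u v + x 1 * φ 1 u v + x 2 * φ 2 u v := by
  simp [Fin.sum_univ_three]

lemma wedge_sum_smul_self
    (hw : ∀ c d e, wedge (φ c) (φ d) e = if c = d then 1 / 2 * μ e else 0) (x : Fin 3 → ℝ)
    (e : Fin 4 → T) :
    wedge (∑ c, x c • φ c) (∑ c, x c • φ c) e = 1 / 2 * (x 0 ^ 2 + x 1 ^ 2 + x 2 ^ 2) * μ e := by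
  have e1 : wedge (∑ c, x c • φ c) (∑ c, x c • φ c) e =
      ∑ c, ∑ d, x c * x d * wedge (φ c) (φ d) e := by
    simp only [wedge, sum_smul_form_apply]
    simp only [Fin.sum_univ_three]
    ring
  rw [e1]
  simp [hw, Fin.sum_univ_three]
  ring

lemma eq_zero_of_sq_add_sq_add_sq {a b c : ℝ} (h : a ^ 2 + b ^ 2 + c ^ 2 = 0) :
    a = 0 ∧ b = 0 ∧ c = 0 := by
  have ha := sq_nonneg a
  have hb := sq_nonneg b
  have hc := sq_nonneg c
  exact ⟨pow_eq_zero_iff two_ne_zero |>.1 (by linarith),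
    pow_eq_zero_iff two_ne_zero |>.1 (by linarith), pow_eq_zero_iff two_ne_zero |>.1 (by linarith)⟩

/-- The norm, as a matrix, of a combination of the standard self-dual forms. -/
lemma trace_mul_transpose_omega {τ : ℝ} (hττ : τ * τ = 1) {N : Matrix (Fin 4) (Fin 4) ℝ}
    {x : Fin 3 → ℝ} (hN : ∀ i j, N i j = τ / 2 *
      (x 0 * omega 0 i j + x 1 * omega 1 i j + x 2 * omega 2 i j)) :
    (N * N.transpose).trace = x 0 ^ 2 + x 1 ^ 2 + x 2 ^ 2 := by
  simp only [Matrix.trace, Fin.sum_univ_four, Matrix.diag_apply, Matrix.mul_apply,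
    Matrix.transpose_apply, hN]
  simp [omega]
  linear_combination (x 0 ^ 2 + x 1 ^ 2 + x 2 ^ 2) * hττ

/-- In a basis adapted to the triple `φ`, the self-dual forms of the inner product that makes the
basis orthonormal are the combinations of the `φ c`. -/
lemma span_eq_selfDual (halt : ∀ c, (φ c).IsAlt)
    (hw : ∀ c d e, wedge (φ c) (φ d) e = if c = d then 1 / 2 * μ e else 0)
    {b : Module.Basis (Fin 4) ℝ T} {τ : ℝ} (hτ : τ = 1 ∨ τ = -1)
    (hb : ∀ c i j, φ c (b i) (b j) = τ / 2 * omega c i j)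
    (hγ : IsOrthonormalFrame (fun u v => γ u v) b) :
    {α | ∃ x : Fin 3 → ℝ, α = ∑ c, x c • φ c} = selfDual (fun u v => γ u v) μ := by
  have hττ : τ * τ = 1 := by rcases hτ with rfl | rfl <;> norm_num
  ext α
  constructor
  · rintro ⟨x, rfl⟩
    set α := ∑ c, x c • φ c
    have hα : α.IsAlt := fun v => by simp [α, fun c => halt c v]
    refine ⟨hα, fun e he hpos => ?_⟩
    have hμ : μ e = 1 := by
      rw [← abs_eq_one_of_isOrthonormalFrame halt hw hτ hb hγ he, abs_of_pos hpos]
    have hP := isOrthonormalFrame_iff.1 he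
    rw [formMatrix_eq_conj γ b, isOrthonormalFrame_iff.1 hγ, mul_one] at hP
    have hF := formMatrix_eq_conj α b e
    set P := b.toMatrix e
    set N := formMatrix α b
    have hN (i j) : N i j = τ / 2 *
        (x 0 * omega 0 i j + x 1 * omega 1 i j + x 2 * omega 2 i j) := by
      simp only [N, α, formMatrix, hb, Matrix.of_apply, sum_smul_form_apply]
      ring
    -- both `α ∧ α` and `|α|²` are known, and `|α - ∗α|² = 2 |α|² - 2 (α ∧ α)(e)`
    have hwα := wedge_sum_smul_self hw x e
    rw [hμ] at hwα
    have htr : (formMatrix α e * (formMatrix α e).transpose).trace =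
        x 0 ^ 2 + x 1 ^ 2 + x 2 ^ 2 := by
      have hP' : P * P.transpose = 1 := mul_eq_one_comm.1 hP
      have e1 : formMatrix α e * (formMatrix α e).transpose =
          P.transpose * N * (P * P.transpose) * N.transpose * P := by
        rw [hF]; simp only [Matrix.transpose_mul, Matrix.transpose_transpose, mul_assoc]
      rw [e1, hP', mul_one, Matrix.trace_mul_comm, ← mul_assoc, ← mul_assoc, hP', one_mul,
        trace_mul_transpose_omega hττ hN]
    have hs (i j) : α (e i) (e j) = -α (e j) (e i) := by rw [hα.neg_eq]
    have h0 (i) : α (e i) (e i) = 0 := hα _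
    simp only [Matrix.trace, Fin.sum_univ_four, Matrix.diag_apply, Matrix.mul_apply, formMatrix,
      Matrix.transpose_apply, Matrix.of_apply, h0, hs 1 0, hs 2 0, hs 3 0, hs 2 1, hs 3 1,
      hs 3 2] at htr
    simp only [wedge] at hwα
    have key : (α (e 0) (e 1) - α (e 2) (e 3)) ^ 2 + (α (e 0) (e 2) + α (e 1) (e 3)) ^ 2
        + (α (e 0) (e 3) - α (e 1) (e 2)) ^ 2 = 0 := by
      linear_combination (1 / 2) * htr - hwα
    obtain ⟨k1, k2, k3⟩ := eq_zero_of_sq_add_sq_add_sq key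
    exact ⟨sub_eq_zero.1 k1, eq_neg_of_add_eq_zero_left k2, sub_eq_zero.1 k3⟩
  · rintro ⟨hα, h⟩
    have hμ : 0 < μ b := by
      have := hw 0 0 b
      simp only [wedge, hb, if_true] at this
      simp [omega] at this
      nlinarith
    obtain ⟨h1, h2, h3⟩ := h b hγ hμ
    refine ⟨fun c => 2 * τ * α (b 0) (b c.succ),
      LinearMap.BilinForm.ext_basis b fun i j => ?_⟩
    have hs (i j) : α (b i) (b j) = -α (b j) (b i) := by rw [hα.neg_eq]
    have h0 (i) : α (b i) (b i) = 0 := hα _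
    have e (x w) : 2 * τ * x * (τ / 2 * w) = x * w := by linear_combination x * w * hττ
    simp only [sum_smul_form_apply, hb, e]
    fin_cases i <;> fin_cases j <;>
      simp [omega, h0, h1, h2, h3, hs 1 0, hs 2 0, hs 3 0, hs 2 1, hs 3 1, hs 3 2]

end SelfDual

/-! ### Existence of adapted frames -/

section AdaptedFrameExistence

variable {T : Type*} [AddCommGroup T] [Module ℝ T] {φ : Fin 3 → LinearMap.BilinForm ℝ T}
  {μ : (Fin 4 → T) → ℝ} {γ : LinearMap.BilinForm ℝ T}

/-- An orthonormal frame with `μ e = -1` becomes positive on changing the sign of one vector. -/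
lemma exists_pos_isOrthonormalFrame (hT : Module.finrank ℝ T = 4)
    (hsymm : ∀ u v, γ u v = γ v u) (hpos : ∀ u, u ≠ 0 → 0 < γ u u)
    (hw : ∀ c d e, wedge (φ c) (φ d) e = if c = d then 1 / 2 * μ e else 0)
    (hμ : ∀ e, IsOrthonormalFrame (fun u v => γ u v) e → |μ e| = 1) :
    ∃ e, IsOrthonormalFrame (fun u v => γ u v) e ∧ μ e = 1 := by
  obtain ⟨e, he⟩ := exists_isOrthonormalFrame hT hsymm hpos
  have h := hμ e he
  rcases abs_eq zero_le_one |>.1 h with h | h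
  · exact ⟨e, he, h⟩
  · refine ⟨![-e 0, e 1, e 2, e 3], fun i j => ?_, ?_⟩
    · have := he i j
      fin_cases i <;> fin_cases j <;> simpa using this
    · have h1 := hw 0 0 e
      have h2 := hw 0 0 ![-e 0, e 1, e 2, e 3]
      simp [wedge] at h1 h2
      linarith

/-- An inner product whose self-dual forms include a triple with wedge products `½ δ_cd μ`, and whose
volume form is `μ`, has an orthonormal frame in which the triple is `± ½` the standard one. -/
lemma exists_adapted_frame (hT : Module.finrank ℝ T = 4)
    (hsymm : ∀ u v, γ u v = γ v u) (hpos : ∀ u, u ≠ 0 → 0 < γ u u)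
    (hw : ∀ c d e, wedge (φ c) (φ d) e = if c = d then 1 / 2 * μ e else 0)
    (hμ : ∀ e, IsOrthonormalFrame (fun u v => γ u v) e → |μ e| = 1)
    (hsd : ∀ c, φ c ∈ selfDual (fun u v => γ u v) μ) :
    ∃ (e : Fin 4 → T) (τ : ℝ), IsOrthonormalFrame (fun u v => γ u v) e ∧ (τ = 1 ∨ τ = -1) ∧
      ∀ c i j, φ c (e i) (e j) = τ / 2 * omega c i j := by
  obtain ⟨e, he, hμe⟩ := exists_pos_isOrthonormalFrame hT hsymm hpos hw hμ
  -- self-duality and the wedge products make `2 φ c (e 0, e (k + 1))` an orthogonal matrix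
  let O : Matrix (Fin 3) (Fin 3) ℝ := Matrix.of fun c k => 2 * φ c (e 0) (e k.succ)
  have hO : O * O.transpose = 1 := by
    ext c d
    obtain ⟨c1, c2, c3⟩ := (hsd c).2 e he (by rw [hμe]; exact one_pos)
    obtain ⟨d1, d2, d3⟩ := (hsd d).2 e he (by rw [hμe]; exact one_pos)
    have h := hw c d e
    rw [hμe, wedge, ← c1, ← c3, ← d1, ← d3,
      show φ c (e 1) (e 3) = -φ c (e 0) (e 2) by rw [c2, neg_neg],
      show φ d (e 1) (e 3) = -φ d (e 0) (e 2) by rw [d2, neg_neg]] at h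
    simp only [Matrix.mul_apply, Matrix.transpose_apply, O, Matrix.of_apply, Fin.sum_univ_three,
      Matrix.one_apply]
    rw [show Fin.succ (0 : Fin 3) = 1 from rfl, show Fin.succ (1 : Fin 3) = 2 from rfl,
      show Fin.succ (2 : Fin 3) = 3 from rfl]
    split_ifs at h ⊢ <;> linear_combination 2 * h
  have hO' (c d : Fin 3) : O c 0 * O d 0 + O c 1 * O d 1 + O c 2 * O d 2 =
      if c = d then 1 else 0 := by
    have := congrFun (congrFun hO c) d
    rwa [Matrix.one_apply, Matrix.mul_apply, Fin.sum_univ_three] at this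
  -- rotating `e 1, e 2, e 3` by `O` brings the components `φ c (e 0, ·)` into standard form
  let v : Fin 3 → T := fun k => O k 0 • e 1 + O k 1 • e 2 + O k 2 • e 3
  have hvv (k l) : γ (v k) (v l) = if k = l then 1 else 0 := by
    rw [← hO' k l]
    simp only [v, map_add, map_smul, LinearMap.add_apply, LinearMap.smul_apply, he _ _, smul_eq_mul]
    simp
    ring
  have hev (k) : γ (e 0) (v k) = 0 := by simp [v, he _ _]
  have hve (k) : γ (v k) (e 0) = 0 := by simp [v, he _ _]
  have hφ (c k) : φ c (e 0) (v k) = if c = k then 1 / 2 else 0 := by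
    have := hO' c k
    simp only [O, Matrix.of_apply] at this
    simp only [v, map_add, map_smul, smul_eq_mul]
    simp only [O, Matrix.of_apply]
    rw [show Fin.succ (0 : Fin 3) = 1 from rfl, show Fin.succ (1 : Fin 3) = 2 from rfl,
      show Fin.succ (2 : Fin 3) = 3 from rfl] at *
    split_ifs at this ⊢ <;> linear_combination (1 / 2) * this
  let e' : ℝ → Fin 4 → T := fun σ => ![e 0, σ • v 0, σ • v 1, σ • v 2]
  have he' (σ : ℝ) (hσ : σ = 1 ∨ σ = -1) : IsOrthonormalFrame (fun u v => γ u v) (e' σ) := by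
    have h0 : γ (e 0) (e 0) = 1 := by simpa using he 0 0
    intro i j
    rcases hσ with rfl | rfl <;> fin_cases i <;> fin_cases j <;> simp [e', hvv, hev, hve, h0]
  -- the sign is chosen so that the new frame is positive
  obtain ⟨σ, hσ, hσμ⟩ : ∃ σ : ℝ, (σ = 1 ∨ σ = -1) ∧ 0 < μ (e' σ) := by
    have h : μ (e' (-1)) = -μ (e' 1) := by
      have h1 := hw 0 0 (e' 1)
      have h2 := hw 0 0 (e' (-1))
      simp [wedge, e'] at h1 h2
      simp only [e', neg_smul, one_smul]
      linarith
    rcases abs_eq zero_le_one |>.1 (hμ _ (he' 1 (Or.inl rfl))) with h1 | h1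
    · exact ⟨1, Or.inl rfl, by rw [h1]; exact one_pos⟩
    · exact ⟨-1, Or.inr rfl, by rw [h, h1]; norm_num⟩
  refine ⟨e' σ, σ, he' σ hσ, hσ, fun c i j => ?_⟩
  obtain ⟨h1, h2, h3⟩ := (hsd c).2 _ (he' σ hσ) hσμ
  have hs (i j) : φ c (e' σ i) (e' σ j) = -φ c (e' σ j) (e' σ i) := by rw [(hsd c).1.neg_eq]
  have h0 (i) : φ c (e' σ i) (e' σ i) = 0 := (hsd c).1 _
  have h01 : φ c (e' σ 0) (e' σ 1) = if c = 0 then σ / 2 else 0 := by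
    simp [e', hφ, div_eq_mul_inv]
  have h02 : φ c (e' σ 0) (e' σ 2) = if c = 1 then σ / 2 else 0 := by
    simp [e', hφ, div_eq_mul_inv]
  have h03 : φ c (e' σ 0) (e' σ 3) = if c = 2 then σ / 2 else 0 := by
    simp [e', hφ, div_eq_mul_inv]
  have h23 := h1.symm.trans h01
  have h13 : φ c (e' σ 1) (e' σ 3) = -if c = 1 then σ / 2 else 0 := by
    rw [← h02, h2, neg_neg]
  have h12 := h3.symm.trans h03
  clear_value e'
  fin_cases i <;> fin_cases j <;>
    simp only [Fin.zero_eta, Fin.mk_one, Fin.reduceFinMk, h0, h01, h02, h03, h12, h13, h23, hs 1 0,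
      hs 2 0, hs 3 0, hs 2 1, hs 3 1, hs 3 2] <;> fin_cases c <;> simp [omega]

/-- In the situation of `exists_adapted_frame`, in terms of a basis. -/
lemma isAdapted_of_frame (b : Module.Basis (Fin 4) ℝ T) {e : Fin 4 → T} {τ : ℝ}
    (he : IsOrthonormalFrame (fun u v => γ u v) e) (hτ : τ = 1 ∨ τ = -1)
    (hφ : ∀ c i j, φ c (e i) (e j) = τ / 2 * omega c i j) :
    IsAdapted (formMatrix γ b) (fun c => formMatrix (φ c) b) τ (b.toMatrix e) where
  sign := hτ
  metric := by rw [← formMatrix_eq_conj, isOrthonormalFrame_iff.1 he]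
  form c := by
    rw [← formMatrix_eq_conj]
    ext i j
    simp [formMatrix, hφ]

end AdaptedFrameExistence

/-! ### The curvature forms of a perfect connection at a point -/

section Rotations

variable {W : Type*} [NormedAddCommGroup W] [InnerProductSpace ℝ W]
  (b : OrthonormalBasis (Fin 3) ℝ W)

/-- The infinitesimal rotation `v ↦ b c × v` of a three-dimensional Euclidean space with orthonormal
basis `b`. These are an orthogonal basis of `so(W)`. -/
def rot (c : Fin 3) : Module.End ℝ W :=
  (innerₛₗ ℝ (b (c + 1))).smulRight (b (c + 2)) - (innerₛₗ ℝ (b (c + 2))).smulRight (b (c + 1))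

lemma rot_apply (c : Fin 3) (v : W) :
    rot b c v = inner ℝ (b (c + 1)) v • b (c + 2) - inner ℝ (b (c + 2)) v • b (c + 1) := rfl

lemma inner_basis (c d : Fin 3) : inner ℝ (b c) (b d) = if c = d then (1 : ℝ) else 0 :=
  orthonormal_iff_ite.1 b.orthonormal c d

lemma isSkew_rot (c : Fin 3) : IsSkew (rot b c) := by
  intro v w
  rw [rot_apply, rot_apply, inner_sub_left, inner_sub_right, real_inner_smul_left,
    real_inner_smul_left, real_inner_smul_right, real_inner_smul_right,
    real_inner_comm (b (c + 1)) v, real_inner_comm (b (c + 2)) v]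
  ring

variable {b}

lemma killingInner_rot {ξ : Module.End ℝ W} (hξ : IsSkew ξ) (c : Fin 3) :
    killingInner ξ (rot b c) = 2 * inner ℝ (b (c + 2)) (ξ (b (c + 1))) := by
  have h := hξ (b (c + 1)) (b (c + 2))
  rw [real_inner_comm] at h
  rw [killingInner, LinearMap.trace_eq_sum_inner _ b]
  have e : ∑ d, inner ℝ (b d) ((ξ * rot b c) (b d)) =
      inner ℝ (b (c + 1)) (ξ (b (c + 2))) - inner ℝ (b (c + 2)) (ξ (b (c + 1))) := by
    simp only [Module.End.mul_apply, rot_apply, inner_basis, Fin.sum_univ_three]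
    fin_cases c <;> simp <;> ring
  rw [e]
  linarith

lemma killingInner_rot_rot (c d : Fin 3) :
    killingInner (rot b c) (rot b d) = if c = d then 2 else 0 := by
  rw [killingInner_rot (isSkew_rot b c), rot_apply, inner_sub_right, real_inner_smul_right,
    real_inner_smul_right]
  simp only [inner_basis]
  fin_cases c <;> fin_cases d <;> simp

/-- The expansion of a skew endomorphism in the basis `rot b` of `so(W)`. -/
lemma IsSkew.eq_sum_rot {ξ : Module.End ℝ W} (hξ : IsSkew ξ) :
    ξ = ∑ c, inner ℝ (b (c + 2)) (ξ (b (c + 1))) • rot b c := by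
  have h (c d : Fin 3) : inner ℝ (b c) (ξ (b d)) = -inner ℝ (b d) (ξ (b c)) := by
    rw [← hξ (b d) (b c), real_inner_comm]
  have h0 (c : Fin 3) : inner ℝ (b c) (ξ (b c)) = 0 := by linarith [h c c]
  refine b.toBasis.ext fun d => b.toBasis.ext_elem fun e => ?_
  rw [Fin.sum_univ_three]
  simp only [OrthonormalBasis.coe_toBasis, OrthonormalBasis.coe_toBasis_repr_apply,
    OrthonormalBasis.repr_apply_apply, LinearMap.add_apply, LinearMap.smul_apply, inner_add_right,
    real_inner_smul_right, rot_apply, inner_sub_right, inner_basis]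
  fin_cases d <;> fin_cases e <;> simp [h0]
  exacts [h 2 0, h 0 1, h 1 2]

end Rotations

section PointwiseCurvature

variable {M : Type*} [TopologicalSpace M] [ChartedSpace (EuclideanSpace ℝ (Fin 4)) M]
  [IsManifold (𝓡 4) ∞ M] [T2Space M]
  {E : M → Type*} [TopologicalSpace (TotalSpace (EuclideanSpace ℝ (Fin 3)) E)]
  [∀ x, NormedAddCommGroup (E x)] [∀ x, InnerProductSpace ℝ (E x)]
  [FiberBundle (EuclideanSpace ℝ (Fin 3)) E] [VectorBundle ℝ (EuclideanSpace ℝ (Fin 3)) E]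
  [ContMDiffVectorBundle ∞ (EuclideanSpace ℝ (Fin 3)) E (𝓡 4)]
  (A : CovariantDerivative (𝓡 4) (EuclideanSpace ℝ (Fin 3)) E)
  [A.ContMDiffCovariantDerivative ∞]

lemma curvature_swap (x : M) (u v : TangentSpace (𝓡 4) x) :
    A.curvature x u v = -A.curvature x v u := by
  ext w
  exact A.curvatureAux_swap x _ _ _

/-- The components `½ F_A(rot b c)` of the curvature, in an orthonormal basis of `E_x`: they are
`⟨b (c + 2), F_A(u, v) b (c + 1)⟩`. -/
def soForm (x : M) (b : OrthonormalBasis (Fin 3) ℝ (E x)) (c : Fin 3) :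
    LinearMap.BilinForm ℝ (TangentSpace (𝓡 4) x) :=
  (1 / 2 : ℝ) • curvatureForm A x (rot b c)

variable {A}

lemma soForm_isAlt {x : M} (b : OrthonormalBasis (Fin 3) ℝ (E x)) (c : Fin 3) :
    (soForm A x b c).IsAlt := by
  intro u
  have h : A.curvature x u u = 0 := by
    have := curvature_swap A x u u
    have h2 : (2 : ℝ) • A.curvature x u u = 0 := by
      rw [two_smul]; nth_rewrite 2 [this]; exact add_neg_cancel _
    exact (smul_eq_zero_iff_right two_ne_zero).1 h2
  change (1 / 2 : ℝ) • killingInner (A.curvature x u u) (rot b c) = 0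
  rw [h]
  simp [killingInner]

lemma wedge_soForm (hA : IsPerfect A) {x : M} (b : OrthonormalBasis (Fin 3) ℝ (E x)) (c d : Fin 3)
    (e : Fin 4 → TangentSpace (𝓡 4) x) :
    wedge (soForm A x b c) (soForm A x b d) e =
      if c = d then 1 / 2 * curvatureVolume A x e else 0 := by
  have h := hA.2 x _ _ (isSkew_rot b c) (isSkew_rot b d) e
  rw [killingInner_rot_rot] at h
  have e1 : wedge (soForm A x b c) (soForm A x b d) e =
      1 / 4 * wedge (curvatureForm A x (rot b c)) (curvatureForm A x (rot b d)) e := by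
    simp only [wedge, soForm, LinearMap.smul_apply, smul_eq_mul]
    ring
  rw [e1, h]
  split_ifs <;> ring

/-- The forms `F_A(ξ)` are the combinations of the three components. -/
lemma setOf_curvatureForm {x : M} (b : OrthonormalBasis (Fin 3) ℝ (E x)) :
    {α | ∃ ξ : Module.End ℝ (E x), IsSkew ξ ∧ α = curvatureForm A x ξ} =
      {α | ∃ y : Fin 3 → ℝ, α = ∑ c, y c • soForm A x b c} := by
  have key (y : Fin 3 → ℝ) : curvatureForm A x (∑ c, y c • rot b c) =
      ∑ c, (2 * y c) • soForm A x b c := by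
    ext u v
    rw [sum_smul_form_apply]
    simp only [soForm, LinearMap.smul_apply, curvatureForm, LinearMap.mk₂_apply, killingInner,
      Fin.sum_univ_three, mul_add, map_add, mul_smul_comm, map_smul, smul_eq_mul]
    ring
  ext α
  constructor
  · rintro ⟨ξ, hξ, rfl⟩
    rw [hξ.eq_sum_rot (b := b), key]
    exact ⟨_, rfl⟩
  · rintro ⟨y, rfl⟩
    refine ⟨∑ c, (y c / 2) • rot b c, fun v w => ?_, ?_⟩
    · simp only [LinearMap.sum_apply, LinearMap.smul_apply, sum_inner, inner_sum,
        real_inner_smul_left, real_inner_smul_right, ← Finset.sum_neg_distrib]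
      exact Finset.sum_congr rfl fun c _ => by rw [isSkew_rot b c]; ring
    · rw [key]
      exact Finset.sum_congr rfl fun c _ => by rw [mul_div_cancel₀ _ two_ne_zero]

end PointwiseCurvature

section CurvatureForms

lemma isSkew_of_basis {W : Type*} [NormedAddCommGroup W] [InnerProductSpace ℝ W]
    (b : OrthonormalBasis (Fin 3) ℝ W) {ξ : Module.End ℝ W}
    (h : ∀ c d, inner ℝ (b c) (ξ (b d)) = -inner ℝ (b d) (ξ (b c))) : IsSkew ξ := by
  have e : (innerₗ W).compl₁₂ ξ LinearMap.id = -(innerₗ W).compl₁₂ LinearMap.id ξ := by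
    refine b.toBasis.ext fun c => b.toBasis.ext fun d => ?_
    have := h d c
    simpa [real_inner_comm] using this
  intro v w
  exact congrArg (fun B : W →ₗ[ℝ] W →ₗ[ℝ] ℝ => B v w) e

variable {M : Type*} [TopologicalSpace M] [ChartedSpace (EuclideanSpace ℝ (Fin 4)) M]
  [IsManifold (𝓡 4) ∞ M] [T2Space M]

lemma finrank_tangentSpace (x : M) : Module.finrank ℝ (TangentSpace (𝓡 4) x) = 4 :=
  finrank_euclideanSpace_fin (𝕜 := ℝ) (n := 4)

/-- The basis `∂_0, …, ∂_3` of the tangent space given by the chart at `p`. -/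
def coordBasis {p x : M} (hx : x ∈ (extChartAt (𝓡 4) p).source) :
    Module.Basis (Fin 4) ℝ (TangentSpace (𝓡 4) x) :=
  have : FiniteDimensional ℝ (TangentSpace (𝓡 4) x) :=
    Module.finite_of_finrank_eq_succ (finrank_tangentSpace x)
  basisOfLinearIndependentOfCardEqFinrank (linearIndependent_coordField hx)
    (by rw [finrank_tangentSpace]; rfl)

lemma coordBasis_apply {p x : M} (hx : x ∈ (extChartAt (𝓡 4) p).source) (i : Fin 4) :
    coordBasis hx i = coordField p i x := by
  simp [coordBasis]

variable {E : M → Type*} [TopologicalSpace (TotalSpace (EuclideanSpace ℝ (Fin 3)) E)]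
  [∀ x, NormedAddCommGroup (E x)] [∀ x, InnerProductSpace ℝ (E x)]
  [FiberBundle (EuclideanSpace ℝ (Fin 3)) E] [VectorBundle ℝ (EuclideanSpace ℝ (Fin 3)) E]
  [ContMDiffVectorBundle ∞ (EuclideanSpace ℝ (Fin 3)) E (𝓡 4)]
  [IsContMDiffRiemannianBundle (𝓡 4) ∞ (EuclideanSpace ℝ (Fin 3)) E]
  {A : CovariantDerivative (𝓡 4) (EuclideanSpace ℝ (Fin 3)) E}
  [A.ContMDiffCovariantDerivative ∞]
  {s : Fin 3 → Π x : M, E x} {U : Set M}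

lemma curvCoeff_skew (hA : A.IsMetricCompatible) (hs : IsSmoothOrthonormalFrame s U) (p : M)
    (i j : Fin 4) (c d : Fin 3) {y : EuclideanSpace ℝ (Fin 4)} (hy : y ∈ coordDomain p U) :
    curvCoeff A s p i j c d y = -curvCoeff A s p i j d c y := by
  have hV := isOpen_coordDomain p hs.isOpen
  have h (i : Fin 4) (c d : Fin 3) {z} (hz : z ∈ coordDomain p U) :=
    connCoeff_skew hA hs p i c d hz
  have hd (i j : Fin 4) : partialDeriv i (connCoeff A s p j c d) y =
      -partialDeriv i (connCoeff A s p j d c) y := by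
    rw [← partialDeriv_neg, partialDeriv_congr hV hy fun z hz => h j c d hz]
  rw [curvCoeff_eq hA hs p i j c d hy, curvCoeff_eq hA hs p i j d c hy, hd i j, hd j i, neg_add,
    ← Finset.sum_neg_distrib]
  congr 1
  · ring
  · refine Finset.sum_congr rfl fun b _ => ?_
    rw [h i c b hy, h j b d hy, h j c b hy, h i b d hy]
    ring

/-- The curvature of a metric connection takes values in `so(E)`. -/
lemma isSkew_curvature (hA : A.IsMetricCompatible) (x : M) (u v : TangentSpace (𝓡 4) x) :
    IsSkew (A.curvature x u v) := by
  obtain ⟨s, U, hs, hx⟩ := exists_isSmoothOrthonormalFrame (E := E) x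
  have hxs := mem_extChartAt_source (I := 𝓡 4) x
  have hφ := extChartAt_to_inv (I := 𝓡 4) x
  have hy : extChartAt (𝓡 4) x x ∈ coordDomain x U :=
    ⟨mem_extChartAt_target x, by rwa [Set.mem_preimage, hφ]⟩
  have h0 (i j : Fin 4) : IsSkew (A.curvature x (coordField x i x) (coordField x j x)) := by
    refine isSkew_of_basis (hs.basis hx) fun c d => ?_
    have h (z : M) (hz : (extChartAt (𝓡 4) x).symm (extChartAt (𝓡 4) x x) = z) :
        inner ℝ (s c z) (A.curvature z (coordField x i z) (coordField x j z) (s d z)) =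
          -inner ℝ (s d z) (A.curvature z (coordField x i z) (coordField x j z) (s c z)) := by
      subst hz
      exact curvCoeff_skew hA hs x i j c d hy
    simpa only [hs.basis_apply] using h x hφ
  intro a b
  let β : LinearMap.BilinForm ℝ (TangentSpace (𝓡 4) x) :=
    LinearMap.mk₂ ℝ (fun u v => inner ℝ (A.curvature x u v a) b + inner ℝ a (A.curvature x u v b))
      (fun u u' v => by simp [inner_add_left, inner_add_right]; ring)
      (fun c u v => by simp [inner_smul_left, inner_smul_right]; ring)
      (fun u v v' => by simp [inner_add_left, inner_add_right]; ring)
      (fun c u v => by simp [inner_smul_left, inner_smul_right]; ring)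
  have hβ : β = 0 := by
    refine LinearMap.BilinForm.ext_basis (coordBasis hxs) fun i j => ?_
    rw [coordBasis_apply, coordBasis_apply]
    change inner ℝ _ b + inner ℝ a _ = (0 : ℝ)
    rw [h0 i j a b, neg_add_cancel]
  exact eq_neg_of_add_eq_zero_left
    (congrArg (fun B : LinearMap.BilinForm ℝ (TangentSpace (𝓡 4) x) => B u v) hβ)

lemma soForm_apply (hA : A.IsMetricCompatible) {x : M} (b : OrthonormalBasis (Fin 3) ℝ (E x))
    (c : Fin 3) (u v : TangentSpace (𝓡 4) x) :
    soForm A x b c u v = inner ℝ (b (c + 2)) (A.curvature x u v (b (c + 1))) := by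
  change (1 / 2 : ℝ) • killingInner (A.curvature x u v) (rot b c) = _
  rw [killingInner_rot (isSkew_curvature hA x u v), smul_eq_mul]
  ring

lemma soForm_definite (hA : A.IsMetricCompatible) (hperf : IsPerfect A) {x : M}
    (b : OrthonormalBasis (Fin 3) ℝ (E x)) (u v : TangentSpace (𝓡 4) x)
    (h : LinearIndependent ℝ ![u, v]) : ∃ c, soForm A x b c u v ≠ 0 := by
  by_contra! h0
  refine hperf.1 x u v h ?_
  rw [(isSkew_curvature hA x u v).eq_sum_rot (b := b)]
  refine Finset.sum_eq_zero fun c _ => ?_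
  rw [← soForm_apply hA, h0 c, zero_smul]

/-- A Riemannian metric at a point, as a bilinear form. -/
def metricForm (g : ContMDiffRiemannianMetric (𝓡 4) ∞ (EuclideanSpace ℝ (Fin 4))
      (fun x : M => TangentSpace (𝓡 4) x)) (x : M) :
    LinearMap.BilinForm ℝ (TangentSpace (𝓡 4) x) :=
  LinearMap.mk₂ ℝ (fun u v => g.inner x u v) (fun u u' v => by simp) (fun c u v => by simp)
    (fun u v v' => by simp) (fun c u v => by simp)

lemma metricForm_apply (g : ContMDiffRiemannianMetric (𝓡 4) ∞ (EuclideanSpace ℝ (Fin 4))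
      (fun x : M => TangentSpace (𝓡 4) x)) (x : M) (u v : TangentSpace (𝓡 4) x) :
    metricForm g x u v = g.inner x u v := rfl

/-- The inner product `γ` on `T_x M` has volume form `μ_A`, up to sign, and its self-dual forms are
the forms `F_A(ξ)`. -/
structure IsMetricAt (A : CovariantDerivative (𝓡 4) (EuclideanSpace ℝ (Fin 3)) E)
    [A.ContMDiffCovariantDerivative ∞] (x : M)
    (γ : LinearMap.BilinForm ℝ (TangentSpace (𝓡 4) x)) : Prop where
  symm (u v : TangentSpace (𝓡 4) x) : γ u v = γ v u
  pos (u : TangentSpace (𝓡 4) x) (hu : u ≠ 0) : 0 < γ u u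
  volume (e : Fin 4 → TangentSpace (𝓡 4) x) (he : IsOrthonormalFrame (fun u v => γ u v) e) :
    |curvatureVolume A x e| = 1
  selfDual_eq : {α | ∃ ξ : Module.End ℝ (E x), IsSkew ξ ∧ α = curvatureForm A x ξ} =
    selfDual (fun u v => γ u v) (curvatureVolume A x)

lemma IsMetricOf.isMetricAt {g : ContMDiffRiemannianMetric (𝓡 4) ∞ (EuclideanSpace ℝ (Fin 4))
    (fun x : M => TangentSpace (𝓡 4) x)} (hg : IsMetricOf A g) (x : M) :
    IsMetricAt A x (metricForm g x) :=
  ⟨g.symm x, g.pos x, (hg x).1, (hg x).2⟩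

/-- The metric of a perfect connection has, at each point, an orthonormal frame in which the
components of the curvature are `± ½` the standard self-dual forms. -/
lemma IsMetricAt.exists_frame (hperf : IsPerfect A) {x : M}
    {γ : LinearMap.BilinForm ℝ (TangentSpace (𝓡 4) x)} (hγ : IsMetricAt A x γ)
    (b : OrthonormalBasis (Fin 3) ℝ (E x)) :
    ∃ (e : Fin 4 → TangentSpace (𝓡 4) x) (τ : ℝ),
      IsOrthonormalFrame (fun u v => γ u v) e ∧ (τ = 1 ∨ τ = -1) ∧
      ∀ c i j, soForm A x b c (e i) (e j) = τ / 2 * omega c i j :=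
  exists_adapted_frame (finrank_tangentSpace x) hγ.symm hγ.pos (wedge_soForm hperf b)
    hγ.volume fun c => by
      rw [← hγ.selfDual_eq, setOf_curvatureForm b]
      exact ⟨Pi.single c 1, by
        rw [Finset.sum_eq_single c (fun d _ hd => by rw [Pi.single_eq_of_ne hd, zero_smul])
          (fun h => absurd (Finset.mem_univ c) h), Pi.single_eq_same, one_smul]⟩

end CurvatureForms

/-! ### The metric of a perfect connection in coordinates -/

section CoordinateMetric

variable {M : Type*} [TopologicalSpace M] [ChartedSpace (EuclideanSpace ℝ (Fin 4)) M]
  [IsManifold (𝓡 4) ∞ M] [T2Space M]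
  {g : ContMDiffRiemannianMetric (𝓡 4) ∞ (EuclideanSpace ℝ (Fin 4))
      (fun x : M => TangentSpace (𝓡 4) x)}

lemma coordMetric_eq_formMatrix {p : M} {y : EuclideanSpace ℝ (Fin 4)}
    (hy : y ∈ (extChartAt (𝓡 4) p).target) :
    coordMetric g p y = formMatrix (metricForm g ((extChartAt (𝓡 4) p).symm y))
      (coordBasis ((extChartAt (𝓡 4) p).map_target hy)) := by
  ext i j
  simp only [formMatrix, Matrix.of_apply]
  rw [coordBasis_apply, coordBasis_apply, coordField_symm hy, coordField_symm hy]
  rfl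

lemma matSmooth_coordMetric (p : M) (U : Set M) :
    MatSmooth (coordDomain p U) (coordMetric g p) := by
  intro i j
  have h : ContMDiffOn (𝓡 4) 𝓘(ℝ, ℝ) ∞
      (fun x => g.inner x (coordField p i x) (coordField p j x))
      ((extChartAt (𝓡 4) p).source ∩ U) := by
    have h1 := (g.contMDiff.contMDiffOn (s := (extChartAt (𝓡 4) p).source)).clm_bundle_apply₂
      (contMDiffOn_coordField p i) (contMDiffOn_coordField p j)
    intro x hx
    have h2 := h1 x hx.1
    simp only [contMDiffWithinAt_totalSpace] at h2
    exact h2.2.mono Set.inter_subset_left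
  refine (contDiffOn_comp_symm h).congr fun y hy => ?_
  rw [coordMetric_eq_formMatrix hy.1]
  simp only [formMatrix, Matrix.of_apply]
  rw [coordBasis_apply, coordBasis_apply, metricForm_apply]

variable {E : M → Type*} [TopologicalSpace (TotalSpace (EuclideanSpace ℝ (Fin 3)) E)]
  [∀ x, NormedAddCommGroup (E x)] [∀ x, InnerProductSpace ℝ (E x)]
  [FiberBundle (EuclideanSpace ℝ (Fin 3)) E] [VectorBundle ℝ (EuclideanSpace ℝ (Fin 3)) E]
  [ContMDiffVectorBundle ∞ (EuclideanSpace ℝ (Fin 3)) E (𝓡 4)]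
  [IsContMDiffRiemannianBundle (𝓡 4) ∞ (EuclideanSpace ℝ (Fin 3)) E]
  {A : CovariantDerivative (𝓡 4) (EuclideanSpace ℝ (Fin 3)) E}
  [A.ContMDiffCovariantDerivative ∞]
  {s : Fin 3 → Π x : M, E x} {U : Set M}

/-- The components of the curvature in a frame `s` and the chart at `p`, for the basis `rot` of
`so(3)`. -/
def curvMat (A : CovariantDerivative (𝓡 4) (EuclideanSpace ℝ (Fin 3)) E)
    [A.ContMDiffCovariantDerivative ∞] (s : Fin 3 → Π x : M, E x) (p : M) (c : Fin 3)
    (y : EuclideanSpace ℝ (Fin 4)) : Matrix (Fin 4) (Fin 4) ℝ :=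
  Matrix.of fun i j => curvCoeff A s p i j (c + 2) (c + 1) y

lemma curvMat_eq_formMatrix (hA : A.IsMetricCompatible) (hs : IsSmoothOrthonormalFrame s U) {p : M}
    {y : EuclideanSpace ℝ (Fin 4)} (hy : y ∈ coordDomain p U) (c : Fin 3) :
    curvMat A s p c y = formMatrix (soForm A _ (hs.basis hy.2) c)
      (coordBasis ((extChartAt (𝓡 4) p).map_target hy.1)) := by
  ext i j
  simp only [formMatrix, Matrix.of_apply]
  rw [coordBasis_apply, coordBasis_apply, soForm_apply hA, hs.basis_apply, hs.basis_apply]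
  rfl

/-- The `so(3)` form of `F = dA + A ∧ A`: the matrix product in `A ∧ A` becomes the cross product
`a^{c+1} ∧ a^{c+2}` of the components. -/
lemma curvMat_eq (hA : A.IsMetricCompatible) (hs : IsSmoothOrthonormalFrame s U) (p : M)
    {y : EuclideanSpace ℝ (Fin 4)} (hy : y ∈ coordDomain p U) (c : Fin 3) (i j : Fin 4) :
    curvMat A s p c y i j =
      partialDeriv i (connCoeff A s p j (c + 2) (c + 1)) y
        - partialDeriv j (connCoeff A s p i (c + 2) (c + 1)) y
        + (connCoeff A s p i (c + 1 + 2) (c + 1 + 1) y * connCoeff A s p j (c + 2 + 2) (c + 2 + 1) y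
          - connCoeff A s p i (c + 2 + 2) (c + 2 + 1) y
            * connCoeff A s p j (c + 1 + 2) (c + 1 + 1) y) := by
  have h (i : Fin 4) (c d : Fin 3) := connCoeff_skew hA hs p i c d hy
  have h0 (i : Fin 4) (c : Fin 3) : connCoeff A s p i c c y = 0 := by linarith [h i c c]
  rw [curvMat, Matrix.of_apply, curvCoeff_eq hA hs p i j _ _ hy]
  congr 1
  rw [succ_add_two, succ_succ, add_two_add_two, add_two_succ, Fin.sum_univ_three]
  have a1 := h i 0 1
  have a2 := h i 0 2
  have a3 := h i 1 2
  have b1 := h j 0 1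
  have b2 := h j 0 2
  have b3 := h j 1 2
  fin_cases c <;> simp [h0, a1, a2, a3, b1, b2, b3, mul_comm]

lemma matSmooth_curvMat (hA : A.IsMetricCompatible) (hs : IsSmoothOrthonormalFrame s U) (p : M)
    (c : Fin 3) : MatSmooth (coordDomain p U) (curvMat A s p c) := fun i j => by
  have hV := isOpen_coordDomain p hs.isOpen
  have ha (i : Fin 4) (c d : Fin 3) := contDiffOn_connCoeff (A := A) hs p i c d
  have hp (i j : Fin 4) (c d : Fin 3) := ContDiffOn.partialDeriv (ha j c d) hV i
  exact (((hp i j _ _).sub (hp j i _ _)).add (((ha i _ _).mul (ha j _ _)).sub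
    ((ha i _ _).mul (ha j _ _)))).congr fun y hy => curvMat_eq hA hs p hy c i j

/-- A frame adapted to the curvature at a point yields an adapted frame in coordinates. -/
lemma isAdapted_coord (hA : A.IsMetricCompatible) (hs : IsSmoothOrthonormalFrame s U) {p : M}
    {y : EuclideanSpace ℝ (Fin 4)} (hy : y ∈ coordDomain p U)
    {e : Fin 4 → TangentSpace (𝓡 4) ((extChartAt (𝓡 4) p).symm y)} {τ : ℝ}
    (he : IsOrthonormalFrame (fun u v => metricForm g _ u v) e) (hτ : τ = 1 ∨ τ = -1)
    (hφ : ∀ c i j, soForm A _ (hs.basis hy.2) c (e i) (e j) = τ / 2 * omega c i j) :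
    IsAdapted (coordMetric g p y) (fun c => curvMat A s p c y) τ
      ((coordBasis ((extChartAt (𝓡 4) p).map_target hy.1)).toMatrix e) := by
  rw [coordMetric_eq_formMatrix hy.1, funext fun c => curvMat_eq_formMatrix hA hs hy c]
  exact isAdapted_of_frame _ he hτ hφ

/-- A perfect connection and its metric satisfy `IsPerfectCoord` in each chart and orthonormal
frame. -/
lemma isPerfectCoord (hA : A.IsMetricCompatible) (hperf : IsPerfect A) (hg : IsMetricOf A g)
    (hs : IsSmoothOrthonormalFrame s U) (p : M) :
    IsPerfectCoord (coordDomain p U) (coordMetric g p)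
      (fun i c => connCoeff A s p i (c + 2) (c + 1)) (curvMat A s p) := by
  have had {y} (hy : y ∈ coordDomain p U) :
      ∃ τ P, IsAdapted (coordMetric g p y) (fun c => curvMat A s p c y) τ P := by
    obtain ⟨e, τ, he, hτ, hφ⟩ := (hg.isMetricAt _).exists_frame hperf (hs.basis hy.2)
    exact ⟨_, _, isAdapted_coord hA hs hy he hτ hφ⟩
  exact
  { isOpen := isOpen_coordDomain p hs.isOpen
    smooth := matSmooth_coordMetric p U
    symm := fun hy => by
      ext i j
      rw [Matrix.transpose_apply, coordMetric_eq_formMatrix hy.1]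
      exact g.symm _ _ _
    det_ne_zero := fun hy => by
      obtain ⟨τ, P, h⟩ := had hy
      have := congrArg Matrix.det h.metric_mul_inv
      rw [Matrix.det_mul, Matrix.det_one] at this
      exact left_ne_zero_of_mul_eq_one this
    smooth_conn := fun i c => contDiffOn_connCoeff hs p i _ _
    curv := fun c i j y hy => curvMat_eq hA hs p hy c i j
    adapted := had }

end CoordinateMetric

/-! ### Curvature of the metric of a perfect connection -/

lemma bilinForm_eq_sum {T : Type*} [AddCommGroup T] [Module ℝ T] (β : LinearMap.BilinForm ℝ T)
    (b : Module.Basis (Fin 4) ℝ T) (u v : T) :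
    β u v = ∑ i, ∑ j, b.repr u i * b.repr v j * formMatrix β b i j := by
  conv_lhs => rw [← b.sum_repr u, ← b.sum_repr v]
  simp only [map_sum, map_smul, LinearMap.sum_apply, LinearMap.smul_apply, smul_eq_mul, formMatrix,
    Matrix.of_apply]
  rw [Finset.sum_comm]
  refine Finset.sum_congr rfl fun i _ => ?_
  rw [Finset.mul_sum]
  exact Finset.sum_congr rfl fun j _ => by ring

section CurvatureOfMetric

variable {M : Type*} [TopologicalSpace M] [ChartedSpace (EuclideanSpace ℝ (Fin 4)) M]
  [IsManifold (𝓡 4) ∞ M] [T2Space M]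
  {g : ContMDiffRiemannianMetric (𝓡 4) ∞ (EuclideanSpace ℝ (Fin 4))
      (fun x : M => TangentSpace (𝓡 4) x)}

lemma coordMetric_extChartAt {p x : M} (hx : x ∈ (extChartAt (𝓡 4) p).source) :
    coordMetric g p (extChartAt (𝓡 4) p x) = formMatrix (metricForm g x) (coordBasis hx) := by
  obtain ⟨y, hy, rfl⟩ : ∃ y ∈ (extChartAt (𝓡 4) p).target, (extChartAt (𝓡 4) p).symm y = x :=
    ⟨_, (extChartAt (𝓡 4) p).map_source hx, (extChartAt (𝓡 4) p).left_inv hx⟩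
  rw [(extChartAt (𝓡 4) p).right_inv hy, coordMetric_eq_formMatrix hy]

lemma extChartAt_mem_coordDomain {p x : M} {U : Set M} (hx : x ∈ (extChartAt (𝓡 4) p).source)
    (hxU : x ∈ U) : extChartAt (𝓡 4) p x ∈ coordDomain p U :=
  ⟨(extChartAt (𝓡 4) p).map_source hx,
    by rwa [Set.mem_preimage, (extChartAt (𝓡 4) p).left_inv hx]⟩

lemma riemannCoord_eq (p : M) (l i j k : Fin 4) :
    riemannCoord g p l i j k =
      riemannMat (coordMetric g p) i j (extChartAt (𝓡 4) p p) l k := by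
  rw [riemannMat, Matrix.add_apply, Matrix.sub_apply, Matrix.sub_apply, Matrix.mul_apply,
    Matrix.mul_apply, ← Finset.sum_sub_distrib]
  rfl

/-- The chart basis at the centre of the chart is the standard basis of `ℝ⁴`. -/
lemma coordBasis_self_repr (p : M) (u : TangentSpace (𝓡 4) p) (i : Fin 4) :
    (coordBasis (mem_extChartAt_source (I := 𝓡 4) p)).repr u i = coords u i := by
  set b := coordBasis (mem_extChartAt_source (I := 𝓡 4) p)
  have h : u = ∑ i, coords u i • b i := by
    have h1 := (EuclideanSpace.basisFun (Fin 4) ℝ).sum_repr (show EuclideanSpace ℝ (Fin 4) from u)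
    refine h1.symm.trans (Finset.sum_congr rfl fun i _ => ?_)
    rw [coordBasis_apply, coordField_self, EuclideanSpace.basisFun_apply]
    rfl
  conv_lhs => rw [h]
  rw [b.repr_sum_self]

lemma inner_eq_sum (p : M) (u v : TangentSpace (𝓡 4) p) :
    g.inner p u v = ∑ i, ∑ j, coords u i * coords v j *
      coordMetric g p (extChartAt (𝓡 4) p p) i j := by
  rw [coordMetric_extChartAt (mem_extChartAt_source p), ← metricForm_apply,
    bilinForm_eq_sum _ (coordBasis (mem_extChartAt_source (I := 𝓡 4) p))]
  simp only [coordBasis_self_repr]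

lemma riemann_eq_sum (p : M) (u v w z : TangentSpace (𝓡 4) p) :
    riemann g p u v w z = ∑ i, ∑ j, coords u i * coords v j * ∑ k, ∑ m, coords w k * coords z m *
      ((riemannMat (coordMetric g p) i j (extChartAt (𝓡 4) p p)).transpose *
        coordMetric g p (extChartAt (𝓡 4) p p)) k m := by
  rw [riemann, inner_eq_sum]
  simp only [Matrix.mul_apply, Matrix.transpose_apply, ← riemannCoord_eq]
  have e (l : Fin 4) : coords (p := p) (show TangentSpace (𝓡 4) p from WithLp.toLp 2 fun l =>
      ∑ i, ∑ j, ∑ k, riemannCoord g p l i j k * coords u i * coords v j * coords w k) l =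
      ∑ i, ∑ j, ∑ k, riemannCoord g p l i j k * coords u i * coords v j * coords w k := rfl
  simp only [e, Finset.sum_mul, Finset.mul_sum]
  rw [Finset.sum_comm_cycle]
  refine Finset.sum_congr rfl fun i _ => ?_
  rw [Finset.sum_comm_cycle]
  refine Finset.sum_congr rfl fun j _ => ?_
  rw [Finset.sum_comm_cycle]
  refine Finset.sum_congr rfl fun k _ => ?_
  rw [Finset.sum_comm]
  exact Finset.sum_congr rfl fun m _ => Finset.sum_congr rfl fun l _ => by ring

variable {E : M → Type*} [TopologicalSpace (TotalSpace (EuclideanSpace ℝ (Fin 3)) E)]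
  [∀ x, NormedAddCommGroup (E x)] [∀ x, InnerProductSpace ℝ (E x)]
  [FiberBundle (EuclideanSpace ℝ (Fin 3)) E] [VectorBundle ℝ (EuclideanSpace ℝ (Fin 3)) E]
  [ContMDiffVectorBundle ∞ (EuclideanSpace ℝ (Fin 3)) E (𝓡 4)]
  [IsContMDiffRiemannianBundle (𝓡 4) ∞ (EuclideanSpace ℝ (Fin 3)) E]
  {A : CovariantDerivative (𝓡 4) (EuclideanSpace ℝ (Fin 3)) E}
  [A.ContMDiffCovariantDerivative ∞]
  {s : Fin 3 → Π x : M, E x} {U : Set M}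

lemma curvMat_extChartAt (hA : A.IsMetricCompatible) (hs : IsSmoothOrthonormalFrame s U) {p x : M}
    (hx : x ∈ (extChartAt (𝓡 4) p).source) (hxU : x ∈ U) (c : Fin 3) :
    curvMat A s p c (extChartAt (𝓡 4) p x) =
      formMatrix (soForm A x (hs.basis hxU) c) (coordBasis hx) := by
  obtain ⟨y, hy, rfl⟩ : ∃ y ∈ (extChartAt (𝓡 4) p).target, (extChartAt (𝓡 4) p).symm y = x :=
    ⟨_, (extChartAt (𝓡 4) p).map_source hx, (extChartAt (𝓡 4) p).left_inv hx⟩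
  rw [(extChartAt (𝓡 4) p).right_inv hy, curvMat_eq_formMatrix hA hs ⟨hy, hxU⟩]

/-- The sign `τ` depends on the point and the frame of `E` only, not on the chart. -/
lemma IsMetricAt.exists_isAdapted (hA : A.IsMetricCompatible) (hperf : IsPerfect A)
    (hs : IsSmoothOrthonormalFrame s U) {x : M}
    {γ : LinearMap.BilinForm ℝ (TangentSpace (𝓡 4) x)} (hγ : IsMetricAt A x γ) (hxU : x ∈ U) :
    ∃ τ, ∀ (p : M) (hx : x ∈ (extChartAt (𝓡 4) p).source), ∃ P,
      IsAdapted (formMatrix γ (coordBasis hx)) (fun c => curvMat A s p c (extChartAt (𝓡 4) p x))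
        τ P := by
  obtain ⟨e, τ, he, hτ, hφ⟩ := hγ.exists_frame hperf (hs.basis hxU)
  refine ⟨τ, fun p hx => ⟨(coordBasis hx).toMatrix e, ?_⟩⟩
  rw [funext fun c => curvMat_extChartAt hA hs hx hxU c]
  exact isAdapted_of_frame _ he hτ hφ

lemma sum_riemannCoord (hA : A.IsMetricCompatible) (hperf : IsPerfect A) (hg : IsMetricOf A g)
    (hs : IsSmoothOrthonormalFrame s U) {p : M} (hp : p ∈ U)
    {τ : ℝ} {P : Matrix (Fin 4) (Fin 4) ℝ}
    (hP : IsAdapted (coordMetric g p (extChartAt (𝓡 4) p p))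
      (fun c => curvMat A s p c (extChartAt (𝓡 4) p p)) τ P) (j k : Fin 4) :
    ∑ i, riemannCoord g p i i j k =
      -(3 / 2) * τ * coordMetric g p (extChartAt (𝓡 4) p p) j k := by
  simp only [riemannCoord_eq]
  exact (isPerfectCoord hA hperf hg hs p).sum_riemannMat
    (extChartAt_mem_coordDomain (mem_extChartAt_source p) hp) hP j k

lemma ricci_eq (hA : A.IsMetricCompatible) (hperf : IsPerfect A) (hg : IsMetricOf A g)
    (hs : IsSmoothOrthonormalFrame s U) {p : M} (hp : p ∈ U)
    {τ : ℝ} {P : Matrix (Fin 4) (Fin 4) ℝ}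
    (hP : IsAdapted (coordMetric g p (extChartAt (𝓡 4) p p))
      (fun c => curvMat A s p c (extChartAt (𝓡 4) p p)) τ P) (v w : TangentSpace (𝓡 4) p) :
    ricci g p v w = -(3 / 2) * τ * g.inner p v w := by
  rw [ricci, inner_eq_sum, Finset.sum_comm_cycle, Finset.sum_comm_cycle, Finset.mul_sum]
  refine Finset.sum_congr rfl fun j _ => ?_
  rw [Finset.mul_sum]
  refine Finset.sum_congr rfl fun k _ => ?_
  rw [← Finset.sum_mul, ← Finset.sum_mul, sum_riemannCoord hA hperf hg hs hp hP]
  ring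

lemma scalarCurvature_eq (hA : A.IsMetricCompatible) (hperf : IsPerfect A) (hg : IsMetricOf A g)
    (hs : IsSmoothOrthonormalFrame s U) {p : M} (hp : p ∈ U)
    {τ : ℝ} {P : Matrix (Fin 4) (Fin 4) ℝ}
    (hP : IsAdapted (coordMetric g p (extChartAt (𝓡 4) p p))
      (fun c => curvMat A s p c (extChartAt (𝓡 4) p p)) τ P) :
    scalarCurvature g p = -6 * τ := by
  have hG : (coordMetric g p (extChartAt (𝓡 4) p p)).transpose =
      coordMetric g p (extChartAt (𝓡 4) p p) := (isPerfectCoord hA hperf hg hs p).symm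
    (extChartAt_mem_coordDomain (mem_extChartAt_source p) hp)
  have h1 := congrArg Matrix.trace hP.metric_inv_mul
  rw [scalarCurvature, Finset.sum_comm_cycle, Finset.sum_comm_cycle]
  simp only [← Finset.mul_sum, sum_riemannCoord hA hperf hg hs hp hP]
  rw [Matrix.trace_one, Matrix.trace] at h1
  have e : ∑ j, ∑ k, (coordMetric g p (extChartAt (𝓡 4) p p))⁻¹ j k *
      (-(3 / 2) * τ * coordMetric g p (extChartAt (𝓡 4) p p) j k) = -(3 / 2) * τ * (4 : ℝ) := by
    rw [show (4 : ℝ) = (Fintype.card (Fin 4) : ℝ) by simp, ← h1, Finset.mul_sum]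
    refine Finset.sum_congr rfl fun j _ => ?_
    rw [Matrix.diag_apply, Matrix.mul_apply, Finset.mul_sum]
    refine Finset.sum_congr rfl fun k _ => ?_
    rw [← congrFun (congrFun hG k) j, Matrix.transpose_apply]
    ring
  rw [e]
  ring

end CurvatureOfMetric

/-! ### Anti-self-duality and the scalar curvature -/

section OrthonormalExpansion

variable {T : Type*} [AddCommGroup T] [Module ℝ T] {γ : LinearMap.BilinForm ℝ T} {e : Fin 4 → T}

lemma sum_smul_orthonormalFrame (hT : Module.finrank ℝ T = 4)
    (he : IsOrthonormalFrame (fun u v => γ u v) e) (v : T) : ∑ k, γ v (e k) • e k = v := by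
  have : FiniteDimensional ℝ T := Module.finite_of_finrank_eq_succ hT
  have key (x : Fin 4 → ℝ) (l : Fin 4) : γ (∑ k, x k • e k) (e l) = x l := by
    have h (k) : γ (e k) (e l) = if k = l then 1 else 0 := he k l
    simp [h]
  have hli : LinearIndependent ℝ e := by
    rw [Fintype.linearIndependent_iff]
    intro x hx l
    rw [← key x l, hx]
    simp
  let b := basisOfLinearIndependentOfCardEqFinrank hli (by rw [hT]; rfl)
  have hb : ⇑b = e := coe_basisOfLinearIndependentOfCardEqFinrank _ _
  have h := b.sum_repr v
  rw [hb] at h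
  conv_rhs => rw [← h]
  refine Finset.sum_congr rfl fun k _ => ?_
  rw [← key (b.repr v) k, h]

/-- The curvature tensor of constant curvature acts on 2-forms as a scalar. -/
lemma sum_inner_mul_inner_mul_form (hT : Module.finrank ℝ T = 4)
    (he : IsOrthonormalFrame (fun u v => γ u v) e) (α : LinearMap.BilinForm ℝ T) (u v : T) :
    ∑ k, ∑ l, γ u (e k) * γ v (e l) * α (e k) (e l) = α u v := by
  conv_rhs => rw [← sum_smul_orthonormalFrame hT he u, ← sum_smul_orthonormalFrame hT he v]
  simp only [map_sum, map_smul, LinearMap.sum_apply, LinearMap.smul_apply, smul_eq_mul]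
  rw [Finset.sum_comm]
  refine Finset.sum_congr rfl fun k _ => ?_
  rw [Finset.mul_sum]
  exact Finset.sum_congr rfl fun l _ => by ring

end OrthonormalExpansion

section Conclusions

variable {M : Type*} [TopologicalSpace M] [ChartedSpace (EuclideanSpace ℝ (Fin 4)) M]
  [IsManifold (𝓡 4) ∞ M] [T2Space M]
  {g : ContMDiffRiemannianMetric (𝓡 4) ∞ (EuclideanSpace ℝ (Fin 4))
      (fun x : M => TangentSpace (𝓡 4) x)}
  {E : M → Type*} [TopologicalSpace (TotalSpace (EuclideanSpace ℝ (Fin 3)) E)]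
  [∀ x, NormedAddCommGroup (E x)] [∀ x, InnerProductSpace ℝ (E x)]
  [FiberBundle (EuclideanSpace ℝ (Fin 3)) E] [VectorBundle ℝ (EuclideanSpace ℝ (Fin 3)) E]
  [ContMDiffVectorBundle ∞ (EuclideanSpace ℝ (Fin 3)) E (𝓡 4)]
  [IsContMDiffRiemannianBundle (𝓡 4) ∞ (EuclideanSpace ℝ (Fin 3)) E]
  {A : CovariantDerivative (𝓡 4) (EuclideanSpace ℝ (Fin 3)) E}
  [A.ContMDiffCovariantDerivative ∞]
  {s : Fin 3 → Π x : M, E x} {U : Set M}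

lemma exists_isAdapted (hA : A.IsMetricCompatible) (hperf : IsPerfect A) (hg : IsMetricOf A g)
    (hs : IsSmoothOrthonormalFrame s U) {p : M} (hp : p ∈ U) :
    ∃ τ P, IsAdapted (coordMetric g p (extChartAt (𝓡 4) p p))
      (fun c => curvMat A s p c (extChartAt (𝓡 4) p p)) τ P := by
  obtain ⟨τ, hτ⟩ := (hg.isMetricAt p).exists_isAdapted hA hperf hs hp
  obtain ⟨P, hP⟩ := hτ p (mem_extChartAt_source p)
  exact ⟨τ, P, by rwa [coordMetric_extChartAt]⟩

lemma scalarCurvature_ne_zero (hA : A.IsMetricCompatible) (hperf : IsPerfect A)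
    (hg : IsMetricOf A g) (p : M) : scalarCurvature g p ≠ 0 := by
  obtain ⟨s, U, hs, hp⟩ := exists_isSmoothOrthonormalFrame (E := E) p
  obtain ⟨τ, P, hP⟩ := exists_isAdapted hA hperf hg hs hp
  rw [scalarCurvature_eq hA hperf hg hs hp hP]
  rcases hP.sign with rfl | rfl <;> norm_num

/-- The curvature operator is multiplication by `τ` on self-dual forms. -/
lemma sum_riemann_mul_soForm (hA : A.IsMetricCompatible) (hperf : IsPerfect A)
    (hg : IsMetricOf A g) (hs : IsSmoothOrthonormalFrame s U) {p : M} (hp : p ∈ U)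
    {τ : ℝ} {P : Matrix (Fin 4) (Fin 4) ℝ}
    (hP : IsAdapted (coordMetric g p (extChartAt (𝓡 4) p p))
      (fun c => curvMat A s p c (extChartAt (𝓡 4) p p)) τ P)
    {e : Fin 4 → TangentSpace (𝓡 4) p}
    (he : IsOrthonormalFrame (fun u v => metricForm g p u v) e) (c : Fin 3)
    (u v : TangentSpace (𝓡 4) p) :
    ∑ k, ∑ l, riemann g p u v (e k) (e l) * soForm A p (hs.basis hp) c (e k) (e l) =
      τ * soForm A p (hs.basis hp) c u v := by
  have hsrc := mem_extChartAt_source (I := 𝓡 4) p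
  have hy := extChartAt_mem_coordDomain hsrc hp
  have hpc := isPerfectCoord hA hperf hg hs p
  set y := extChartAt (𝓡 4) p p
  set G := coordMetric g p y with hG
  set F := curvMat A s p c y with hF
  set Q := (coordBasis hsrc).toMatrix e
  have hQ (k a) : Q k a = coords (e a) k := by
    rw [← coordBasis_self_repr]; rfl
  have hQG : Q.transpose * G * Q = 1 := by
    rw [hG, coordMetric_extChartAt hsrc, ← formMatrix_eq_conj, isOrthonormalFrame_iff.1 he]
  have hFe (k l) : soForm A p (hs.basis hp) c (e k) (e l) = (Q.transpose * F * Q) k l := by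
    rw [hF, curvMat_extChartAt hA hs hsrc hp, ← formMatrix_eq_conj]; rfl
  have hRe (k l) : riemann g p u v (e k) (e l) = ∑ i, ∑ j, coords u i * coords v j *
      (Q.transpose * ((riemannMat (coordMetric g p) i j y).transpose * G) * Q) k l := by
    rw [riemann_eq_sum]
    refine Finset.sum_congr rfl fun i _ => Finset.sum_congr rfl fun j _ => ?_
    congr 1
    rw [Matrix.mul_apply, Finset.sum_comm]
    refine Finset.sum_congr rfl fun m _ => ?_
    rw [Matrix.mul_apply, Finset.sum_mul]
    refine Finset.sum_congr rfl fun k' _ => ?_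
    rw [← hQ, ← hQ, Matrix.transpose_apply]
    ring
  have hGT : G.transpose = G := hpc.symm hy
  have hinv := inv_eq_of_orthonormal hQG
  have htr (i j : Fin 4) : ∑ k, ∑ l,
      (Q.transpose * ((riemannMat (coordMetric g p) i j y).transpose * G) * Q) k l *
        (Q.transpose * F * Q) k l = τ * F i j := by
    rw [← hpc.trace_riemannMat hy hP i j c]
    set R := riemannMat (coordMetric g p) i j y
    have e1 : ∑ k, ∑ l, (Q.transpose * (R.transpose * G) * Q) k l * (Q.transpose * F * Q) k l =
        ((Q.transpose * (R.transpose * G) * Q) * (Q.transpose * F * Q).transpose).trace := by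
      simp only [Matrix.trace, Matrix.diag_apply,
        Matrix.mul_apply (M := Q.transpose * (R.transpose * G) * Q), Matrix.transpose_apply]
    have hFT : F.transpose = -F := hpc.form_transpose hy c
    have hGinv : G⁻¹.transpose = G⁻¹ := by rw [Matrix.transpose_nonsing_inv, hGT]
    have hGG : G * G⁻¹ = 1 := hP.metric_mul_inv
    have e2 : (Q.transpose * (R.transpose * G) * Q) * (Q.transpose * F * Q).transpose =
        Q.transpose * (R.transpose * (G * (Q * Q.transpose)) * F.transpose * Q) := by
      simp only [Matrix.transpose_mul, Matrix.transpose_transpose, mul_assoc]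
    have e3 : R.transpose * F.transpose * G⁻¹ = (G⁻¹ * F * R).transpose := by
      rw [Matrix.transpose_mul, Matrix.transpose_mul, hGinv, mul_assoc]
    rw [e1, e2, Matrix.trace_mul_comm, mul_assoc _ Q, ← hinv, hGG, mul_one, e3,
      Matrix.trace_transpose, Matrix.trace_mul_comm, ← mul_assoc]
  have hFuv : soForm A p (hs.basis hp) c u v = ∑ i, ∑ j, coords u i * coords v j * F i j := by
    rw [hF, curvMat_extChartAt hA hs hsrc hp, bilinForm_eq_sum _ (coordBasis hsrc)]
    simp only [coordBasis_self_repr]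
  rw [hFuv, Finset.mul_sum]
  simp only [hRe, hFe, Finset.sum_mul]
  rw [Finset.sum_comm_cycle]
  refine Finset.sum_congr rfl fun i _ => ?_
  rw [Finset.sum_comm_cycle, Finset.mul_sum]
  refine Finset.sum_congr rfl fun j _ => ?_
  rw [mul_left_comm, ← htr, Finset.mul_sum]
  refine Finset.sum_congr rfl fun k _ => ?_
  rw [Finset.mul_sum]
  exact Finset.sum_congr rfl fun l _ => by ring

/-- The Riemann tensor and the terms of the Weyl tensor built from the metric all act on self-dual
forms as scalars, and these add up to zero. -/
lemma isAntiSelfDual (hA : A.IsMetricCompatible) (hperf : IsPerfect A)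
    (hg : IsMetricOf A g) : IsAntiSelfDual g (curvatureVolume A) := by
  intro p e he α hα u v
  obtain ⟨s, U, hs, hp⟩ := exists_isSmoothOrthonormalFrame (E := E) p
  obtain ⟨τ, P, hP⟩ := exists_isAdapted hA hperf hg hs hp
  rw [← (hg p).2, setOf_curvatureForm (hs.basis hp)] at hα
  obtain ⟨y, hy⟩ := hα
  have hαalt : α u v = -α v u := by
    have h (c) : soForm A p (hs.basis hp) c u v = -soForm A p (hs.basis hp) c v u := by
      rw [(soForm_isAlt (hs.basis hp) c).neg_eq]
    rw [hy, sum_smul_form_apply, sum_smul_form_apply, h, h, h]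
    ring
  have h1 : ∑ k, ∑ l, riemann g p u v (e k) (e l) * α (e k) (e l) = τ * α u v := by
    have h (c) := sum_riemann_mul_soForm hA hperf hg hs hp hP he c u v
    rw [hy, sum_smul_form_apply, mul_add, mul_add, mul_left_comm, ← h, mul_left_comm τ, ← h,
      mul_left_comm τ, ← h]
    simp only [sum_smul_form_apply, Finset.mul_sum, ← Finset.sum_add_distrib]
    exact Finset.sum_congr rfl fun k _ => Finset.sum_congr rfl fun l _ => by ring
  have h2 (u v : TangentSpace (𝓡 4) p) :=
    sum_inner_mul_inner_mul_form (finrank_tangentSpace p) (γ := metricForm g p) he α u v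
  have hw (k l) : weyl g p u v (e k) (e l) * α (e k) (e l) =
      riemann g p u v (e k) (e l) * α (e k) (e l)
        + τ / 2 * (metricForm g p v (e k) * metricForm g p u (e l) * α (e k) (e l))
        - τ / 2 * (metricForm g p u (e k) * metricForm g p v (e l) * α (e k) (e l)) := by
    rw [weyl, scalarCurvature_eq hA hperf hg hs hp hP]
    simp only [ricci_eq hA hperf hg hs hp hP, metricForm_apply]
    ring
  simp only [hw, Finset.sum_add_distrib, Finset.sum_sub_distrib, ← Finset.mul_sum, h1, h2]
  rw [hαalt]
  ring

end Conclusions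

/-! ### The sign, uniqueness and the Einstein condition -/

section Sign

/-- The matrix that is, up to sign and a factor two, the metric for which the forms `f c` are half
the standard self-dual ones. -/
def metricOfForms (f : Fin 3 → Matrix (Fin 4) (Fin 4) ℝ) : Matrix (Fin 4) (Fin 4) ℝ :=
  f 1 * (f 2)⁻¹ * f 0

namespace IsAdapted

variable {G P : Matrix (Fin 4) (Fin 4) ℝ} {f : Fin 3 → Matrix (Fin 4) (Fin 4) ℝ} {τ : ℝ}

lemma metric_zero_zero (h : IsAdapted G f τ P) : G 0 0 = -(2 * τ) * metricOfForms f 0 0 := by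
  conv_lhs => rw [h.metric_eq_forms]
  rfl

lemma metricOfForms_ne_zero (h : IsAdapted G f τ P) (hG : 0 < G 0 0) :
    metricOfForms f 0 0 ≠ 0 := by
  intro h0
  rw [h.metric_zero_zero, h0, mul_zero] at hG
  exact lt_irrefl _ hG

/-- Positivity of the metric determines the sign `τ`. -/
lemma sign_eq (h : IsAdapted G f τ P) (hG : 0 < G 0 0) :
    τ = -(|metricOfForms f 0 0| / metricOfForms f 0 0) := by
  have h0 := h.metricOfForms_ne_zero hG
  rw [h.metric_zero_zero] at hG
  rcases h.sign with rfl | rfl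
  · rw [abs_of_neg (by linarith), neg_div, div_self h0, neg_neg]
  · rw [abs_of_pos (by linarith), div_self h0]

lemma metric_eq_metricOfForms (h : IsAdapted G f τ P) (hG : 0 < G 0 0) :
    G = (2 * (|metricOfForms f 0 0| / metricOfForms f 0 0)) • metricOfForms f := by
  conv_lhs => rw [h.metric_eq_forms, h.sign_eq hG]
  rw [mul_neg, neg_neg]; rfl

end IsAdapted

end Sign

section Uniqueness

variable {M : Type*} [TopologicalSpace M] [ChartedSpace (EuclideanSpace ℝ (Fin 4)) M]
  [IsManifold (𝓡 4) ∞ M] [T2Space M]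
  {g : ContMDiffRiemannianMetric (𝓡 4) ∞ (EuclideanSpace ℝ (Fin 4))
      (fun x : M => TangentSpace (𝓡 4) x)}
  {E : M → Type*} [TopologicalSpace (TotalSpace (EuclideanSpace ℝ (Fin 3)) E)]
  [∀ x, NormedAddCommGroup (E x)] [∀ x, InnerProductSpace ℝ (E x)]
  [FiberBundle (EuclideanSpace ℝ (Fin 3)) E] [VectorBundle ℝ (EuclideanSpace ℝ (Fin 3)) E]
  [ContMDiffVectorBundle ∞ (EuclideanSpace ℝ (Fin 3)) E (𝓡 4)]
  [IsContMDiffRiemannianBundle (𝓡 4) ∞ (EuclideanSpace ℝ (Fin 3)) E]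
  {A : CovariantDerivative (𝓡 4) (EuclideanSpace ℝ (Fin 3)) E}
  [A.ContMDiffCovariantDerivative ∞]
  {s : Fin 3 → Π x : M, E x} {U : Set M}

lemma IsMetricAt.formMatrix_pos {x : M} {γ : LinearMap.BilinForm ℝ (TangentSpace (𝓡 4) x)}
    (hγ : IsMetricAt A x γ) (b : Module.Basis (Fin 4) ℝ (TangentSpace (𝓡 4) x)) :
    0 < formMatrix γ b 0 0 := hγ.pos _ (b.ne_zero 0)

/-- The inner product is determined by the matrices of the curvature forms. -/
lemma IsMetricAt.unique (hA : A.IsMetricCompatible) (hperf : IsPerfect A) {x : M}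
    {γ γ' : LinearMap.BilinForm ℝ (TangentSpace (𝓡 4) x)} (hγ : IsMetricAt A x γ)
    (hγ' : IsMetricAt A x γ') : γ = γ' := by
  obtain ⟨s, U, hs, hx⟩ := exists_isSmoothOrthonormalFrame (E := E) x
  have hsrc := mem_extChartAt_source (I := 𝓡 4) x
  obtain ⟨τ, hτ⟩ := hγ.exists_isAdapted hA hperf hs hx
  obtain ⟨τ', hτ'⟩ := hγ'.exists_isAdapted hA hperf hs hx
  obtain ⟨P, hP⟩ := hτ x hsrc
  obtain ⟨P', hP'⟩ := hτ' x hsrc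
  have h : formMatrix γ (coordBasis hsrc) = formMatrix γ' (coordBasis hsrc) := by
    rw [hP.metric_eq_metricOfForms (hγ.formMatrix_pos _),
      hP'.metric_eq_metricOfForms (hγ'.formMatrix_pos _)]
  exact LinearMap.BilinForm.ext_basis (coordBasis hsrc) fun i j => congrFun (congrFun h i) j

lemma matSmooth_metricOfForms {V : Set (EuclideanSpace ℝ (Fin 4))}
    {f : Fin 3 → EuclideanSpace ℝ (Fin 4) → Matrix (Fin 4) (Fin 4) ℝ} (hf : ∀ c, MatSmooth V (f c))
    (h0 : ∀ y ∈ V, (f 2 y).det ≠ 0) : MatSmooth V (fun y => metricOfForms fun c => f c y) :=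
  ((hf 1).mul ((hf 2).inv h0)).mul (hf 0)

lemma IsAdapted.det_form_ne_zero {G P : Matrix (Fin 4) (Fin 4) ℝ}
    {f : Fin 3 → Matrix (Fin 4) (Fin 4) ℝ} {τ : ℝ} (h : IsAdapted G f τ P) (c : Fin 3) :
    (f c).det ≠ 0 := by
  have h1 := congrArg Matrix.det (h.form_mul_self c)
  intro h0
  have h2 := congrArg Matrix.det h.metric_mul_inv
  rw [Matrix.det_mul, Matrix.det_one] at h2
  rw [Matrix.det_mul, h0, mul_zero, Matrix.det_smul] at h1
  have h3 : G.det ≠ 0 := left_ne_zero_of_mul_eq_one h2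
  have h4 : (-(1 / 4 : ℝ)) ^ Fintype.card (Fin 4) ≠ 0 := pow_ne_zero _ (by norm_num)
  exact (mul_ne_zero h4 h3) h1.symm

/-- The inner product for which the basis of `exists_basis_of_definite` is orthonormal. -/
lemma exists_isMetricAt (hA : A.IsMetricCompatible) (hperf : IsPerfect A) (x : M) :
    ∃ (γ : LinearMap.BilinForm ℝ (TangentSpace (𝓡 4) x)), IsMetricAt A x γ := by
  obtain ⟨s, U, hs, hx⟩ := exists_isSmoothOrthonormalFrame (E := E) x
  obtain ⟨b, τ, hτ, hb⟩ := exists_basis_of_definite (φ := soForm A x (hs.basis hx))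
    (finrank_tangentSpace x) (soForm_isAlt _) (soForm_definite hA hperf _)
    (wedge_soForm hperf (hs.basis hx))
  let γ : LinearMap.BilinForm ℝ (TangentSpace (𝓡 4) x) :=
    LinearMap.mk₂ ℝ (fun u v => ∑ i, b.repr u i * b.repr v i)
      (fun u u' v => by simp [add_mul, Finset.sum_add_distrib])
      (fun c u v => by simp [mul_assoc, Finset.mul_sum])
      (fun u v v' => by simp [mul_add, Finset.sum_add_distrib])
      (fun c u v => by simp [mul_left_comm, Finset.mul_sum])
  have hγ : IsOrthonormalFrame (fun u v => γ u v) b := fun i j => by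
    simp [γ, Finsupp.single_apply]
  refine ⟨γ, fun u v => ?_, fun u hu => ?_, fun e he => ?_, ?_⟩
  · change ∑ i, b.repr u i * b.repr v i = ∑ i, b.repr v i * b.repr u i
    exact Finset.sum_congr rfl fun i _ => mul_comm (b.repr u i) (b.repr v i)
  · obtain ⟨i, hi⟩ : ∃ i, b.repr u i ≠ 0 := by
      by_contra! h
      exact hu (b.repr.map_eq_zero_iff.1 (Finsupp.ext h))
    exact Finset.sum_pos' (fun j _ => mul_self_nonneg _) ⟨i, Finset.mem_univ i, mul_self_pos.2 hi⟩
  · exact abs_eq_one_of_isOrthonormalFrame (soForm_isAlt _) (wedge_soForm hperf _) hτ hb hγ he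
  · rw [setOf_curvatureForm (hs.basis hx)]
    exact span_eq_selfDual (soForm_isAlt _) (wedge_soForm hperf _) hτ hb hγ

lemma det_curvMat_ne_zero (hA : A.IsMetricCompatible) (hperf : IsPerfect A)
    (hs : IsSmoothOrthonormalFrame s U) {p : M} {y : EuclideanSpace ℝ (Fin 4)}
    (hy : y ∈ coordDomain p U) (c : Fin 3) : (curvMat A s p c y).det ≠ 0 := by
  obtain ⟨γ, hγ⟩ := exists_isMetricAt hA hperf ((extChartAt (𝓡 4) p).symm y)
  obtain ⟨τ, hτ⟩ := hγ.exists_isAdapted hA hperf hs hy.2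
  obtain ⟨P, hP⟩ := hτ p ((extChartAt (𝓡 4) p).map_target hy.1)
  have := hP.det_form_ne_zero c
  rwa [(extChartAt (𝓡 4) p).right_inv hy.1] at this

lemma matSmooth_metricOfForms_curvMat (hA : A.IsMetricCompatible) (hperf : IsPerfect A)
    (hs : IsSmoothOrthonormalFrame s U) (p : M) :
    MatSmooth (coordDomain p U) (fun y => metricOfForms fun c => curvMat A s p c y) :=
  matSmooth_metricOfForms (fun c => matSmooth_curvMat hA hs p c)
    fun _ hy => det_curvMat_ne_zero hA hperf hs hy 2

/-- The constant is `-(3 / 2) τ`, and by continuity of the curvature `τ` is locally constant. -/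
lemma isEinstein (hA : A.IsMetricCompatible) (hperf : IsPerfect A) (hg : IsMetricOf A g) :
    IsEinstein g := by
  have h0 : ∀ p : M, ∃ c : ℝ, ∀ v w : TangentSpace (𝓡 4) p,
      ricci g p v w = c * g.inner p v w := fun p => by
    obtain ⟨s, U, hs, hp⟩ := exists_isSmoothOrthonormalFrame (E := E) p
    obtain ⟨τ, P, hP⟩ := exists_isAdapted hA hperf hg hs hp
    exact ⟨_, ricci_eq hA hperf hg hs hp hP⟩
  choose c hc using h0
  refine ⟨c, ?_, hc⟩
  rw [IsLocallyConstant.iff_eventually_eq]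
  intro p
  obtain ⟨s, U, hs, hp⟩ := exists_isSmoothOrthonormalFrame (E := E) p
  have hsrc := mem_extChartAt_source (I := 𝓡 4) p
  let N (x : M) : ℝ := metricOfForms (fun d => curvMat A s p d (extChartAt (𝓡 4) p x)) 0 0
  -- near `p` the Einstein constant is determined by the sign of `N`
  have key (x : M) (hx : x ∈ (extChartAt (𝓡 4) p).source) (hxU : x ∈ U) :
      c x = 3 / 2 * (|N x| / N x) ∧ N x ≠ 0 := by
    obtain ⟨τ, hτ⟩ := (hg.isMetricAt x).exists_isAdapted hA hperf hs hxU
    -- the Ricci tensor at `x` is computed in the chart at `x`, and `N` in the chart at `p`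
    obtain ⟨P, hP⟩ := hτ x (mem_extChartAt_source x)
    obtain ⟨P', hP'⟩ := hτ p hx
    rw [← coordMetric_extChartAt] at hP
    have h1 := hP'.sign_eq ((hg.isMetricAt x).formMatrix_pos _)
    have hb := (hg.isMetricAt x).formMatrix_pos (coordBasis hx)
    refine ⟨?_, hP'.metricOfForms_ne_zero hb⟩
    have h2 := ricci_eq hA hperf hg hs hxU hP (coordBasis hx 0) (coordBasis hx 0)
    rw [hc] at h2
    have h3 := mul_right_cancel₀ (show g.inner x (coordBasis hx 0) (coordBasis hx 0) ≠ 0 from hb.ne')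
      h2
    rw [h3, h1]
    ring
  have hcont : ContinuousAt N p := by
    have h1 := (matSmooth_metricOfForms_curvMat hA hperf hs p 0 0).continuousOn.continuousAt
      ((isOpen_coordDomain p hs.isOpen).mem_nhds (extChartAt_mem_coordDomain hsrc hp))
    exact ContinuousAt.comp (f := extChartAt (𝓡 4) p) h1 (continuousAt_extChartAt p)
  have hNp := (key p hsrc hp).2
  have hpos : ∀ᶠ x in 𝓝 p, 0 < N x * N p :=
    (hcont.mul continuousAt_const).eventually_const_lt (mul_self_pos.2 hNp)
  filter_upwards [hpos, hs.isOpen.mem_nhds hp,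
    (isOpen_extChartAt_source (I := 𝓡 4) p).mem_nhds hsrc] with x hx hxU hxs
  rw [(key x hxs hxU).1, (key p hsrc hp).1]
  rcases pos_and_pos_or_neg_and_neg_of_mul_pos hx with ⟨h1, h2⟩ | ⟨h1, h2⟩
  · rw [abs_of_pos h1, abs_of_pos h2, div_self h1.ne', div_self h2.ne']
  · rw [abs_of_neg h1, abs_of_neg h2, neg_div, neg_div, div_self h1.ne, div_self h2.ne]

end Uniqueness

/-! ### Existence of the metric -/

section Construction

/-- The unit ball of an inner product on a finite-dimensional space is bounded. -/
lemma isVonNBounded_of_orthonormalFrame {T : Type*} [AddCommGroup T] [Module ℝ T]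
    [TopologicalSpace T] [IsTopologicalAddGroup T] [ContinuousSMul ℝ T]
    (hT : Module.finrank ℝ T = 4) {γ : LinearMap.BilinForm ℝ T}
    {e : Fin 4 → T} (he : IsOrthonormalFrame (fun u v => γ u v) e) :
    Bornology.IsVonNBounded ℝ {v : T | γ v v < 1} := by
  let L : (Fin 4 → ℝ) →L[ℝ] T :=
    LinearMap.toContinuousLinearMap (Fintype.linearCombination ℝ e)
  refine ((NormedSpace.isVonNBounded_ball ℝ (Fin 4 → ℝ) 1).image L).subset fun v hv => ?_
  have h := sum_smul_orthonormalFrame hT he v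
  refine ⟨fun k => γ v (e k), ?_, h⟩
  have h1 : γ v v = ∑ k, γ v (e k) * γ v (e k) := by
    have h2 := congrArg (γ v) h
    rw [map_sum] at h2
    rw [← h2]
    exact Finset.sum_congr rfl fun k _ => by rw [map_smul, smul_eq_mul]
  rw [mem_ball_zero_iff, pi_norm_lt_iff one_pos]
  intro k
  have h2 : γ v (e k) * γ v (e k) ≤ γ v v := by
    rw [h1]
    exact Finset.single_le_sum (f := fun k => γ v (e k) * γ v (e k))
      (fun k _ => mul_self_nonneg _) (Finset.mem_univ k)
  have h3 : γ v (e k) ^ 2 < 1 := by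
    rw [pow_two]; exact h2.trans_lt hv
  exact (sq_lt_one_iff_abs_lt_one _).1 h3

variable {M : Type*} [TopologicalSpace M] [ChartedSpace (EuclideanSpace ℝ (Fin 4)) M]
  [IsManifold (𝓡 4) ∞ M] [T2Space M]

instance (x : M) : FiniteDimensional ℝ (TangentSpace (𝓡 4) x) :=
  Module.finite_of_finrank_eq_succ (finrank_tangentSpace x)

instance (x : M) : T2Space (TangentSpace (𝓡 4) x) :=
  inferInstanceAs (T2Space (EuclideanSpace ℝ (Fin 4)))

/-- A field of bilinear forms is smooth at `p` if its components in the chart at `p` are. -/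
lemma contMDiffAt_of_coordField
    {B : ∀ x : M, TangentSpace (𝓡 4) x →L[ℝ] TangentSpace (𝓡 4) x →L[ℝ] ℝ}
    {p : M} (h : ∀ i j, ContMDiffAt (𝓡 4) 𝓘(ℝ, ℝ) ∞
      (fun x => B x (coordField p i x) (coordField p j x)) p) :
    ContMDiffAt (𝓡 4) ((𝓡 4).prod
      𝓘(ℝ, EuclideanSpace ℝ (Fin 4) →L[ℝ] EuclideanSpace ℝ (Fin 4) →L[ℝ] ℝ)) ∞
      (fun x => TotalSpace.mk' (EuclideanSpace ℝ (Fin 4) →L[ℝ] EuclideanSpace ℝ (Fin 4) →L[ℝ] ℝ)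
        (E := fun x => TangentSpace (𝓡 4) x →L[ℝ] TangentSpace (𝓡 4) x →L[ℝ] ℝ) x (B x)) p := by
  rw [contMDiffAt_hom_bundle]
  refine ⟨contMDiffAt_id, ?_⟩
  let C (i j : Fin 4) : EuclideanSpace ℝ (Fin 4) →L[ℝ] EuclideanSpace ℝ (Fin 4) →L[ℝ] ℝ :=
    (EuclideanSpace.proj i).smulRight (EuclideanSpace.proj (𝕜 := ℝ) j)
  have h1 : ContMDiffAt (𝓡 4)
      𝓘(ℝ, EuclideanSpace ℝ (Fin 4) →L[ℝ] EuclideanSpace ℝ (Fin 4) →L[ℝ] ℝ) ∞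
      (fun x => ∑ i, ∑ j, B x (coordField p i x) (coordField p j x) • C i j) p :=
    ContMDiffAt.sum fun i _ => ContMDiffAt.sum fun j _ => (h i j).smul contMDiffAt_const
  refine h1.congr_of_eventuallyEq ?_
  filter_upwards [(trivializationAt (EuclideanSpace ℝ (Fin 4)) (TangentSpace (𝓡 4))
    p).open_baseSet.mem_nhds (FiberBundle.mem_baseSet_trivializationAt' p)] with x hx
  ext v w
  rw [inCoordinates_apply_eq₂ hx hx (by simp)]
  have e (v : EuclideanSpace ℝ (Fin 4)) :
      (trivializationAt (EuclideanSpace ℝ (Fin 4)) (TangentSpace (𝓡 4)) p).symm x v =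
        ∑ i, v i • coordField p i x := by
    have h1 := (EuclideanSpace.basisFun (Fin 4) ℝ).sum_repr v
    rw [← Bundle.Trivialization.symmL_apply (R := ℝ) _ hx]
    conv_lhs => rw [← h1]
    rw [map_sum]
    refine Finset.sum_congr rfl fun i _ => ?_
    rw [map_smul, EuclideanSpace.basisFun_apply]
    rfl
  rw [e, e]
  simp only [map_sum, map_smul, sum_apply, smul_apply, C]
  simp [Finset.mul_sum]
  rw [Finset.sum_comm]
  exact Finset.sum_congr rfl fun i _ => Finset.sum_congr rfl fun j _ => by ring

variable {E : M → Type*} [TopologicalSpace (TotalSpace (EuclideanSpace ℝ (Fin 3)) E)]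
  [∀ x, NormedAddCommGroup (E x)] [∀ x, InnerProductSpace ℝ (E x)]
  [FiberBundle (EuclideanSpace ℝ (Fin 3)) E] [VectorBundle ℝ (EuclideanSpace ℝ (Fin 3)) E]
  [ContMDiffVectorBundle ∞ (EuclideanSpace ℝ (Fin 3)) E (𝓡 4)]
  [IsContMDiffRiemannianBundle (𝓡 4) ∞ (EuclideanSpace ℝ (Fin 3)) E]
  {A : CovariantDerivative (𝓡 4) (EuclideanSpace ℝ (Fin 3)) E}
  [A.ContMDiffCovariantDerivative ∞]

/-- The inner products determined by a perfect connection depend smoothly on the point. -/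
lemma contMDiffAt_isMetricAt (hA : A.IsMetricCompatible) (hperf : IsPerfect A)
    {γ : ∀ x : M, LinearMap.BilinForm ℝ (TangentSpace (𝓡 4) x)} (hγ : ∀ x, IsMetricAt A x (γ x))
    (p : M) (i j : Fin 4) : ContMDiffAt (𝓡 4) 𝓘(ℝ, ℝ) ∞
      (fun x => γ x (coordField p i x) (coordField p j x)) p := by
  obtain ⟨s, U, hs, hp⟩ := exists_isSmoothOrthonormalFrame (E := E) p
  have hsrc := mem_extChartAt_source (I := 𝓡 4) p
  let N (y : EuclideanSpace ℝ (Fin 4)) : Matrix (Fin 4) (Fin 4) ℝ :=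
    metricOfForms fun d => curvMat A s p d y
  have key (x : M) (hx : x ∈ (extChartAt (𝓡 4) p).source) (hxU : x ∈ U) :
      N (extChartAt (𝓡 4) p x) 0 0 ≠ 0 ∧ γ x (coordField p i x) (coordField p j x) =
        2 * (|N (extChartAt (𝓡 4) p x) 0 0| / N (extChartAt (𝓡 4) p x) 0 0) *
          N (extChartAt (𝓡 4) p x) i j := by
    obtain ⟨τ, hτ⟩ := (hγ x).exists_isAdapted hA hperf hs hxU
    obtain ⟨P, hP⟩ := hτ p hx
    have hpos := (hγ x).formMatrix_pos (coordBasis hx)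
    refine ⟨hP.metricOfForms_ne_zero hpos, ?_⟩
    have h := congrFun (congrFun (hP.metric_eq_metricOfForms hpos) i) j
    simp only [formMatrix, Matrix.of_apply] at h
    rw [coordBasis_apply, coordBasis_apply] at h
    exact h
  have hN (i j : Fin 4) : ContDiffAt ℝ ∞ (fun y => N y i j) (extChartAt (𝓡 4) p p) :=
    (matSmooth_metricOfForms_curvMat hA hperf hs p i j).contDiffAt
      ((isOpen_coordDomain p hs.isOpen).mem_nhds (extChartAt_mem_coordDomain hsrc hp))
  have h0 := (key p hsrc hp).1
  have h1 : ContDiffAt ℝ ∞ (fun y => 2 * (|N y 0 0| / N y 0 0) * N y i j) (extChartAt (𝓡 4) p p) :=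
    (contDiffAt_const.mul (((hN 0 0).abs h0).div (hN 0 0) h0)).mul (hN i j)
  refine (ContMDiffAt.comp (I' := 𝓘(ℝ, EuclideanSpace ℝ (Fin 4))) p h1.contMDiffAt
    contMDiffAt_extChartAt).congr_of_eventuallyEq ?_
  filter_upwards [hs.isOpen.mem_nhds hp, (isOpen_extChartAt_source (I := 𝓡 4) p).mem_nhds hsrc]
    with x hxU hx
  exact (key x hx hxU).2

/-- The metric `g_A`. -/
lemma exists_isMetricOf (hA : A.IsMetricCompatible) (hperf : IsPerfect A) :
    ∃ g : ContMDiffRiemannianMetric (𝓡 4) ∞ (EuclideanSpace ℝ (Fin 4))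
      (fun x : M => TangentSpace (𝓡 4) x), IsMetricOf A g := by
  choose γ hγ using exists_isMetricAt (M := M) hA hperf
  refine ⟨{
    inner := fun x => (γ x).toContinuousBilinearMap
    symm := fun x => (hγ x).symm
    pos := fun x => (hγ x).pos
    isVonNBounded := fun x => ?_
    contMDiff := fun p => contMDiffAt_of_coordField fun i j =>
      contMDiffAt_isMetricAt hA hperf hγ p i j }, fun x => ⟨(hγ x).volume, (hγ x).selfDual_eq⟩⟩
  obtain ⟨e, he⟩ := exists_isOrthonormalFrame (finrank_tangentSpace x) (hγ x).symm (hγ x).pos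
  exact isVonNBounded_of_orthonormalFrame (finrank_tangentSpace x) he

lemma isMetricOf_unique (hA : A.IsMetricCompatible) (hperf : IsPerfect A)
    {g g' : ContMDiffRiemannianMetric (𝓡 4) ∞ (EuclideanSpace ℝ (Fin 4))
      (fun x : M => TangentSpace (𝓡 4) x)} (hg : IsMetricOf A g) (hg' : IsMetricOf A g') :
    g = g' := by
  have h : g.inner = g'.inner := by
    funext x
    have := (hg.isMetricAt x).unique hA hperf (hg'.isMetricAt x)
    ext u v
    exact congrArg (fun B : LinearMap.BilinForm ℝ (TangentSpace (𝓡 4) x) => B u v) this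
  cases g
  cases g'
  simpa using h

end Construction

end FourManifold

end

theorem mainTheorem1
    {M : Type*} [TopologicalSpace M] [T2Space M]
    [ChartedSpace (EuclideanSpace ℝ (Fin 4)) M] [IsManifold (𝓡 4) ∞ M]
    {E : M → Type*} [TopologicalSpace (TotalSpace (EuclideanSpace ℝ (Fin 3)) E)]
    [∀ x, NormedAddCommGroup (E x)] [∀ x, InnerProductSpace ℝ (E x)]
    [FiberBundle (EuclideanSpace ℝ (Fin 3)) E] [VectorBundle ℝ (EuclideanSpace ℝ (Fin 3)) E]
    [ContMDiffVectorBundle ∞ (EuclideanSpace ℝ (Fin 3)) E (𝓡 4)]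
    [IsContMDiffRiemannianBundle (𝓡 4) ∞ (EuclideanSpace ℝ (Fin 3)) E]
    (A : CovariantDerivative (𝓡 4) (EuclideanSpace ℝ (Fin 3)) E)
    [A.ContMDiffCovariantDerivative ∞]
    (hmetric : A.IsMetricCompatible)
    (hperfect : FourManifold.IsPerfect A) :
    (∃! g : ContMDiffRiemannianMetric (𝓡 4) ∞ (EuclideanSpace ℝ (Fin 4))
        (fun x : M => TangentSpace (𝓡 4) x), FourManifold.IsMetricOf A g) ∧
    ∀ g : ContMDiffRiemannianMetric (𝓡 4) ∞ (EuclideanSpace ℝ (Fin 4))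
        (fun x : M => TangentSpace (𝓡 4) x), FourManifold.IsMetricOf A g →
      FourManifold.IsAntiSelfDual g (FourManifold.curvatureVolume A) ∧
      FourManifold.IsEinstein g ∧
      ∀ p : M, FourManifold.scalarCurvature g p ≠ 0 := by
  obtain ⟨g, hg⟩ := FourManifold.exists_isMetricOf hmetric hperfect
  exact ⟨⟨g, hg, fun g' hg' => FourManifold.isMetricOf_unique hmetric hperfect hg' hg⟩,
    fun g hg => ⟨FourManifold.isAntiSelfDual hmetric hperfect hg,
      FourManifold.isEinstein hmetric hperfect hg,
      FourManifold.scalarCurvature_ne_zero hmetric hperfect hg⟩⟩
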